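/- **Theorem (Approximating the soft LinUCB).** Let $d,A,T\ge 1$ be integers and $\sigma,b_a,B_a,B_w,\lambda>0$. *Environment.* A stochastic linear bandit has a parameter $\mathbf w^*\in\mathbb R^d$ with $\|\mathbf w^*\|_2\le B_w$ and, for each round $t\in[T]$, an action set $\mathbb A_t=\{\mathbf a_{t,1},\dots,\mathbf a_{t,A}\}\subset\mathbb R^d$ with $b_a\le\|\mathbf a_{t,k}\|_2\le B_a$. In round $t$ the learner chooses $\mathbf a_t\in\mathbb A_t$ and receives $r_t=\langle\mathbf a_t,\mathbf w^*\rangle+\varepsilon_t$ with noise $|\varepsilon_t|\le\sigma$. Write $s_t=\mathbb A_t$ and $D_{t-1}=(s_1,\mathbf a_1,r_1,\dots,s_{t-1},\mathbf a_{t-1},r_{t-1})$. *Soft LinUCB.* Let $\mathbf w^t=\arg\min_{\mathbf w}\sum_{j<t}(r_j-\langle\mathbf a_j,\mathbf w\rangle)^2+\lambda\|\mathbf w\|_2^2$, $\mathbf A_t=\lambda I_d+\sum_{j<t}\mathbf a_j\mathbf a_j^\top$, $$\alpha=\sqrt\lambda B_w+\sigma\sqrt{2\log(2B_aB_wT)+d\log\tfrac{d\lambda+TB_a^2}{d\lambda}}$$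 (the root being read as $0$ if the radicand is negative) and $v^*_{tk}=\langle\mathbf a_{t,k},\mathbf w^t\rangle+\alpha(\mathbf a_{t,k}^\top\mathbf A_t^{-1}\mathbf a_{t,k})^{1/2}$. Given $(D_{t-1},s_t)$, the algorithm $\mathsf{Alg}_{\mathrm{sLinUCB}(\tau)}$ chooses $\mathbf a_{t,k}$ with probability $\mathrm{softmax}\big((v^*_{tj}/\tau)_{j\in[A]}\big)_k$. *Transformer.* With $\mathrm{ReLU}(x)=\max\{x,0\}$ (entrywise), a layer with $M$ heads and hidden width $D'$ has matrices $\mathbf V_m,\mathbf Q_m,\mathbf K_m\in\mathbb R^{D\times D}$ ($m\in[M]$), $\mathbf W_1\in\mathbb R^{D'\times D}$, $\mathbf W_2\in\mathbb R^{D\times D'}$. It maps tokens $\mathbf h_1,\dots,\mathbf h_N\in\mathbb R^D$ first to $\mathbf h_i+\sum_{m}\frac1i\sum_{j\le i}\mathrm{ReLU}(\langle\mathbf Q_m\mathbf h_i,\mathbf K_m\mathbf h_j\rangle)\mathbf V_m\mathbf h_j$, then each resulting token $\mathbf h$ to $\mathbf h+\mathbf W_2\,\mathrm{ReLU}(\mathbf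 W_1\mathbf h)$, and then projects each token to the Euclidean ball of radius $\mathsf R$. The transformer $\mathrm{TF}^{\mathsf R}_\theta$ projects its input tokens to this ball and then applies $L$ such layers. Its norm is $$|||\theta|||=\max_{\ell\in[L]}\Big\{\max_{m}\{\|\mathbf Q^{(\ell)}_m\|_{\rm op},\|\mathbf K^{(\ell)}_m\|_{\rm op}\}+\sum_{m}\|\mathbf V^{(\ell)}_m\|_{\rm op}+\|\mathbf W^{(\ell)}_1\|_{\rm op}+\|\mathbf W^{(\ell)}_2\|_{\rm op}\Big\}.$$ *Embedding and induced policy.* A token consists of blocks of sizes $d+1,\ dA,\ A,\ z,\ 3$, so that $D=d+1+dA+A+z+3$. The token $\mathbf h_{2t-1}=\mathtt h(s_t)$ carries $(\mathbf a_{t,1},\dots,\mathbf a_{t,A})$ in the second block and $\mathbf h_{2t}=\mathtt h(\mathbf a_t,r_t)$ carries $(\mathbf a_t,r_t)$ in the first block; the last block of $\mathbf h_i$ is $(i,i^2,1)$; all other entries are $0$. The policy $\mathsf{Alg}_\theta(\cdot\mid D_{t-1},s_t)$ is the softmax of the third block of the last output token of $\mathrm{TF}^{\mathsf R}_\theta(\mathbf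 h_1,\dots,\mathbf h_{2t-1})$. *Claim.* For all $\varepsilon,\tau\in(0,1]$ there exist $z\ge 0$, a transformer $\mathrm{TF}_\theta^{\mathsf R}$ as above and $\mathsf R>0$ with $$\log\mathsf R=\tilde O(1),\quad D\le O(dA),\quad L=\tilde O(\sqrt T),\quad M\le 4A,\quad D'=\tilde O\big(d+A\sqrt{Td/(\tau\varepsilon)}\big),\quad |||\theta|||=\tilde O\big(A+T\sqrt d/(\tau\varepsilon^{1/4})\big),$$ such that for every environment and all action choices and noise values as above $$\big|\log\mathsf{Alg}_{\mathrm{sLinUCB}(\tau)}(\mathbf a_{t,k}\mid D_{t-1},s_t)-\log\mathsf{Alg}_\theta(\mathbf a_{t,k}\mid D_{t-1},s_t)\big|\le\varepsilon\qquad\text{for all }t\in[T],\ k\in[A].$$ Here $O(\cdot)$ hides an absolute constant, and $\tilde O(\cdot)$ (an upper bound) hides in addition a factor that is polynomial in $(\sigma,b_a^{-1},B_a,B_w,\lambda,\lambda^{-1})$ and poly-logarithmic in $(T,A,d,1/\varepsilon,1/\tau)$, with absolute constants and degrees; $\theta$ and $\mathsf R$ depend only on $(d,A,T,\sigma,b_a,B_a,B_w,\lambda,\varepsilon,\tau)$.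 -/

import Mathlib

open scoped Matrix

noncomputable section

namespace ICRL

/-! ### Decoder transformers with ReLU attention

Tokens are real vectors whose coordinates are indexed by a finite type `ι`; the token dimension is
`D = Fintype.card ι`. -/

/-- The Euclidean norm of a vector given by its coordinates. -/
def l2norm {ι : Type} [Fintype ι] (v : ι → ℝ) : ℝ := ‖WithLp.toLp 2 v‖

/-- The operator norm of a matrix with respect to the Euclidean norms. -/
def opNorm {κ ι : Type} [Fintype κ] [Fintype ι] [DecidableEq ι] (W : Matrix κ ι ℝ) : ℝ :=
  ‖LinearMap.toContinuousLinearMap (Matrix.toEuclideanLin W)‖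

def relu (x : ℝ) : ℝ := max x 0

/-- The weights of one layer: `M` attention heads and an MLP with `D'` hidden neurons. -/
structure LayerParams (ι : Type) (M D' : ℕ) where
  V : Fin M → Matrix ι ι ℝ
  Q : Fin M → Matrix ι ι ℝ
  K : Fin M → Matrix ι ι ℝ
  W₁ : Matrix (Fin D') ι ℝ
  W₂ : Matrix ι (Fin D') ℝ

/-- The weights of a transformer with `L` layers. -/
abbrev TFParams (ι : Type) (L M D' : ℕ) := Fin L → LayerParams ι M D'

section Transformer

variable {ι : Type} [Fintype ι] {M D' : ℕ}

/-- The masked attention layer. Tokens are counted from `0`, so that `i + 1` tokens are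
visible to token `i`. -/
def attn (θ : LayerParams ι M D') {N : ℕ} (H : Fin N → ι → ℝ) (i : Fin N) : ι → ℝ :=
  H i + ∑ m : Fin M, (1 / ((i : ℝ) + 1)) •
    ∑ j ∈ Finset.Iic i, relu ((θ.Q m *ᵥ H i) ⬝ᵥ (θ.K m *ᵥ H j)) • (θ.V m *ᵥ H j)

/-- The MLP layer, applied to every token. -/
def mlp (θ : LayerParams ι M D') {N : ℕ} (H : Fin N → ι → ℝ) (i : Fin N) : ι → ℝ :=
  H i + θ.W₂ *ᵥ (fun n => relu ((θ.W₁ *ᵥ H i) n))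

/-- Tokenwise projection to the Euclidean ball of radius `R`. -/
def clip (R : ℝ) {N : ℕ} (H : Fin N → ι → ℝ) (i : Fin N) : ι → ℝ :=
  if l2norm (H i) ≤ R then H i else (R / l2norm (H i)) • H i

/-- The transformer: clip the input, then apply attention, MLP and clip in each layer. -/
def transformer (R : ℝ) {N : ℕ} :
    (L : ℕ) → TFParams ι L M D' → (Fin N → ι → ℝ) → (Fin N → ι → ℝ)
  | 0, _, H => clip R H
  | L + 1, θ, H =>
      clip R (mlp (θ (Fin.last L)) (attn (θ (Fin.last L))
        (transformer R L (fun l => θ l.castSucc) H)))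

/-- The norm of a transformer (a maximum over an empty index set is `0`). -/
def tfNorm [DecidableEq ι] {L : ℕ} (θ : TFParams ι L M D') : ℝ :=
  ⨆ l : Fin L, ((⨆ m : Fin M, max (opNorm ((θ l).Q m)) (opNorm ((θ l).K m)))
    + ∑ m : Fin M, opNorm ((θ l).V m) + opNorm (θ l).W₁ + opNorm (θ l).W₂)

end Transformer

/-! ### Stochastic linear bandits and histories -/

/-- What the learner sees when choosing an action after `n` complete rounds: the action sets of the
rounds `0, …, n` (the last one is the current state) and the actions and rewards of the
rounds `0, …, n - 1`. -/
structure History (d A n : ℕ) where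
  actionSet : Fin (n + 1) → Fin A → EuclideanSpace ℝ (Fin d)
  action : Fin n → EuclideanSpace ℝ (Fin d)
  reward : Fin n → ℝ

/-- The current action set. -/
def History.current {d A n : ℕ} (h : History d A n) : Fin A → EuclideanSpace ℝ (Fin d) :=
  h.actionSet (Fin.last n)

/-- A linear bandit environment with horizon `T` and `A` actions in each round. The noise is
supplied separately, through its realized values. -/
structure LinearBandit (d A T : ℕ) where
  param : EuclideanSpace ℝ (Fin d)
  actionSet : Fin T → Fin A → EuclideanSpace ℝ (Fin d)

/-- The boundedness conditions on the environment. -/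
def LinearBandit.IsBounded {d A T : ℕ} (E : LinearBandit d A T) (b_a B_a B_w : ℝ) : Prop :=
  ‖E.param‖ ≤ B_w ∧ ∀ t k, b_a ≤ ‖E.actionSet t k‖ ∧ ‖E.actionSet t k‖ ≤ B_a

/-- The history before the action of round `t` (counted from `0`), if the learner chooses the action
number `choice j` and the noise is `noise j` in round `j`. -/
def LinearBandit.history {d A T : ℕ} (E : LinearBandit d A T) (choice : Fin T → Fin A)
    (noise : Fin T → ℝ) (t : Fin T) : History d A t where
  actionSet j := E.actionSet ⟨j, by omega⟩
  action j := E.actionSet ⟨j, by omega⟩ (choice ⟨j, by omega⟩)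
  reward j := inner ℝ (E.actionSet ⟨j, by omega⟩ (choice ⟨j, by omega⟩)) E.param
    + noise ⟨j, by omega⟩

def softmax {A : ℕ} (v : Fin A → ℝ) (k : Fin A) : ℝ := Real.exp (v k) / ∑ j, Real.exp (v j)

/-! ### Soft LinUCB -/

/-- The ridge regression objective. -/
def ridgeLoss {d A n : ℕ} (lam : ℝ) (h : History d A n) (w : EuclideanSpace ℝ (Fin d)) : ℝ :=
  ∑ j, (h.reward j - inner ℝ (h.action j) w) ^ 2 + lam * ‖w‖ ^ 2

/-- The ridge estimator: the minimizer of the ridge objective (it exists and is unique for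
`lam > 0`). -/
def ridge {d A n : ℕ} (lam : ℝ) (h : History d A n) : EuclideanSpace ℝ (Fin d) :=
  Classical.epsilon (fun w => ∀ w', ridgeLoss lam h w ≤ ridgeLoss lam h w')

/-- The regularized covariance matrix `lam • I + ∑ j, a_j a_jᵀ`. -/
def covMatrix {d A n : ℕ} (lam : ℝ) (h : History d A n) : Matrix (Fin d) (Fin d) ℝ :=
  lam • (1 : Matrix (Fin d) (Fin d) ℝ) + ∑ j, Matrix.vecMulVec (h.action j) (h.action j)

/-- The confidence parameter. -/
def confWidth (d T : ℕ) (σ B_a B_w lam : ℝ) : ℝ :=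
  √lam * B_w + σ * √(2 * Real.log (2 * B_a * B_w * T)
    + d * Real.log ((d * lam + T * B_a ^ 2) / (d * lam)))

/-- The upper confidence bound for the reward of action `k` of the current action set. -/
def ucb {d A n : ℕ} (lam α : ℝ) (h : History d A n) (k : Fin A) : ℝ :=
  inner ℝ (h.current k) (ridge lam h)
    + α * √((h.current k).ofLp ⬝ᵥ ((covMatrix lam h)⁻¹ *ᵥ (h.current k).ofLp))

/-- The probability with which soft LinUCB with temperature `τ` chooses action `k`. -/
def softLinUCB {d A n : ℕ} (lam α τ : ℝ) (h : History d A n) (k : Fin A) : ℝ :=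
  softmax (fun j => ucb lam α h j / τ) k

/-! ### Embedding, extraction and induced algorithm -/

/-- The coordinates of a token: an action and its reward, an action set, the (unnormalized) policy,
`z` further coordinates, and the positional embedding. -/
abbrev TokenIdx (d A z : ℕ) : Type :=
  (Fin d ⊕ Unit) ⊕ (Fin A × Fin d) ⊕ Fin A ⊕ Fin z ⊕ Fin 3

/-- The positional embedding `(i, i², 1)`. -/
def posEmb (i : ℕ) : Fin 3 → ℝ := ![(i : ℝ), (i : ℝ) ^ 2, 1]

/-- The token at position `i` that carries an action set. -/
def stateToken {d A : ℕ} (z i : ℕ) (S : Fin A → EuclideanSpace ℝ (Fin d)) : TokenIdx d A z → ℝ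
  | .inl _ => 0
  | .inr (.inl (k, c)) => S k c
  | .inr (.inr (.inl _)) => 0
  | .inr (.inr (.inr (.inl _))) => 0
  | .inr (.inr (.inr (.inr c))) => posEmb i c

/-- The token at position `i` that carries an action and its reward. -/
def actionToken {d A : ℕ} (z i : ℕ) (a : EuclideanSpace ℝ (Fin d)) (r : ℝ) : TokenIdx d A z → ℝ
  | .inl (.inl c) => a c
  | .inl (.inr _) => r
  | .inr (.inl _) => 0
  | .inr (.inr (.inl _)) => 0
  | .inr (.inr (.inr (.inl _))) => 0
  | .inr (.inr (.inr (.inr c))) => posEmb i c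

/-- The input sequence `h(s_1), h(a_1, r_1), …, h(a_{t-1}, r_{t-1}), h(s_t)` with `t = n + 1`.
The entry with index `i`, counted from `0`, is the token at position `i + 1`. -/
def tokens {d A n : ℕ} (z : ℕ) (h : History d A n) (i : Fin (2 * n + 1)) : TokenIdx d A z → ℝ :=
  if hi : (i : ℕ) % 2 = 0 then
    stateToken z (i + 1) (h.actionSet ⟨(i : ℕ) / 2, by omega⟩)
  else
    actionToken z (i + 1) (h.action ⟨(i : ℕ) / 2, by omega⟩) (h.reward ⟨(i : ℕ) / 2, by omega⟩)

/-- The policy induced by a transformer: the softmax of the policy coordinates of the last output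
token. -/
def inducedAlg {d A z L M D' n : ℕ} (R : ℝ) (θ : TFParams (TokenIdx d A z) L M D')
    (h : History d A n) (k : Fin A) : ℝ :=
  softmax (fun j => transformer R L θ (tokens z h) (Fin.last (2 * n)) (.inr (.inr (.inl j)))) k

/-! ### Orders of magnitude -/

/-- The factor hidden by the soft-O notation: a constant times a polynomial of degree `p` in
`σ`, `1 / b_a`, `B_a`, `B_w`, `lam`, `1 / lam`, times a poly-logarithmic factor of degree `q`. -/
def softFactor (C : ℝ) (p q : ℕ) (d A T : ℕ) (σ b_a B_a B_w lam ε τ : ℝ) : ℝ :=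
  C * (1 + σ + b_a⁻¹ + B_a + B_w + lam + lam⁻¹) ^ p
    * (1 + Real.log T + Real.log A + Real.log d + Real.log (1 / ε) + Real.log (1 / τ)) ^ q

end ICRL

end

open ICRL

/-!
# A transformer which approximates soft LinUCB

The upper confidence bound of an action `a` is `⟪a, A⁻¹ b⟫ + α √(aᵀ A⁻¹ a)`, where `A` is the
regularized covariance matrix and `b = ∑ r_j a_j`. Both terms are linear functionals of the one vector
`A⁻¹ a`, so it is enough to solve one linear system for each action. The token at position `i` solves
`S x = a` for `S = A / i`. The averaging factor `1 / i` of the attention turns sums over the previous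
tokens into products with `S`, and as `x = i A⁻¹ a`, it also cancels when `⟪a, A⁻¹ b⟫` and
`aᵀ A⁻¹ a` are read off.

The system is solved by Nesterov's accelerated gradient method, one step in each layer
(`attn_agdLayer`). The matrix `S` has its spectrum between `lam / (2 T)` and `lam + B_a ^ 2`, so that
of the order `√T` steps suffice, up to logarithms; the rate comes from the decay of a Lyapunov function
(`agdEnergy_step_le`, `norm_agd_sub_sq_le`). One further layer reads off the predicted reward and the
number `q = aᵀ A⁻¹ a` (`attn_readLayer`). The square root of `q` is the limit of
`s ↦ s + η (q - s ^ 2)` (`sqrtIter_bounds`); as `√q` is at least of the order `1 / √T`, again of the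
order `√T` layers suffice (`attn_sqrtLayer`). A last linear layer forms the scores
(`attn_outLayer`).

All of this is done by the attention heads, and there are no hidden neurons at all. A pair of heads with
opposite signs has linear weights, because `relu x - relu (-x) = x`. A head sees only its own token if
its query and key matrices contribute a term `B * (j - i)`, which is negative enough for `j < i`; this
gives products of coordinates of one token. With `i + i * (j - i)` in place of the weights it even has
weight `i` for the own token, which cancels the averaging factor, so that any linear map can be added to
the tokens by one head (`linHead_out`). Four heads for each action are enough.

No intermediate token leaves the ball of radius `R` (`l2norm_tokAfter_le`), so the projections do
nothing. For the choice of the constants all parameters of the problem are compared with two numbers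
(`ScaleBounds`): `P`, which is polynomial in the bounds of the environment, and
`Y = T A d / (ε τ)`. An accuracy which is a fixed power of `(P Y)⁻¹` is enough, and
`log (P Y)` is at most `P` times the logarithmic factor.
-/

noncomputable section

namespace ICRL

/-! ### Accelerated gradient descent for positive definite linear systems -/

section Accelerated

variable {E : Type*} [NormedAddCommGroup E] [InnerProductSpace ℝ E]

/-- One step of Nesterov's accelerated gradient descent for `S x = c`, where `S` has its spectrum in
`[L * θ ^ 2, L]`. A state is a pair `(y, u)`: `y` is the point where the gradient is taken and
`u = θ • z` is the rescaled momentum sequence `z`; the usual main sequence is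
`x = (1 + θ) • y - u`. The rescaling keeps all coefficients bounded as `θ → 0`. -/
def agdStep (S : E →ₗ[ℝ] E) (c : E) (L θ : ℝ) (p : E × E) : E × E :=
  ((1 + θ)⁻¹ • ((1 + θ ^ 2) • p.1 + (1 - θ) • p.2 - (2 / L) • (S p.1 - c)),
    (1 - θ) • p.2 + θ ^ 2 • p.1 - (1 / L) • (S p.1 - c))

/-- The accelerated gradient iterates, started at zero. -/
def agd (S : E →ₗ[ℝ] E) (c : E) (L θ : ℝ) (n : ℕ) : E × E := (agdStep S c L θ)^[n] (0, 0)

lemma agd_succ (S : E →ₗ[ℝ] E) (c : E) (L θ : ℝ) (n : ℕ) :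
    agd S c L θ (n + 1) = agdStep S c L θ (agd S c L θ n) := by
  simp only [agd, Function.iterate_succ_apply']

/-- The Lyapunov function of accelerated gradient descent, as a function of the errors of `y`
and `u`. -/
def agdEnergy (S : E →ₗ[ℝ] E) (L θ : ℝ) (p : E × E) : ℝ :=
  inner ℝ (S ((1 + θ) • p.1 - p.2)) ((1 + θ) • p.1 - p.2) + L * ‖p.2‖ ^ 2

variable {S : E →ₗ[ℝ] E} {L θ : ℝ}

lemma agdEnergy_step_le (hS : ∀ v w, inner ℝ (S v) w = inner ℝ v (S w)) (hL : 0 < L)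
    (hθ : 0 < θ) (hθ1 : θ ≤ 1) (hlow : ∀ v, L * θ ^ 2 * ‖v‖ ^ 2 ≤ inner ℝ (S v) v)
    (hup : ∀ v, inner ℝ (S v) v ≤ L * ‖v‖ ^ 2) (p : E × E) :
    agdEnergy S L θ (agdStep S 0 L θ p) ≤ (1 - θ) * agdEnergy S L θ p := by
  obtain ⟨y, u⟩ := p
  have hx : (1 + θ) • (agdStep S 0 L θ (y, u)).1 - (agdStep S 0 L θ (y, u)).2
      = y - (1 / L) • S y := by
    have h1 : (1 + θ) ≠ 0 := by positivity
    simp only [agdStep, smul_smul, mul_inv_cancel₀ h1, one_smul, sub_zero]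
    module
  have h1 := hup (S y)
  have h2 : 0 ≤ inner ℝ (S (u - θ • y)) (u - θ • y) :=
    le_trans (by positivity) (hlow (u - θ • y))
  have h3 : 0 ≤ ‖u - θ • y‖ ^ 2 := by positivity
  have h4 := hlow y
  rw [agdEnergy, agdEnergy, hx]
  have hl : 0 < 1 / L := by positivity
  have hLl : L * (1 / L) = 1 := by field_simp
  generalize 1 / L = l at *
  simp only [agdStep, sub_zero] at *
  have e1 : inner ℝ (S (S y)) y = ‖S y‖ ^ 2 := by
    rw [hS, real_inner_self_eq_norm_sq]
  have e2 : inner ℝ (S u) y = inner ℝ (S y) u := by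
    rw [hS, real_inner_comm]
  have e3 : inner ℝ (S y) (S y) = ‖S y‖ ^ 2 := real_inner_self_eq_norm_sq _
  have hl' : 1 / L = l := by field_simp; linarith
  simp only [hl', ← real_inner_self_eq_norm_sq, map_sub, map_smul, inner_sub_left, inner_sub_right,
    inner_add_left, inner_add_right, inner_smul_left, inner_smul_right,
    RCLike.conj_to_real] at *
  have e4 : inner ℝ u (S y) = inner ℝ (S y) u := real_inner_comm _ _
  have e5 : inner ℝ y (S y) = inner ℝ (S y) y := real_inner_comm _ _
  have e6 : inner ℝ u y = inner ℝ y u := real_inner_comm _ _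
  simp only [e1, e2, e4, e5, e6] at *
  have k1 := mul_le_mul_of_nonneg_left h1 (mul_pos hl hl).le
  have k2 := mul_nonneg (sub_nonneg.2 hθ1) h2
  have k3 := mul_nonneg (mul_nonneg (mul_nonneg hL.le hθ.le) (sub_nonneg.2 hθ1)) h3
  have k4 := mul_nonneg hθ.le (sub_nonneg.2 h4)
  linear_combination k1 + k2 + k3 + k4 + (2 * l * inner ℝ (S y) (S y)
    - 2 * (1 - θ) * inner ℝ (S y) u - 2 * θ ^ 2 * inner ℝ (S y) y) * hLl

/-- The iterates converge linearly, with rate `1 - θ`. -/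
lemma norm_agd_sub_sq_le (hS : ∀ v w, inner ℝ (S v) w = inner ℝ v (S w)) (hL : 0 < L)
    (hθ : 0 < θ) (hθ1 : θ ≤ 1) (hlow : ∀ v, L * θ ^ 2 * ‖v‖ ^ 2 ≤ inner ℝ (S v) v)
    (hup : ∀ v, inner ℝ (S v) v ≤ L * ‖v‖ ^ 2) {c x : E} (hx : S x = c) (n : ℕ) :
    L * θ ^ 2 * ‖(agd S c L θ n).1 - x‖ ^ 2 ≤ (1 - θ) ^ n * (2 * inner ℝ c x) ∧
      L * ‖(agd S c L θ n).2 - θ • x‖ ^ 2 ≤ (1 - θ) ^ n * (2 * inner ℝ c x) := by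
  set err : ℕ → E × E := fun n => ((agd S c L θ n).1 - x, (agd S c L θ n).2 - θ • x) with herr
  have h1 : (1 + θ) ≠ 0 := by positivity
  have hstep : ∀ n, err (n + 1) = agdStep S 0 L θ (err n) := by
    intro n
    simp only [herr, agd_succ, agdStep, map_sub, hx, sub_zero]
    generalize (agd S c L θ n).1 = y
    generalize (agd S c L θ n).2 = u
    refine Prod.ext ?_ ?_
    · have : x = (1 + θ)⁻¹ • ((1 + θ) • x) := by rw [smul_smul, inv_mul_cancel₀ h1, one_smul]
      nth_rewrite 1 [this]
      simp only
      rw [← smul_sub]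
      congr 1
      module
    · simp only
      module
  have hV : ∀ n, agdEnergy S L θ (err n) ≤ (1 - θ) ^ n * (2 * inner ℝ c x) := by
    intro n
    induction n with
    | zero =>
      have h0 : err 0 = (-x, -(θ • x)) := by simp [herr, agd]
      have e : (1 + θ) • (-x) - -(θ • x) = -x := by module
      have hx' := hlow x
      rw [hx] at hx'
      rw [h0, agdEnergy, pow_zero, one_mul, e, map_neg, inner_neg_neg, norm_neg, norm_smul, hx,
        mul_pow, Real.norm_eq_abs, sq_abs]
      linarith
    | succ n ih =>
      rw [hstep, pow_succ']
      refine (agdEnergy_step_le hS hL hθ hθ1 hlow hup _).trans ?_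
      rw [mul_assoc]
      exact mul_le_mul_of_nonneg_left ih (sub_nonneg.2 hθ1)
  have hn := hV n
  rw [agdEnergy] at hn
  have hl := hlow ((1 + θ) • (err n).1 - (err n).2)
  have hnn : 0 ≤ L * θ ^ 2 * ‖(1 + θ) • (err n).1 - (err n).2‖ ^ 2 := by positivity
  have hnn' : 0 ≤ L * ‖(err n).2‖ ^ 2 := by positivity
  have hy1 : (agd S c L θ n).1 - x = (err n).1 := rfl
  have hu1 : (agd S c L θ n).2 - θ • x = (err n).2 := rfl
  rw [hy1, hu1]
  refine ⟨?_, by linarith⟩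
  generalize (err n).1 = y at *
  generalize (err n).2 = u at *
  refine le_trans ?_ hn
  refine le_trans ?_ (add_le_add_left hl _)
  -- `(1 + θ) • y = x + u`, and `‖x + u‖ ^ 2 ≤ (1 + θ) * (‖x‖ ^ 2 + ‖u‖ ^ 2 / θ)` with `1 ≤ 1 + θ`.
  have htri : (1 + θ) * ‖y‖ ≤ ‖(1 + θ) • y - u‖ + ‖u‖ := by
    have := norm_add_le ((1 + θ) • y - u) u
    rwa [sub_add_cancel, norm_smul, Real.norm_of_nonneg (by positivity)] at this
  have hsq : (1 + θ) ^ 2 * (θ ^ 2 * ‖y‖ ^ 2) ≤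
      (1 + θ) ^ 2 * (θ ^ 2 * ‖(1 + θ) • y - u‖ ^ 2 + ‖u‖ ^ 2) := by
    have a := norm_nonneg y
    have b := norm_nonneg ((1 + θ) • y - u)
    have c := norm_nonneg u
    generalize ‖(1 + θ) • y - u‖ = X at *
    generalize ‖u‖ = U at *
    generalize ‖y‖ = Y at *
    have h2 : ((1 + θ) * Y) ^ 2 ≤ (X + U) ^ 2 := by gcongr
    have h3 : 0 ≤ (θ * X - U) ^ 2 := by positivity
    have h4 : θ ^ 2 * ((1 + θ) * Y) ^ 2 ≤ θ ^ 2 * (X + U) ^ 2 := by gcongr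
    nlinarith [mul_nonneg hθ.le (sq_nonneg (θ * X - U)), mul_nonneg hθ.le (sq_nonneg U),
      mul_nonneg hθ.le (sq_nonneg X), mul_nonneg (mul_nonneg hθ.le hθ.le) (sq_nonneg X),
      mul_nonneg (mul_nonneg hθ.le hθ.le) (sq_nonneg U), mul_nonneg b c]
  have hsq' := le_of_mul_le_mul_left hsq (by positivity)
  have := mul_le_mul_of_nonneg_left hsq' hL.le
  linarith

end Accelerated

/-! ### A division-free iteration for square roots -/

/-- The iteration `s ↦ s + η (q - s ^ 2)`, started at zero. -/
def sqrtIter (η q : ℝ) : ℕ → ℝ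
  | 0 => 0
  | n + 1 => sqrtIter η q n + η * (q - sqrtIter η q n ^ 2)

lemma sqrtIter_bounds {η q : ℝ} (hη : 0 ≤ η) (hq : 0 ≤ q) (h : 2 * η * √q ≤ 1) (n : ℕ) :
    0 ≤ sqrtIter η q n ∧ sqrtIter η q n ≤ √q ∧
      √q - sqrtIter η q n ≤ √q * (1 - η * √q) ^ n := by
  have hr := Real.sqrt_nonneg q
  have hsq := Real.mul_self_sqrt hq
  generalize √q = r at *
  induction n with
  | zero => simp [sqrtIter, hr]
  | succ n ih =>
    obtain ⟨h0, h1, h2⟩ := ih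
    rw [sqrtIter]
    generalize sqrtIter η q n = s at *
    have key : r - (s + η * (q - s ^ 2)) = (r - s) * (1 - η * (r + s)) := by rw [← hsq]; ring
    have hp : 0 ≤ 1 - η * (r + s) := by nlinarith
    refine ⟨?_, ?_, ?_⟩
    · have : 0 ≤ η * (q - s ^ 2) := mul_nonneg hη (by rw [← hsq]; nlinarith)
      linarith
    · have := mul_nonneg (sub_nonneg.2 h1) hp
      linarith
    · rw [key, pow_succ, ← mul_assoc]
      exact mul_le_mul h2 (by nlinarith) hp (mul_nonneg hr (pow_nonneg (by nlinarith) _))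

/-! ### Stability of the logarithm of the softmax -/

lemma log_softmax {A : ℕ} (v : Fin A → ℝ) (k : Fin A) :
    Real.log (softmax v k) = v k - Real.log (∑ j, Real.exp (v j)) := by
  have : 0 < ∑ j, Real.exp (v j) :=
    Finset.sum_pos (fun j _ => Real.exp_pos _) ⟨k, Finset.mem_univ _⟩
  rw [softmax, Real.log_div (Real.exp_pos _).ne' this.ne', Real.log_exp]

lemma log_sum_exp_le {A : ℕ} {v w : Fin A → ℝ} {δ : ℝ} (k : Fin A) (h : ∀ j, v j ≤ w j + δ) :
    Real.log (∑ j, Real.exp (v j)) ≤ Real.log (∑ j, Real.exp (w j)) + δ := by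
  have hpos : ∀ v : Fin A → ℝ, 0 < ∑ j, Real.exp (v j) := fun v =>
    Finset.sum_pos (fun j _ => Real.exp_pos _) ⟨k, Finset.mem_univ _⟩
  rw [← Real.log_exp δ, ← Real.log_mul (hpos w).ne' (Real.exp_pos _).ne']
  refine Real.log_le_log (hpos v) ?_
  rw [Finset.sum_mul]
  exact Finset.sum_le_sum fun j _ => by rw [← Real.exp_add]; exact Real.exp_le_exp.2 (h j)

lemma abs_log_softmax_sub_le {A : ℕ} {v w : Fin A → ℝ} {δ : ℝ} (h : ∀ j, |v j - w j| ≤ δ)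
    (k : Fin A) : |Real.log (softmax v k) - Real.log (softmax w k)| ≤ 2 * δ := by
  have h1 := log_sum_exp_le (v := v) (w := w) (δ := δ) k fun j => by
    linarith [(abs_le.1 (h j)).2]
  have h2 := log_sum_exp_le (v := w) (w := v) (δ := δ) k fun j => by
    linarith [(abs_le.1 (h j)).1]
  have h3 := abs_le.1 (h k)
  rw [log_softmax, log_softmax, abs_le]
  constructor <;> linarith

/-! ### Euclidean norms, and matrices with at most one nonzero entry in each row -/

section Norms

variable {ι κ : Type} [Fintype ι] [Fintype κ]

lemma l2norm_nonneg (v : ι → ℝ) : 0 ≤ l2norm v := norm_nonneg _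

lemma l2norm_sq (v : ι → ℝ) : l2norm v ^ 2 = ∑ i, v i ^ 2 := by
  simp [l2norm, EuclideanSpace.norm_sq_eq]

lemma l2norm_le_card_mul {v : ι → ℝ} {β : ℝ} (h : ∀ i, |v i| ≤ β) (hβ : 0 ≤ β) :
    l2norm v ≤ Fintype.card ι * β := by
  refine le_of_sq_le_sq ?_ (by positivity)
  rw [l2norm_sq]
  calc ∑ i, v i ^ 2 ≤ ∑ _i : ι, β ^ 2 := Finset.sum_le_sum fun i _ => sq_le_sq' (by
        linarith [(abs_le.1 (h i)).1]) (abs_le.1 (h i)).2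
    _ = Fintype.card ι * β ^ 2 := by simp
    _ ≤ (Fintype.card ι * β) ^ 2 := by
        rw [mul_pow]
        refine mul_le_mul_of_nonneg_right ?_ (by positivity)
        exact_mod_cast Nat.le_self_pow two_ne_zero _

lemma l2norm_comp_equiv (φ : ι ≃ κ) (v : κ → ℝ) : l2norm (v ∘ φ) = l2norm v := by
  rw [← sq_eq_sq₀ (l2norm_nonneg _) (l2norm_nonneg _), l2norm_sq, l2norm_sq]
  exact Equiv.sum_comp φ fun i => v i ^ 2

variable [DecidableEq ι]

lemma opNorm_nonneg (W : Matrix κ ι ℝ) : 0 ≤ opNorm W := norm_nonneg _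

lemma opNorm_le {W : Matrix κ ι ℝ} {c : ℝ} (hc : 0 ≤ c)
    (h : ∀ v, l2norm (W *ᵥ v) ≤ c * l2norm v) : opNorm W ≤ c :=
  ContinuousLinearMap.opNorm_le_bound _ hc fun v => h v.ofLp

lemma l2norm_mulVec_le (W : Matrix κ ι ℝ) (v : ι → ℝ) :
    l2norm (W *ᵥ v) ≤ opNorm W * l2norm v :=
  ContinuousLinearMap.le_opNorm (LinearMap.toContinuousLinearMap (Matrix.toEuclideanLin W))
    (WithLp.toLp 2 v)

lemma opNorm_zero : opNorm (0 : Matrix κ ι ℝ) = 0 := by simp [opNorm]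

lemma opNorm_add_le (W W' : Matrix κ ι ℝ) : opNorm (W + W') ≤ opNorm W + opNorm W' := by
  simpa [opNorm] using norm_add_le (LinearMap.toContinuousLinearMap (Matrix.toEuclideanLin W))
    (LinearMap.toContinuousLinearMap (Matrix.toEuclideanLin W'))

lemma opNorm_smul (a : ℝ) (W : Matrix κ ι ℝ) : opNorm (a • W) = |a| * opNorm W := by
  simp [opNorm, norm_smul]

lemma opNorm_submatrix_le {ι' κ' : Type} [Fintype ι'] [Fintype κ'] [DecidableEq ι']
    (W : Matrix κ ι ℝ) (e : κ' ≃ κ) (f : ι' ≃ ι) : opNorm (W.submatrix e f) ≤ opNorm W := by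
  refine opNorm_le (opNorm_nonneg W) fun v => ?_
  rw [Matrix.submatrix_mulVec_equiv, l2norm_comp_equiv, ← l2norm_comp_equiv f.symm v]
  exact l2norm_mulVec_le _ _

/-- The square matrix with the entry `w o` at the place `(o, src o)` of each row `o`, and zeros
elsewhere: the coordinate `o` of the image of a vector is `w o` times its coordinate `src o`. -/
def pick (w : ι → ℝ) (src : ι → ι) : Matrix ι ι ℝ :=
  Matrix.of fun o p => if src o = p then w o else 0

@[simp]
lemma pick_mulVec (w : ι → ℝ) (src : ι → ι) (v : ι → ℝ) :
    pick w src *ᵥ v = fun o => w o * v (src o) := by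
  ext o
  simp [pick, Matrix.mulVec, dotProduct]

/-- If different rows have their nonzero entries in different columns, then the operator norm is at
most the largest entry. -/
lemma opNorm_pick_le {w : ι → ℝ} {src : ι → ι} {c : ℝ} (hc : 0 ≤ c) (hw : ∀ o, |w o| ≤ c)
    (hsrc : ∀ o o', w o ≠ 0 → w o' ≠ 0 → src o = src o' → o = o') :
    opNorm (pick w src) ≤ c := by
  refine opNorm_le hc fun v => le_of_sq_le_sq ?_ (mul_nonneg hc (l2norm_nonneg v))
  rw [mul_pow, l2norm_sq, l2norm_sq, pick_mulVec, Finset.mul_sum]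
  calc ∑ o, (w o * v (src o)) ^ 2
      = ∑ o ∈ Finset.univ.filter (fun o => w o ≠ 0), (w o * v (src o)) ^ 2 := by
        rw [Finset.sum_filter]
        refine Finset.sum_congr rfl fun o _ => ?_
        by_cases h : w o = 0 <;> simp [h]
    _ ≤ ∑ o ∈ Finset.univ.filter (fun o => w o ≠ 0), c ^ 2 * v (src o) ^ 2 := by
        refine Finset.sum_le_sum fun o _ => ?_
        rw [mul_pow]
        refine mul_le_mul_of_nonneg_right ?_ (sq_nonneg _)
        exact sq_le_sq' (by linarith [(abs_le.1 (hw o)).1]) (abs_le.1 (hw o)).2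
    _ = ∑ p ∈ (Finset.univ.filter (fun o => w o ≠ 0)).image src, c ^ 2 * v p ^ 2 := by
        rw [Finset.sum_image]
        intro o ho o' ho' h
        simp only [Finset.coe_filter, Finset.mem_univ, true_and, Set.mem_ofPred_eq] at ho ho'
        exact hsrc o o' ho ho' h
    _ ≤ ∑ p, c ^ 2 * v p ^ 2 :=
        Finset.sum_le_sum_of_subset_of_nonneg (Finset.subset_univ _) fun p _ _ => by positivity

end Norms

/-! ### Renaming the coordinates of a transformer -/

section Reindex

variable {ι κ : Type} [Fintype ι] [Fintype κ] {M D' : ℕ}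

/-- The same layer, acting on tokens whose coordinates are renamed by `φ`. -/
def LayerParams.reindex (φ : ι ≃ κ) (θ : LayerParams κ M D') : LayerParams ι M D' where
  V m := (θ.V m).submatrix φ φ
  Q m := (θ.Q m).submatrix φ φ
  K m := (θ.K m).submatrix φ φ
  W₁ := θ.W₁.submatrix (Equiv.refl _) φ
  W₂ := θ.W₂.submatrix φ (Equiv.refl _)

lemma submatrix_mulVec_comp {κ' ι' : Type} [Fintype ι'] (W : Matrix κ' κ ℝ) (e : ι' ≃ κ')
    (φ : ι ≃ κ) (v : κ → ℝ) : W.submatrix e φ *ᵥ (v ∘ φ) = (W *ᵥ v) ∘ e := by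
  rw [Matrix.submatrix_mulVec_equiv]
  simp [Function.comp_assoc]

lemma attn_reindex (φ : ι ≃ κ) (θ : LayerParams κ M D') {N : ℕ} (H : Fin N → κ → ℝ) (i : Fin N) :
    attn (θ.reindex φ) (fun i => H i ∘ φ) i = attn θ H i ∘ φ := by
  ext o
  simp only [attn, LayerParams.reindex, submatrix_mulVec_comp, comp_equiv_dotProduct_comp_equiv]
  simp [Finset.sum_apply]

lemma mlp_reindex (φ : ι ≃ κ) (θ : LayerParams κ M D') {N : ℕ} (H : Fin N → κ → ℝ) (i : Fin N) :
    mlp (θ.reindex φ) (fun i => H i ∘ φ) i = mlp θ H i ∘ φ := by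
  have h : (θ.reindex φ).W₁ *ᵥ (H i ∘ φ) = θ.W₁ *ᵥ H i := submatrix_mulVec_comp _ _ _ _
  ext o
  simp only [mlp, h, Pi.add_apply, Function.comp_apply, add_right_inj]
  rfl

lemma clip_reindex (φ : ι ≃ κ) (R : ℝ) {N : ℕ} (H : Fin N → κ → ℝ) (i : Fin N) :
    clip R (fun i => H i ∘ φ) i = clip R H i ∘ φ := by
  simp only [clip, l2norm_comp_equiv]
  split_ifs <;> rfl

lemma transformer_reindex (φ : ι ≃ κ) (R : ℝ) {N : ℕ} (H : Fin N → κ → ℝ) (L : ℕ)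
    (θ : TFParams κ L M D') :
    transformer R L (fun l => (θ l).reindex φ) (fun i => H i ∘ φ)
      = fun i => transformer R L θ H i ∘ φ := by
  induction L with
  | zero => funext i; exact clip_reindex φ R H i
  | succ L ih =>
    funext i
    simp only [transformer]
    rw [ih fun l => θ l.castSucc]
    rw [← clip_reindex, funext (attn_reindex φ _ _), funext (mlp_reindex φ _ _)]

variable [DecidableEq ι] [DecidableEq κ]

lemma tfNorm_reindex_le (φ : ι ≃ κ) {L : ℕ} (θ : TFParams κ L M D') {X Y : ℝ} (hX : 0 ≤ X)
    (hXY : 0 ≤ X + Y)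
    (hQ : ∀ l m, opNorm ((θ l).Q m) ≤ X) (hK : ∀ l m, opNorm ((θ l).K m) ≤ X)
    (hV : ∀ l, ∑ m, opNorm ((θ l).V m) + opNorm (θ l).W₁ + opNorm (θ l).W₂ ≤ Y) :
    tfNorm (fun l => (θ l).reindex φ) ≤ X + Y := by
  refine Real.iSup_le (fun l => ?_) hXY
  rw [add_assoc, add_assoc]
  refine add_le_add (Real.iSup_le (fun m => max_le ?_ ?_) hX) ?_
  · exact (opNorm_submatrix_le _ _ _).trans (hQ l m)
  · exact (opNorm_submatrix_le _ _ _).trans (hK l m)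
  · refine le_trans ?_ (hV l)
    rw [add_assoc]
    exact add_le_add (Finset.sum_le_sum fun m _ => opNorm_submatrix_le _ _ _)
      (add_le_add (opNorm_submatrix_le _ _ _) (opNorm_submatrix_le _ _ _))

end Reindex

/-! ### Attention-only transformers -/

section Heads

variable {ι : Type} [Fintype ι] {A N : ℕ}

/-- An attention head. -/
structure Head (ι : Type) where
  V : Matrix ι ι ℝ
  Q : Matrix ι ι ℝ
  K : Matrix ι ι ℝ

/-- A layer without hidden neurons, with four attention heads for each action. -/
def headLayer (h : Fin 4 → Fin A → Head ι) : LayerParams ι (4 * A) 0 where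
  V m := (h (finProdFinEquiv.symm m).1 (finProdFinEquiv.symm m).2).V
  Q m := (h (finProdFinEquiv.symm m).1 (finProdFinEquiv.symm m).2).Q
  K m := (h (finProdFinEquiv.symm m).1 (finProdFinEquiv.symm m).2).K
  W₁ := 0
  W₂ := 0

/-- The contribution of a head to the token `i` at the coordinate `o`. -/
def Head.out (h : Head ι) (H : Fin N → ι → ℝ) (i : Fin N) (o : ι) : ℝ :=
  1 / ((i : ℝ) + 1) * ∑ j ∈ Finset.Iic i, relu ((h.Q *ᵥ H i) ⬝ᵥ (h.K *ᵥ H j)) * (h.V *ᵥ H j) o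

lemma attn_headLayer (h : Fin 4 → Fin A → Head ι) (H : Fin N → ι → ℝ) (i : Fin N) (o : ι) :
    attn (headLayer h) H i o = H i o + ∑ k, ∑ t, (h t k).out H i o := by
  have : ∀ F : Fin 4 → Fin A → ℝ,
      ∑ m : Fin (4 * A), F (finProdFinEquiv.symm m).1 (finProdFinEquiv.symm m).2
        = ∑ k, ∑ t, F t k := fun F => by
    rw [Equiv.sum_comp finProdFinEquiv.symm fun p : Fin 4 × Fin A => F p.1 p.2,
      Fintype.sum_prod_type_right]
  rw [← this fun t k => (h t k).out H i o]
  simp [attn, headLayer, Head.out, Finset.sum_apply]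

lemma mlp_headLayer (h : Fin 4 → Fin A → Head ι) (H : Fin N → ι → ℝ) (i : Fin N) :
    mlp (headLayer h) H i = H i := by
  simp [mlp, headLayer]

lemma sum_opNorm_headLayer [DecidableEq ι] (h : Fin 4 → Fin A → Head ι) :
    ∑ m, opNorm ((headLayer h).V m) + opNorm (headLayer h).W₁ + opNorm (headLayer h).W₂
      = ∑ k, ∑ t, opNorm (h t k).V := by
  rw [← Fintype.sum_prod_type_right (f := fun p : Fin 4 × Fin A => opNorm (h p.1 p.2).V),
    ← Equiv.sum_comp finProdFinEquiv.symm fun p : Fin 4 × Fin A => opNorm (h p.1 p.2).V]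
  simp [headLayer, opNorm_zero]

/-- If all intermediate tokens lie in the ball of radius `R`, then the projections to the ball do
nothing. -/
lemma transformer_eq_of_l2norm_le {M D' : ℕ} {R : ℝ} (θ : ℕ → LayerParams ι M D')
    (H : ℕ → Fin N → ι → ℝ) (L : ℕ)
    (hstep : ∀ l < L, ∀ i, mlp (θ l) (attn (θ l) (H l)) i = H (l + 1) i)
    (hR : ∀ l ≤ L, ∀ i, l2norm (H l i) ≤ R) :
    transformer R L (fun l => θ l) (H 0) = H L := by
  induction L with
  | zero => funext i; simp [transformer, clip, hR 0 le_rfl i]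
  | succ L ih =>
    have := ih (fun l hl => hstep l (by omega)) fun l hl => hR l (by omega)
    simp only [Fin.val_castSucc, transformer, Fin.val_last]
    funext i
    rw [this, funext (hstep L (by omega)), clip, if_pos (hR _ le_rfl i)]

end Heads

section Layers

/-! ### The coordinates of the tokens -/

/-- The coordinates of a token, by blocks. The free coordinates of `TokenIdx` are split into the state
`(y k, u k)` of the linear solver for each action `k`, and into the argument `q k` and the state `s k`
of the square root iteration. -/
inductive Coord (d A : ℕ) : Type
  | act (c : Fin d)
  | rew
  | set (k : Fin A) (c : Fin d)
  | pol (k : Fin A)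
  | y (k : Fin A) (c : Fin d)
  | u (k : Fin A) (c : Fin d)
  | q (k : Fin A)
  | s (k : Fin A)
  | pos (c : Fin 3)
  deriving DecidableEq

/-- The blocks of the free coordinates of a token: `y`, `u`, `q` and `s`. -/
abbrev Work (d A : ℕ) : Type := (Fin A × Fin d) ⊕ (Fin A × Fin d) ⊕ Fin A ⊕ Fin A

/-- `Coord` is a sum of its blocks. -/
def Coord.blocks (d A : ℕ) :
    ((Fin d ⊕ Unit) ⊕ (Fin A × Fin d) ⊕ Fin A ⊕ Work d A ⊕ Fin 3) ≃ Coord d A where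
  toFun
    | .inl (.inl c) => .act c
    | .inl (.inr _) => .rew
    | .inr (.inl (k, c)) => .set k c
    | .inr (.inr (.inl k)) => .pol k
    | .inr (.inr (.inr (.inl (.inl (k, c))))) => .y k c
    | .inr (.inr (.inr (.inl (.inr (.inl (k, c)))))) => .u k c
    | .inr (.inr (.inr (.inl (.inr (.inr (.inl k)))))) => .q k
    | .inr (.inr (.inr (.inl (.inr (.inr (.inr k)))))) => .s k
    | .inr (.inr (.inr (.inr c))) => .pos c
  invFun
    | .act c => .inl (.inl c)
    | .rew => .inl (.inr ())
    | .set k c => .inr (.inl (k, c))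
    | .pol k => .inr (.inr (.inl k))
    | .y k c => .inr (.inr (.inr (.inl (.inl (k, c)))))
    | .u k c => .inr (.inr (.inr (.inl (.inr (.inl (k, c))))))
    | .q k => .inr (.inr (.inr (.inl (.inr (.inr (.inl k))))))
    | .s k => .inr (.inr (.inr (.inl (.inr (.inr (.inr k))))))
    | .pos c => .inr (.inr (.inr (.inr c)))
  left_inv o := by rcases o with (_ | _) | _ | _ | (_ | _ | _ | _) | _ <;> rfl
  right_inv o := by cases o <;> rfl

instance (d A : ℕ) : Fintype (Coord d A) := Fintype.ofEquiv _ (Coord.blocks d A)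

/-- The coordinates of the tokens, with `Work d A` as the block of free coordinates. -/
def Coord.ofTokenIdx (d A : ℕ) : TokenIdx d A (Fintype.card (Work d A)) ≃ Coord d A :=
  ((Equiv.refl _).sumCongr <| (Equiv.refl _).sumCongr <| (Equiv.refl _).sumCongr <|
    (Fintype.equivFin (Work d A)).symm.sumCongr (Equiv.refl _)).trans (Coord.blocks d A)

variable {d A : ℕ}

lemma Coord.sum_eq (f : Coord d A → ℝ) :
    ∑ o, f o = ∑ c, f (.act c) + f .rew + ∑ k, ∑ c, f (.set k c) + ∑ k, f (.pol k)
      + ∑ k, ∑ c, f (.y k c) + ∑ k, ∑ c, f (.u k c) + ∑ k, f (.q k) + ∑ k, f (.s k)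
      + (f (.pos 0) + f (.pos 1) + f (.pos 2)) := by
  rw [← Equiv.sum_comp (Coord.blocks d A) f]
  simp only [Fintype.sum_sum_type, Fintype.sum_prod_type, Coord.blocks, Equiv.coe_fn_mk,
    Finset.univ_unique, Finset.sum_singleton, Fin.sum_univ_three]
  ring

lemma Coord.card_le (hd : 1 ≤ d) (hA : 1 ≤ A) : Fintype.card (Coord d A) ≤ 11 * (d * A) := by
  rw [← Fintype.card_congr (Coord.blocks d A)]
  simp only [Fintype.card_sum, Fintype.card_prod, Fintype.card_fin, Fintype.card_unit]
  have h1 : d ≤ d * A := Nat.le_mul_of_pos_right d hA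
  have h2 : A ≤ d * A := Nat.le_mul_of_pos_left A hd
  rw [mul_comm A d]
  omega

/-- The content of a token, by blocks; `n` is its position, counted from `1`. -/
structure Tok (d A : ℕ) where
  act : EuclideanSpace ℝ (Fin d)
  rew : ℝ
  set : Fin A → EuclideanSpace ℝ (Fin d)
  pol : Fin A → ℝ
  y : Fin A → EuclideanSpace ℝ (Fin d)
  u : Fin A → EuclideanSpace ℝ (Fin d)
  q : Fin A → ℝ
  s : Fin A → ℝ
  n : ℕ

/-- The vector of coordinates of a token. -/
def Tok.vec (t : Tok d A) : Coord d A → ℝ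
  | .act c => t.act c
  | .rew => t.rew
  | .set k c => t.set k c
  | .pol k => t.pol k
  | .y k c => t.y k c
  | .u k c => t.u k c
  | .q k => t.q k
  | .s k => t.s k
  | .pos c => posEmb t.n c

/-! ### Attention heads -/

/-- Query matrix for the product of the block `y k` of the query token and the block `act` of the
key token, with sign `σ`. -/
def queryY (σ : ℝ) (k : Fin A) : Matrix (Coord d A) (Coord d A) ℝ :=
  pick (fun | .act _ => σ | _ => 0) (fun | .act c => .y k c | o => o)

/-- Key matrix which selects the block `act`. -/
def keyAct : Matrix (Coord d A) (Coord d A) ℝ :=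
  pick (fun | .act _ => 1 | _ => 0) id

/-- Key matrix which moves the block `set k` to the block `act`. -/
def keySet (k : Fin A) : Matrix (Coord d A) (Coord d A) ℝ :=
  pick (fun | .act _ => 1 | _ => 0) (fun | .act c => .set k c | o => o)

/-- Query matrix for the product `B * (j - i)` of the positions `i` of the query token and `j` of
the key token; it uses the first two coordinates of the block `pos`. -/
def queryMask (B : ℝ) : Matrix (Coord d A) (Coord d A) ℝ :=
  pick (fun | .pos 0 => -B | .pos 1 => B | _ => 0) (fun | .pos 1 => .pos 2 | o => o)

/-- Query matrix for the product `i * (j - i)` of the positions. -/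
def queryPosMask : Matrix (Coord d A) (Coord d A) ℝ :=
  pick (fun | .pos 0 => -1 | .pos 1 => 1 | _ => 0)
    (fun | .pos 0 => .pos 1 | .pos 1 => .pos 0 | o => o)

/-- Key matrix for `queryMask` and `queryPosMask`. -/
def keyMask : Matrix (Coord d A) (Coord d A) ℝ :=
  pick (fun | .pos 0 => 1 | .pos 1 => 1 | _ => 0)
    (fun | .pos 0 => .pos 2 | .pos 1 => .pos 0 | o => o)

/-- The matrix with the single entry `1`, which copies the coordinate `p` to the coordinate `o`. -/
def entry (o p : Coord d A) : Matrix (Coord d A) (Coord d A) ℝ :=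
  pick (fun o' => if o' = o then 1 else 0) (fun _ => p)

/-- The matrix which copies the coordinates `F` to the block `y k`. -/
def toY (k : Fin A) (F : Fin d → Coord d A) : Matrix (Coord d A) (Coord d A) ℝ :=
  pick (fun | .y k' _ => if k' = k then 1 else 0 | _ => 0) (fun | .y _ c => F c | o => o)

/-- The matrix which copies the coordinates `F` to the block `u k`. -/
def toU (k : Fin A) (F : Fin d → Coord d A) : Matrix (Coord d A) (Coord d A) ℝ :=
  pick (fun | .u k' _ => if k' = k then 1 else 0 | _ => 0) (fun | .u _ c => F c | o => o)

/-- The matrix which copies the coordinates `F` to the block `pol`. -/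
def toPol (F : Fin A → Coord d A) : Matrix (Coord d A) (Coord d A) ℝ :=
  pick (fun | .pol _ => 1 | _ => 0) (fun | .pol k => F k | o => o)

/-- The head with weights `relu (σ * ⟪y_i, a_j⟫)` and values `σ * V h_j`. The two signs together
have the effect of a head with the weights `⟪y_i, a_j⟫`, where `y_i` is the block `y k`. -/
def pairHead (σ : ℝ) (k : Fin A) (V : Matrix (Coord d A) (Coord d A) ℝ) : Head (Coord d A) :=
  ⟨σ • V, queryY σ k, keyAct⟩

/-- The head with weights `relu (1 + (j - i))`, that is, weight one for `j = i` only. -/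
def selfHead (V : Matrix (Coord d A) (Coord d A) ℝ) : Head (Coord d A) :=
  ⟨V, queryMask 1 + entry (.pos 2) (.pos 2), keyMask + entry (.pos 2) (.pos 2)⟩

/-- The head with weights `relu (i + i * (j - i))`, that is, weight `i` for `j = i` only. This
cancels the averaging factor, so that the head adds `V h_i` to the token `h_i`. -/
def linHead (V : Matrix (Coord d A) (Coord d A) ℝ) : Head (Coord d A) :=
  ⟨V, queryPosMask + entry (.pos 2) (.pos 0), keyMask + entry (.pos 2) (.pos 2)⟩

/-- The head with weights `relu (⟪y k, set k⟫ + B * (j - i))`. -/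
def quadHead (B : ℝ) (k : Fin A) (V : Matrix (Coord d A) (Coord d A) ℝ) : Head (Coord d A) :=
  ⟨V, queryMask B + queryY 1 k, keyMask + keySet k⟩

/-- The head with weights `relu (s k * s k + B * (j - i))`. -/
def squareHead (B : ℝ) (k : Fin A) (V : Matrix (Coord d A) (Coord d A) ℝ) : Head (Coord d A) :=
  ⟨V, queryMask B + entry (.pos 2) (.s k), keyMask + entry (.pos 2) (.s k)⟩

section HeadOutputs

variable {N : ℕ} {t : Fin N → Tok d A}

lemma relu_sub_relu_neg (x : ℝ) : relu x - relu (-x) = x := by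
  rcases le_total 0 x with h | h <;> simp [relu, h]

lemma relu_of_nonneg {x : ℝ} (h : 0 ≤ x) : relu x = x := max_eq_left h

lemma relu_of_nonpos {x : ℝ} (h : x ≤ 0) : relu x = 0 := max_eq_right h

lemma pairHead_out_add (k : Fin A) (V : Matrix (Coord d A) (Coord d A) ℝ) (i : Fin N)
    (o : Coord d A) :
    (pairHead 1 k V).out (fun i => (t i).vec) i o + (pairHead (-1) k V).out (fun i => (t i).vec) i o
      = 1 / ((i : ℝ) + 1) *
        ∑ j ∈ Finset.Iic i, inner ℝ ((t j).act) ((t i).y k) * (V *ᵥ (t j).vec) o := by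
  have hdot : ∀ (σ : ℝ) (t t' : Tok d A),
      (queryY σ k *ᵥ t.vec) ⬝ᵥ (keyAct *ᵥ t'.vec) = σ * inner ℝ t'.act (t.y k) := by
    intro σ t t'
    simp only [queryY, keyAct, dotProduct, Coord.sum_eq, Tok.vec, PiLp.inner_apply, Finset.mul_sum,
      pick_mulVec]
    simp [mul_assoc]
  simp only [Head.out, pairHead, hdot]
  rw [← mul_add, ← Finset.sum_add_distrib]
  congr 1
  refine Finset.sum_congr rfl fun j _ => ?_
  nth_rewrite 3 [← relu_sub_relu_neg (inner ℝ ((t j).act) ((t i).y k))]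
  simp only [Matrix.smul_mulVec, Pi.smul_apply, smul_eq_mul, one_mul, neg_mul]
  ring

/-- A head whose weights vanish outside the diagonal. -/
lemma Head.out_eq_of_forall_lt {ι : Type} [Fintype ι] {h : Head ι} {H : Fin N → ι → ℝ} {i : Fin N}
    (hlt : ∀ j < i, (h.Q *ᵥ H i) ⬝ᵥ (h.K *ᵥ H j) ≤ 0) (o : ι) :
    h.out H i o
      = 1 / ((i : ℝ) + 1) * (relu ((h.Q *ᵥ H i) ⬝ᵥ (h.K *ᵥ H i)) * (h.V *ᵥ H i) o) := by
  rw [Head.out, Finset.sum_eq_single i]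
  · intro j hj hne
    rw [relu_of_nonpos (hlt j (lt_of_le_of_ne (Finset.mem_Iic.1 hj) hne)), zero_mul]
  · simp

lemma succ_le_of_lt_cast {i j : Fin N} (h : j < i) : (j : ℝ) + 1 ≤ i := by
  exact_mod_cast Nat.succ_le_of_lt h

lemma selfHead_out (hn : ∀ i, (t i).n = i + 1) (V : Matrix (Coord d A) (Coord d A) ℝ) (i : Fin N)
    (o : Coord d A) :
    (selfHead V).out (fun i => (t i).vec) i o = 1 / ((i : ℝ) + 1) * (V *ᵥ (t i).vec) o := by
  have hdot : ∀ i j, ((selfHead V).Q *ᵥ (t i).vec) ⬝ᵥ ((selfHead V).K *ᵥ (t j).vec)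
      = 1 + ((j : ℝ) - i) := by
    intro i j
    simp [selfHead, queryMask, keyMask, entry, Matrix.add_mulVec, dotProduct, Coord.sum_eq, Tok.vec,
      posEmb, hn]
    ring
  rw [Head.out_eq_of_forall_lt, hdot, sub_self, relu_of_nonneg (by norm_num), add_zero, one_mul]
  · rfl
  · intro j hj
    rw [hdot]
    linarith [succ_le_of_lt_cast hj]

lemma linHead_out (hn : ∀ i, (t i).n = i + 1) (V : Matrix (Coord d A) (Coord d A) ℝ) (i : Fin N)
    (o : Coord d A) :
    (linHead V).out (fun i => (t i).vec) i o = (V *ᵥ (t i).vec) o := by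
  have hdot : ∀ i j, ((linHead V).Q *ᵥ (t i).vec) ⬝ᵥ ((linHead V).K *ᵥ (t j).vec)
      = ((i : ℝ) + 1) * (1 + ((j : ℝ) - i)) := by
    intro i j
    simp [linHead, queryPosMask, keyMask, entry, Matrix.add_mulVec, dotProduct, Coord.sum_eq,
      Tok.vec, posEmb, hn]
    ring
  have hi : (0 : ℝ) < (i : ℝ) + 1 := by positivity
  rw [Head.out_eq_of_forall_lt, hdot, sub_self, add_zero, mul_one, relu_of_nonneg hi.le]
  · rw [← mul_assoc, one_div_mul_cancel hi.ne', one_mul]; rfl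
  · intro j hj
    rw [hdot]
    exact mul_nonpos_of_nonneg_of_nonpos hi.le (by linarith [succ_le_of_lt_cast hj])

lemma quadHead_out (hn : ∀ i, (t i).n = i + 1) {B : ℝ} (h0 : 0 ≤ B) {k : Fin A} {i : Fin N}
    (hB : ∀ j, inner ℝ ((t j).set k) ((t i).y k) ≤ B)
    (V : Matrix (Coord d A) (Coord d A) ℝ) (o : Coord d A) :
    (quadHead B k V).out (fun i => (t i).vec) i o
      = 1 / ((i : ℝ) + 1) * (relu (inner ℝ ((t i).set k) ((t i).y k)) * (V *ᵥ (t i).vec) o) := by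
  have hdot : ∀ i j, ((quadHead B k V).Q *ᵥ (t i).vec) ⬝ᵥ ((quadHead B k V).K *ᵥ (t j).vec)
      = inner ℝ ((t j).set k) ((t i).y k) + B * ((j : ℝ) - i) := by
    intro i j
    simp [quadHead, queryMask, keyMask, queryY, keySet, Matrix.add_mulVec, dotProduct,
      Coord.sum_eq, Tok.vec, posEmb, hn, PiLp.inner_apply]
    ring
  rw [Head.out_eq_of_forall_lt, hdot, sub_self, mul_zero, add_zero]
  · rfl
  · intro j hj
    rw [hdot]
    nlinarith [succ_le_of_lt_cast hj, hB j]

lemma squareHead_out (hn : ∀ i, (t i).n = i + 1) {B : ℝ} (h0 : 0 ≤ B) {k : Fin A} {i : Fin N}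
    (hB : ∀ j, (t i).s k * (t j).s k ≤ B)
    (V : Matrix (Coord d A) (Coord d A) ℝ) (o : Coord d A) :
    (squareHead B k V).out (fun i => (t i).vec) i o
      = 1 / ((i : ℝ) + 1) * ((t i).s k ^ 2 * (V *ᵥ (t i).vec) o) := by
  have hdot : ∀ i j, ((squareHead B k V).Q *ᵥ (t i).vec) ⬝ᵥ ((squareHead B k V).K *ᵥ (t j).vec)
      = (t i).s k * (t j).s k + B * ((j : ℝ) - i) := by
    intro i j
    simp [squareHead, queryMask, keyMask, entry, Matrix.add_mulVec, dotProduct,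
      Coord.sum_eq, Tok.vec, posEmb, hn]
    ring
  rw [Head.out_eq_of_forall_lt, hdot, sub_self, mul_zero, add_zero,
    relu_of_nonneg (mul_self_nonneg _), sq]
  · rfl
  · intro j hj
    rw [hdot]
    nlinarith [succ_le_of_lt_cast hj, hB j]

end HeadOutputs

/-! ### Operator norms of the weights -/

lemma opNorm_queryY_le {σ : ℝ} (hσ : |σ| ≤ 1) (k : Fin A) :
    opNorm (queryY (d := d) σ k) ≤ 1 := by
  refine opNorm_pick_le zero_le_one (fun o => ?_) fun o o' ho ho' h => ?_
  · cases o <;> simp [hσ]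
  · cases o <;> cases o' <;> simp_all

lemma opNorm_keyAct_le : opNorm (keyAct (d := d) (A := A)) ≤ 1 := by
  refine opNorm_pick_le zero_le_one (fun o => ?_) fun o o' ho ho' h => h
  cases o <;> simp

lemma opNorm_keySet_le (k : Fin A) : opNorm (keySet (d := d) k) ≤ 1 := by
  refine opNorm_pick_le zero_le_one (fun o => ?_) fun o o' ho ho' h => ?_
  · cases o <;> simp
  · cases o <;> cases o' <;> simp_all

lemma opNorm_queryMask_le {B : ℝ} (hB : 0 ≤ B) : opNorm (queryMask (d := d) (A := A) B) ≤ B := by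
  refine opNorm_pick_le hB (fun o => ?_) fun o o' ho ho' h => ?_
  · rcases o with _ | _ | _ | _ | _ | _ | _ | _ | c <;> try simp [hB]
    fin_cases c <;> simp [hB, abs_of_nonneg]
  · rcases o with _ | _ | _ | _ | _ | _ | _ | _ | c <;> try simp at ho
    rcases o' with _ | _ | _ | _ | _ | _ | _ | _ | c' <;> try simp at ho'
    fin_cases c <;> fin_cases c' <;> simp_all

lemma opNorm_queryPosMask_le : opNorm (queryPosMask (d := d) (A := A)) ≤ 1 := by
  refine opNorm_pick_le zero_le_one (fun o => ?_) fun o o' ho ho' h => ?_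
  · rcases o with _ | _ | _ | _ | _ | _ | _ | _ | c <;> try simp
    fin_cases c <;> simp
  · rcases o with _ | _ | _ | _ | _ | _ | _ | _ | c <;> try simp at ho
    rcases o' with _ | _ | _ | _ | _ | _ | _ | _ | c' <;> try simp at ho'
    fin_cases c <;> fin_cases c' <;> simp_all

lemma opNorm_keyMask_le : opNorm (keyMask (d := d) (A := A)) ≤ 1 := by
  refine opNorm_pick_le zero_le_one (fun o => ?_) fun o o' ho ho' h => ?_
  · rcases o with _ | _ | _ | _ | _ | _ | _ | _ | c <;> try simp
    fin_cases c <;> simp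
  · rcases o with _ | _ | _ | _ | _ | _ | _ | _ | c <;> try simp at ho
    rcases o' with _ | _ | _ | _ | _ | _ | _ | _ | c' <;> try simp at ho'
    fin_cases c <;> fin_cases c' <;> simp_all

lemma opNorm_entry_le (o p : Coord d A) : opNorm (entry o p) ≤ 1 := by
  refine opNorm_pick_le zero_le_one (fun o' => ?_) fun o₁ o₂ h₁ h₂ _ => ?_
  · by_cases h : o' = o <;> simp [h]
  · simp_all

lemma opNorm_toY_le (k : Fin A) {F : Fin d → Coord d A} (hF : Function.Injective F) :
    opNorm (toY k F) ≤ 1 := by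
  refine opNorm_pick_le zero_le_one (fun o => ?_) fun o o' ho ho' h => ?_
  · cases o <;> simp; split_ifs <;> simp
  · cases o <;> cases o' <;> simp_all [hF.eq_iff]

lemma opNorm_toU_le (k : Fin A) {F : Fin d → Coord d A} (hF : Function.Injective F) :
    opNorm (toU k F) ≤ 1 := by
  refine opNorm_pick_le zero_le_one (fun o => ?_) fun o o' ho ho' h => ?_
  · cases o <;> simp; split_ifs <;> simp
  · cases o <;> cases o' <;> simp_all [hF.eq_iff]

lemma opNorm_toPol_le {F : Fin A → Coord d A} (hF : Function.Injective F) :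
    opNorm (toPol F) ≤ 1 := by
  refine opNorm_pick_le zero_le_one (fun o => ?_) fun o o' ho ho' h => ?_
  · cases o <;> simp
  · cases o <;> cases o' <;> simp_all [hF.eq_iff]

/-! ### The four kinds of layers -/

/-- The value matrix which adds the step `v / L` of the main sequence, for the vector `v` in the
coordinates `F`, to the blocks `y k` and `u k` as in `agdStep`. -/
def gradValue (L θ : ℝ) (k : Fin A) (F : Fin d → Coord d A) : Matrix (Coord d A) (Coord d A) ℝ :=
  (2 / (L * (1 + θ))) • toY k F + (1 / L) • toU k F

/-- The value matrix which adds the increments of `agdStep` that do not involve the gradient. -/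
def momentumValue (θ : ℝ) (k : Fin A) : Matrix (Coord d A) (Coord d A) ℝ :=
  ((θ ^ 2 - θ) / (1 + θ)) • toY k (.y k) + ((1 - θ) / (1 + θ)) • toY k (.u k)
    + (-θ) • toU k (.u k) + θ ^ 2 • toU k (.y k)

/-- The layer which makes one accelerated gradient step in each token and for each action. The
gradient `S y - c` is composed of the sum over the key tokens (first two heads), the regularization
term, which keeps the factor `1 / i` (third head), and `c` (fourth head). -/
def agdLayer (d A : ℕ) (lam L θ : ℝ) : LayerParams (Coord d A) (4 * A) 0 :=
  headLayer fun j k => ![pairHead 1 k ((-1 : ℝ) • gradValue L θ k .act),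
    pairHead (-1) k ((-1 : ℝ) • gradValue L θ k .act), selfHead ((-lam) • gradValue L θ k (.y k)),
    linHead (gradValue L θ k (.set k) + momentumValue θ k)] j

/-- The layer which evaluates the predicted rewards and the quadratic forms. -/
def readLayer (d A : ℕ) (B : ℝ) : LayerParams (Coord d A) (4 * A) 0 :=
  headLayer fun j k => ![pairHead 1 k (entry (.pol k) .rew), pairHead (-1) k (entry (.pol k) .rew),
    quadHead B k (entry (.q k) (.pos 2)), linHead 0] j

/-- The layer which makes one step of the square root iteration. -/
def sqrtLayer (d A : ℕ) (B η : ℝ) : LayerParams (Coord d A) (4 * A) 0 :=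
  headLayer fun j k => ![squareHead B k ((-η) • entry (.s k) (.pos 0)),
    linHead (η • entry (.s k) (.q k)), linHead 0, linHead 0] j

/-- The layer which forms the final scores `(pol + α * s) / τ`. It is linear, and one single head
treats all actions at once. -/
def outLayer (d A : ℕ) (α τ : ℝ) (k₀ : Fin A) : LayerParams (Coord d A) (4 * A) 0 :=
  headLayer fun j k => linHead <| if j = 0 ∧ k = k₀ then
    (τ⁻¹ - 1) • toPol .pol + (α / τ) • toPol .s else 0

section Effects

variable {N : ℕ} {t : Fin N → Tok d A}

/-- The matrix `(lam + ∑ j ≤ i, a_j a_jᵀ) / (i + 1)` as a linear map. -/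
def gram (lam : ℝ) (a : Fin N → EuclideanSpace ℝ (Fin d)) (i : Fin N) :
    EuclideanSpace ℝ (Fin d) →ₗ[ℝ] EuclideanSpace ℝ (Fin d) :=
  (1 / ((i : ℝ) + 1)) • (lam • LinearMap.id
    + ∑ j ∈ Finset.Iic i, (innerₛₗ ℝ (a j)).smulRight (a j))

lemma gram_apply (lam : ℝ) (a : Fin N → EuclideanSpace ℝ (Fin d)) (i : Fin N)
    (v : EuclideanSpace ℝ (Fin d)) : gram lam a i v
      = (1 / ((i : ℝ) + 1)) • (lam • v + ∑ j ∈ Finset.Iic i, inner ℝ (a j) v • a j) := by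
  simp [gram]

lemma gram_apply_coord (lam : ℝ) (a : Fin N → EuclideanSpace ℝ (Fin d)) (i : Fin N)
    (v : EuclideanSpace ℝ (Fin d)) (c : Fin d) : gram lam a i v c
      = 1 / ((i : ℝ) + 1) * (lam * v c) + 1 / ((i : ℝ) + 1) *
        ∑ j ∈ Finset.Iic i, inner ℝ (a j) v * a j c := by
  rw [gram_apply]
  simp

lemma attn_agdLayer (hn : ∀ i, (t i).n = i + 1) (lam : ℝ) {L θ : ℝ} (hL : 0 < L) (hθ : 0 < θ)
    (i : Fin N) :
    attn (agdLayer d A lam L θ) (fun i => (t i).vec) i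
      = ({ t i with
          y := fun k => (agdStep (gram lam (fun i => (t i).act) i) ((t i).set k) L θ
            ((t i).y k, (t i).u k)).1
          u := fun k => (agdStep (gram lam (fun i => (t i).act) i) ((t i).set k) L θ
            ((t i).y k, (t i).u k)).2 } : Tok d A).vec := by
  ext o
  have h1 : 1 + θ ≠ 0 := by positivity
  rw [agdLayer, attn_headLayer]
  simp only [Fin.sum_univ_four, Matrix.cons_val]
  simp only [pairHead_out_add, selfHead_out hn, linHead_out hn]
  have hsum : ∀ (b : ℝ) (k : Fin A) (c : Fin d),
      ∑ j ∈ Finset.Iic i, inner ℝ (t j).act ((t i).y k) * (b * (t j).act c)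
        = b * ∑ j ∈ Finset.Iic i, inner ℝ (t j).act ((t i).y k) * (t j).act c := by
    intro b k c
    rw [Finset.mul_sum]
    exact Finset.sum_congr rfl fun j _ => by ring
  cases o with
  | y k c =>
    rw [Finset.sum_eq_single k (fun k' _ hk => by
      simp [gradValue, momentumValue, toY, toU, Matrix.add_mulVec, Matrix.smul_mulVec, Matrix.neg_mulVec, hk.symm])
      (by simp)]
    simp [gradValue, momentumValue, toY, toU, Matrix.add_mulVec, Matrix.smul_mulVec, Matrix.neg_mulVec, Tok.vec,
      agdStep, gram_apply_coord]
    rw [hsum]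
    have hi : (i : ℝ) + 1 ≠ 0 := by positivity
    field_simp
    ring
  | u k c =>
    rw [Finset.sum_eq_single k (fun k' _ hk => by
      simp [gradValue, momentumValue, toY, toU, Matrix.add_mulVec, Matrix.smul_mulVec, Matrix.neg_mulVec, hk.symm])
      (by simp)]
    simp [gradValue, momentumValue, toY, toU, Matrix.add_mulVec, Matrix.smul_mulVec, Matrix.neg_mulVec, Tok.vec,
      agdStep, gram_apply_coord]
    rw [hsum]
    have hi : (i : ℝ) + 1 ≠ 0 := by positivity
    field_simp
    ring
  | _ => 
    simp [gradValue, momentumValue, toY, toU, Matrix.add_mulVec, Matrix.smul_mulVec, Matrix.neg_mulVec, Tok.vec]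

lemma attn_readLayer (hn : ∀ i, (t i).n = i + 1) {B : ℝ} (h0 : 0 ≤ B) {i : Fin N}
    (hB : ∀ k j, inner ℝ ((t j).set k) ((t i).y k) ≤ B) :
    attn (readLayer d A B) (fun i => (t i).vec) i
      = ({ t i with
          pol := fun k => (t i).pol k + 1 / ((i : ℝ) + 1) *
            ∑ j ∈ Finset.Iic i, inner ℝ ((t j).act) ((t i).y k) * (t j).rew
          q := fun k => (t i).q k
            + 1 / ((i : ℝ) + 1) * relu (inner ℝ ((t i).set k) ((t i).y k)) } : Tok d A).vec := by
  ext o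
  rw [readLayer, attn_headLayer]
  simp only [Fin.sum_univ_four, Matrix.cons_val]
  simp only [pairHead_out_add, quadHead_out hn h0 (hB _), linHead_out hn]
  cases o with
  | pol k =>
    rw [Finset.sum_eq_single k (fun k' _ hk => by simp [entry, hk.symm]) (by simp)]
    simp [entry, Tok.vec]
  | q k =>
    rw [Finset.sum_eq_single k (fun k' _ hk => by simp [entry, hk.symm]) (by simp)]
    simp [entry, Tok.vec, posEmb]
  | _ => simp [entry, Tok.vec]

lemma attn_sqrtLayer (hn : ∀ i, (t i).n = i + 1) {B : ℝ} (η : ℝ) (h0 : 0 ≤ B) {i : Fin N}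
    (hB : ∀ k j, (t i).s k * (t j).s k ≤ B) :
    attn (sqrtLayer d A B η) (fun i => (t i).vec) i
      = ({ t i with
          s := fun k => (t i).s k + η * ((t i).q k - (t i).s k ^ 2) } : Tok d A).vec := by
  ext o
  rw [sqrtLayer, attn_headLayer]
  simp only [Fin.sum_univ_four, Matrix.cons_val]
  simp only [squareHead_out hn h0 (hB _), linHead_out hn]
  cases o with
  | s k =>
    rw [Finset.sum_eq_single k (fun k' _ hk => by
      simp [entry, hk.symm, Matrix.smul_mulVec, Matrix.neg_mulVec]) (by simp)]
    have hi : (i : ℝ) + 1 ≠ 0 := by positivity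
    simp [entry, Tok.vec, posEmb, Matrix.smul_mulVec, Matrix.neg_mulVec, hn]
    field_simp
    ring
  | _ => simp [entry, Tok.vec, Matrix.smul_mulVec, Matrix.neg_mulVec]

lemma attn_outLayer (hn : ∀ i, (t i).n = i + 1) (α τ : ℝ) (k₀ : Fin A) (i : Fin N) :
    attn (outLayer d A α τ k₀) (fun i => (t i).vec) i
      = ({ t i with pol := fun k => ((t i).pol k + α * (t i).s k) / τ } : Tok d A).vec := by
  ext o
  rw [outLayer, attn_headLayer]
  simp only [linHead_out hn]
  rw [Finset.sum_eq_single k₀ (fun k' _ hk => by simp [hk]) (by simp),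
    Finset.sum_eq_single 0 (fun j _ hj => by simp [hj]) (by simp)]
  cases o with
  | pol k =>
    simp [toPol, Tok.vec, Matrix.add_mulVec, Matrix.smul_mulVec]
    ring
  | _ => simp [toPol, Tok.vec, Matrix.add_mulVec, Matrix.smul_mulVec]

end Effects

section Weights

/-- A bound for all query, key and value matrices of a layer, in the form in which they enter the norm
of a transformer. -/
def LayerParams.BoundedBy {M D' : ℕ} (θ : LayerParams (Coord d A) M D') (X Y : ℝ) : Prop :=
  (∀ m, opNorm (θ.Q m) ≤ X) ∧ (∀ m, opNorm (θ.K m) ≤ X) ∧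
    ∑ m, opNorm (θ.V m) + opNorm θ.W₁ + opNorm θ.W₂ ≤ Y

lemma boundedBy_headLayer {h : Fin 4 → Fin A → Head (Coord d A)} {X Y : ℝ}
    (hQK : ∀ j k, opNorm (h j k).Q ≤ X ∧ opNorm (h j k).K ≤ X)
    (hV : ∑ k, ∑ j, opNorm (h j k).V ≤ Y) : (headLayer h).BoundedBy X Y :=
  ⟨fun _ => (hQK _ _).1, fun _ => (hQK _ _).2, (sum_opNorm_headLayer h).trans_le hV⟩

lemma LayerParams.BoundedBy.mono {M D' : ℕ} {θ : LayerParams (Coord d A) M D'} {X Y X' Y' : ℝ}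
    (h : θ.BoundedBy X Y) (hX : X ≤ X') (hY : Y ≤ Y') : θ.BoundedBy X' Y' :=
  ⟨fun m => (h.1 m).trans hX, fun m => (h.2.1 m).trans hX, h.2.2.trans hY⟩

lemma opNorm_add_le_of_le {W W' : Matrix (Coord d A) (Coord d A) ℝ} {a b : ℝ} (h : opNorm W ≤ a)
    (h' : opNorm W' ≤ b) : opNorm (W + W') ≤ a + b :=
  (opNorm_add_le W W').trans (add_le_add h h')

lemma opNorm_smul_le_of_le {W : Matrix (Coord d A) (Coord d A) ℝ} {a b c : ℝ} (hW : opNorm W ≤ c)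
    (ha : |a| ≤ b) : opNorm (a • W) ≤ b * c := by
  rw [opNorm_smul]
  exact mul_le_mul ha hW (opNorm_nonneg W) ((abs_nonneg a).trans ha)

lemma pairHead_bounds {σ : ℝ} (hσ : |σ| ≤ 1) (k : Fin A) (V : Matrix (Coord d A) (Coord d A) ℝ) :
    opNorm (pairHead σ k V).Q ≤ 2 ∧ opNorm (pairHead σ k V).K ≤ 2 :=
  ⟨(opNorm_queryY_le hσ k).trans one_le_two, opNorm_keyAct_le.trans one_le_two⟩

lemma selfHead_bounds (V : Matrix (Coord d A) (Coord d A) ℝ) :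
    opNorm (selfHead V).Q ≤ 2 ∧ opNorm (selfHead V).K ≤ 2 := by
  rw [← one_add_one_eq_two]
  exact ⟨opNorm_add_le_of_le (opNorm_queryMask_le zero_le_one) (opNorm_entry_le _ _),
    opNorm_add_le_of_le opNorm_keyMask_le (opNorm_entry_le _ _)⟩

lemma linHead_bounds (V : Matrix (Coord d A) (Coord d A) ℝ) :
    opNorm (linHead V).Q ≤ 2 ∧ opNorm (linHead V).K ≤ 2 := by
  rw [← one_add_one_eq_two]
  exact ⟨opNorm_add_le_of_le opNorm_queryPosMask_le (opNorm_entry_le _ _),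
    opNorm_add_le_of_le opNorm_keyMask_le (opNorm_entry_le _ _)⟩

lemma quadHead_bounds {B : ℝ} (hB : 0 ≤ B) (k : Fin A) (V : Matrix (Coord d A) (Coord d A) ℝ) :
    opNorm (quadHead B k V).Q ≤ B + 2 ∧ opNorm (quadHead B k V).K ≤ B + 2 :=
  ⟨(opNorm_add_le_of_le (opNorm_queryMask_le hB) (opNorm_queryY_le (by simp) k)).trans (by linarith),
    (opNorm_add_le_of_le opNorm_keyMask_le (opNorm_keySet_le k)).trans (by linarith)⟩

lemma squareHead_bounds {B : ℝ} (hB : 0 ≤ B) (k : Fin A) (V : Matrix (Coord d A) (Coord d A) ℝ) :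
    opNorm (squareHead B k V).Q ≤ B + 2 ∧ opNorm (squareHead B k V).K ≤ B + 2 :=
  ⟨(opNorm_add_le_of_le (opNorm_queryMask_le hB) (opNorm_entry_le _ _)).trans (by linarith),
    (opNorm_add_le_of_le opNorm_keyMask_le (opNorm_entry_le _ _)).trans (by linarith)⟩

lemma opNorm_gradValue_le {L θ : ℝ} (hL : 0 < L) (hθ : 0 < θ) (k : Fin A) {F : Fin d → Coord d A}
    (hF : Function.Injective F) : opNorm (gradValue L θ k F) ≤ 3 / L := by
  have h1 : |2 / (L * (1 + θ))| ≤ 2 / L := by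
    rw [abs_of_pos (by positivity)]
    exact div_le_div_of_nonneg_left zero_le_two hL (by nlinarith)
  have h2 : |1 / L| ≤ 1 / L := (abs_of_pos (by positivity)).le
  refine (opNorm_add_le_of_le (opNorm_smul_le_of_le (opNorm_toY_le k hF) h1)
    (opNorm_smul_le_of_le (opNorm_toU_le k hF) h2)).trans (le_of_eq ?_)
  ring

lemma opNorm_momentumValue_le {θ : ℝ} (hθ : 0 < θ) (hθ1 : θ ≤ 1) (k : Fin A) :
    opNorm (momentumValue (d := d) θ k) ≤ 4 := by
  have hy : Function.Injective (Coord.y (d := d) k) := fun c c' h => by simpa using h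
  have hu : Function.Injective (Coord.u (d := d) k) := fun c c' h => by simpa using h
  have h1 : |(θ ^ 2 - θ) / (1 + θ)| ≤ 1 := by
    rw [abs_div, abs_of_pos (by positivity : 0 < 1 + θ), div_le_one (by positivity), abs_le]
    constructor <;> nlinarith
  have h2 : |(1 - θ) / (1 + θ)| ≤ 1 := by
    rw [abs_div, abs_of_pos (by positivity : 0 < 1 + θ), div_le_one (by positivity), abs_le]
    constructor <;> nlinarith
  have h3 : |(-θ)| ≤ 1 := by rwa [abs_neg, abs_of_pos hθ]
  have h4 : |θ ^ 2| ≤ 1 := by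
    rw [abs_of_pos (by positivity)]
    exact pow_le_one₀ hθ.le hθ1
  refine (opNorm_add_le_of_le (opNorm_add_le_of_le (opNorm_add_le_of_le
    (opNorm_smul_le_of_le (opNorm_toY_le k hy) h1) (opNorm_smul_le_of_le (opNorm_toY_le k hu) h2))
    (opNorm_smul_le_of_le (opNorm_toU_le k hu) h3))
    (opNorm_smul_le_of_le (opNorm_toU_le k hy) h4)).trans (by norm_num)

lemma boundedBy_agdLayer {lam L θ : ℝ} (hlam : 0 < lam) (hL : lam ≤ L) (hθ : 0 < θ) (hθ1 : θ ≤ 1) :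
    (agdLayer d A lam L θ).BoundedBy 2 (A * (7 + 9 / lam)) := by
  have hL0 : 0 < L := hlam.trans_le hL
  refine boundedBy_headLayer (fun j k => ?_) ?_
  · fin_cases j
    · exact pairHead_bounds (by simp) _ _
    · exact pairHead_bounds (by simp) _ _
    · exact selfHead_bounds _
    · exact linHead_bounds _
  · have hact : Function.Injective (Coord.act (d := d) (A := A)) := fun c c' h => by simpa using h
    have hg : ∀ (a : ℝ) (k : Fin A) (F : Fin d → Coord d A), Function.Injective F →
        opNorm (a • gradValue L θ k F) ≤ |a| * (3 / L) := fun a k F hF =>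
      opNorm_smul_le_of_le (opNorm_gradValue_le hL0 hθ k hF) le_rfl
    have h3 : 3 / L ≤ 3 / lam := div_le_div_of_nonneg_left (by norm_num) hlam hL
    have h4 : lam * (3 / L) ≤ 3 := by
      rw [mul_div_assoc', div_le_iff₀ hL0]
      linarith
    calc _ ≤ ∑ _k : Fin A, (7 + 9 / lam) := Finset.sum_le_sum fun k _ => ?_
      _ = A * (7 + 9 / lam) := by simp [mul_add]
    simp only [Fin.sum_univ_four, Matrix.cons_val, pairHead, selfHead, linHead, smul_smul]
    have a1 := hg (1 * -1) k _ hact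
    have a2 := hg (-1 * -1) k _ hact
    have a3 := hg (-lam) k (.y k) fun c c' h => by simpa using h
    have a4 := opNorm_add_le_of_le (opNorm_gradValue_le hL0 hθ k (F := .set k)
      fun c c' h => by simpa using h) (opNorm_momentumValue_le (d := d) hθ hθ1 k)
    rw [abs_neg, abs_of_pos hlam] at a3
    norm_num at a1 a2 a3
    have : 9 / lam = 3 * (3 / lam) := by ring
    norm_num
    linarith

lemma boundedBy_readLayer {B : ℝ} (hB : 0 ≤ B) : (readLayer d A B).BoundedBy (B + 2) (A * 3) := by
  refine boundedBy_headLayer (fun j k => ?_) ?_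
  · have h2 : (2 : ℝ) ≤ B + 2 := by linarith
    fin_cases j
    · exact (pairHead_bounds (by simp) _ _).imp h2.trans' h2.trans'
    · exact (pairHead_bounds (by simp) _ _).imp h2.trans' h2.trans'
    · exact quadHead_bounds hB _ _
    · exact (linHead_bounds _).imp h2.trans' h2.trans'
  · calc _ ≤ ∑ _k : Fin A, (3 : ℝ) := Finset.sum_le_sum fun k _ => ?_
      _ = A * 3 := by simp
    simp only [Fin.sum_univ_four, Matrix.cons_val, pairHead, quadHead, linHead, opNorm_smul,
      opNorm_zero, abs_neg, abs_one, one_mul]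
    linarith [opNorm_entry_le (Coord.pol (d := d) k) .rew,
      opNorm_entry_le (Coord.q (d := d) k) (.pos 2)]

lemma boundedBy_sqrtLayer {B η : ℝ} (hB : 0 ≤ B) (hη : |η| ≤ 1) :
    (sqrtLayer d A B η).BoundedBy (B + 2) (A * 2) := by
  refine boundedBy_headLayer (fun j k => ?_) ?_
  · have h2 : (2 : ℝ) ≤ B + 2 := by linarith
    fin_cases j
    · exact squareHead_bounds hB _ _
    all_goals exact (linHead_bounds _).imp h2.trans' h2.trans'
  · calc _ ≤ ∑ _k : Fin A, (2 : ℝ) := Finset.sum_le_sum fun k _ => ?_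
      _ = A * 2 := by simp
    simp only [Fin.sum_univ_four, Matrix.cons_val, squareHead, linHead, opNorm_zero]
    have a1 := opNorm_smul_le_of_le (opNorm_entry_le (Coord.s (d := d) k) (.pos 0))
      ((abs_neg η).trans_le hη)
    have a2 := opNorm_smul_le_of_le (opNorm_entry_le (Coord.s (d := d) k) (.q k)) hη
    linarith

lemma boundedBy_outLayer {α τ : ℝ} (hα : 0 ≤ α) (hτ : 0 < τ) (hτ1 : τ ≤ 1) (k₀ : Fin A) :
    (outLayer d A α τ k₀).BoundedBy 2 ((1 + α) / τ) := by
  refine boundedBy_headLayer (fun j k => linHead_bounds _) ?_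
  rw [Finset.sum_eq_single k₀ (fun k' _ hk => by simp [hk, linHead, opNorm_zero]) (by simp),
    Finset.sum_eq_single 0 (fun j _ hj => by simp [hj, linHead, opNorm_zero]) (by simp)]
  have h1 : 1 ≤ τ⁻¹ := (one_le_inv₀ hτ).2 hτ1
  have a1 := opNorm_smul_le_of_le (a := τ⁻¹ - 1) (opNorm_toPol_le (F := Coord.pol (d := d) (A := A))
    fun c c' h => by simpa using h) (abs_of_nonneg (by linarith)).le
  have a2 := opNorm_smul_le_of_le (a := α / τ) (opNorm_toPol_le (F := Coord.s (d := d) (A := A))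
    fun c c' h => by simpa using h) (abs_of_nonneg (by positivity)).le
  rw [if_pos ⟨rfl, rfl⟩]
  refine (opNorm_add_le_of_le a1 a2).trans ?_
  rw [add_div, one_div]
  linarith

end Weights

end Layers

/-! ### The linear systems solved by the tokens -/

section Gram

variable {d N : ℕ} {a : Fin N → EuclideanSpace ℝ (Fin d)} {lam : ℝ}

lemma inner_gram (lam : ℝ) (a : Fin N → EuclideanSpace ℝ (Fin d)) (i : Fin N)
    (v w : EuclideanSpace ℝ (Fin d)) : inner ℝ (gram lam a i v) w
      = 1 / ((i : ℝ) + 1)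
        * (lam * inner ℝ v w + ∑ j ∈ Finset.Iic i, inner ℝ (a j) v * inner ℝ (a j) w) := by
  rw [gram_apply, real_inner_smul_left, inner_add_left, real_inner_smul_left, sum_inner]
  simp only [real_inner_smul_left]

lemma inner_gram_comm (i : Fin N) (v w : EuclideanSpace ℝ (Fin d)) :
    inner ℝ (gram lam a i v) w = inner ℝ v (gram lam a i w) := by
  rw [real_inner_comm (gram lam a i w), inner_gram, inner_gram, real_inner_comm w v]
  simp only [mul_comm]

lemma le_inner_gram (i : Fin N) (v : EuclideanSpace ℝ (Fin d)) :
    lam / ((i : ℝ) + 1) * ‖v‖ ^ 2 ≤ inner ℝ (gram lam a i v) v := by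
  rw [inner_gram, real_inner_self_eq_norm_sq, mul_add]
  have : 0 ≤ 1 / ((i : ℝ) + 1) *
      ∑ j ∈ Finset.Iic i, inner ℝ (a j) v * inner ℝ (a j) v :=
    mul_nonneg (by positivity) (Finset.sum_nonneg fun j _ => mul_self_nonneg _)
  have e : lam / ((i : ℝ) + 1) * ‖v‖ ^ 2 = 1 / ((i : ℝ) + 1) * (lam * ‖v‖ ^ 2) := by ring
  linarith

lemma sum_Iic_le {i : Fin N} {f : Fin N → ℝ} {b : ℝ} (h : ∀ j, f j ≤ b) :
    1 / ((i : ℝ) + 1) * ∑ j ∈ Finset.Iic i, f j ≤ b := by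
  have h1 : ∑ j ∈ Finset.Iic i, f j ≤ ((i : ℝ) + 1) * b := by
    refine (Finset.sum_le_sum fun j _ => h j).trans (le_of_eq ?_)
    simp [Fin.card_Iic]
  rw [one_div, inv_mul_le_iff₀ (by positivity)]
  exact h1

lemma inner_gram_le {B : ℝ} (hlam : 0 < lam) (ha : ∀ j, ‖a j‖ ≤ B) (i : Fin N)
    (v : EuclideanSpace ℝ (Fin d)) :
    inner ℝ (gram lam a i v) v ≤ (lam + B ^ 2) * ‖v‖ ^ 2 := by
  rw [inner_gram, real_inner_self_eq_norm_sq, mul_add, add_mul]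
  refine add_le_add ?_ (sum_Iic_le fun j => ?_)
  · rw [one_div, inv_mul_le_iff₀ (by positivity)]
    exact le_mul_of_one_le_left (by positivity) (by linarith [(Nat.cast_nonneg i : (0 : ℝ) ≤ i)])
  · rw [← sq, ← mul_pow, ← sq_abs]
    refine pow_le_pow_left₀ (abs_nonneg _) ((abs_real_inner_le_norm _ _).trans ?_) 2
    exact mul_le_mul_of_nonneg_right (ha j) (norm_nonneg v)

lemma exists_gram_eq (hlam : 0 < lam) (i : Fin N) (c : EuclideanSpace ℝ (Fin d)) :
    ∃ x, gram lam a i x = c := by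
  refine LinearMap.injective_iff_surjective.1 ?_ c
  rw [injective_iff_map_eq_zero]
  intro v hv
  have h := le_inner_gram (lam := lam) (a := a) i v
  rw [hv, inner_zero_left] at h
  have hpos : 0 < lam / ((i : ℝ) + 1) := by positivity
  have : ‖v‖ ^ 2 = 0 := le_antisymm (nonpos_of_mul_nonpos_right h hpos) (by positivity)
  simpa using this

variable {i : Fin N} {c x : EuclideanSpace ℝ (Fin d)}

lemma norm_solution_le (hlam : 0 < lam) (hx : gram lam a i x = c) :
    ‖x‖ ≤ ((i : ℝ) + 1) * ‖c‖ / lam := by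
  have h := le_inner_gram (lam := lam) (a := a) i x
  rw [hx] at h
  have h2 := h.trans (real_inner_le_norm c x)
  rcases (norm_nonneg x).eq_or_lt with h0 | h0
  · rw [← h0]; positivity
  · rw [sq, ← mul_assoc] at h2
    have h3 := le_of_mul_le_mul_right h2 h0
    rw [div_mul_eq_mul_div, div_le_iff₀ (by positivity)] at h3
    rw [le_div_iff₀ hlam]
    linarith

lemma inner_solution_nonneg (hlam : 0 < lam) (hx : gram lam a i x = c) : 0 ≤ inner ℝ c x := by
  rw [← hx]
  exact le_trans (by positivity) (le_inner_gram (lam := lam) (a := a) i x)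

/-- The quadratic form of the inverse is bounded below: this is `0 ≤ ⟪S v, v⟫` for
`v = x - c / L`, where `S x = c` and `S ≤ L`. -/
lemma norm_sq_div_le_inner_solution {B : ℝ} (hlam : 0 < lam) (ha : ∀ j, ‖a j‖ ≤ B)
    (hx : gram lam a i x = c) : ‖c‖ ^ 2 / (lam + B ^ 2) ≤ inner ℝ c x := by
  have hL : 0 < lam + B ^ 2 := by positivity
  have h1 := inner_gram_le hlam ha i c
  have h2 : 0 ≤ inner ℝ (gram lam a i (x - (lam + B ^ 2)⁻¹ • c)) (x - (lam + B ^ 2)⁻¹ • c) :=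
    le_trans (by positivity) (le_inner_gram i _)
  rw [map_sub, map_smul, hx, inner_sub_left, inner_sub_right, inner_sub_right,
    real_inner_smul_left, real_inner_smul_left, real_inner_smul_right, real_inner_smul_right,
    inner_gram_comm i c x, hx, real_inner_self_eq_norm_sq] at h2
  generalize lam + B ^ 2 = L at *
  have h3 : L⁻¹ * (L⁻¹ * inner ℝ (gram lam a i c) c) ≤ L⁻¹ * ‖c‖ ^ 2 := by
    rw [mul_le_mul_iff_right₀ (by positivity), inv_mul_le_iff₀ hL]
    exact h1
  rw [div_eq_inv_mul]
  linarith

end Gram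

/-! ### Accuracy of the approximate solution and of the square root -/

section Accuracy

variable {d N : ℕ} {a : Fin N → EuclideanSpace ℝ (Fin d)} {lam : ℝ} {i : Fin N}
  {c x : EuclideanSpace ℝ (Fin d)}

lemma norm_agd_gram_sub_sq_le {B T θ : ℝ} (hlam : 0 < lam) (hi : (i : ℝ) + 1 ≤ 2 * T)
    (ha : ∀ j, ‖a j‖ ≤ B) (hc : ‖c‖ ≤ B) (hθ : 0 < θ) (hθ1 : θ ≤ 1)
    (hθ2 : (lam + B ^ 2) * θ ^ 2 = lam / (2 * T)) (hx : gram lam a i x = c) (n : ℕ) :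
    ‖(agd (gram lam a i) c (lam + B ^ 2) θ n).1 - x‖ ^ 2 ≤
        (1 - θ) ^ n * (2 * (2 * T * B / lam) ^ 2) ∧
      ‖(agd (gram lam a i) c (lam + B ^ 2) θ n).2 - θ • x‖ ^ 2 ≤
        (1 - θ) ^ n * (2 * (2 * T * B / lam) ^ 2) := by
  have hi0 : 0 < (i : ℝ) + 1 := by positivity
  have hT : 0 < 2 * T := hi0.trans_le hi
  have hL : 0 < lam + B ^ 2 := by positivity
  have hB : 0 ≤ B := (norm_nonneg c).trans hc
  have hlow : ∀ v, (lam + B ^ 2) * θ ^ 2 * ‖v‖ ^ 2 ≤ inner ℝ (gram lam a i v) v := fun v => by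
    refine le_trans ?_ (le_inner_gram i v)
    rw [hθ2]
    gcongr
  obtain ⟨h1, h2⟩ := norm_agd_sub_sq_le (fun v w => inner_gram_comm i v w) hL hθ hθ1 hlow
    (inner_gram_le hlam ha i) hx n
  have hcx : inner ℝ c x ≤ 2 * T * B ^ 2 / lam := by
    refine (real_inner_le_norm c x).trans ?_
    calc ‖c‖ * ‖x‖ ≤ B * (2 * T * B / lam) := by
          refine mul_le_mul hc ((norm_solution_le hlam hx).trans ?_) (norm_nonneg x) hB
          gcongr
      _ = 2 * T * B ^ 2 / lam := by ring
  have hmul : (1 - θ) ^ n * (2 * inner ℝ c x) ≤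
      lam / (2 * T) * ((1 - θ) ^ n * (2 * (2 * T * B / lam) ^ 2)) := by
    have e : lam / (2 * T) * ((1 - θ) ^ n * (2 * (2 * T * B / lam) ^ 2))
        = (1 - θ) ^ n * (2 * (2 * T * B ^ 2 / lam)) := by
      field_simp
    rw [e]
    have : 0 ≤ (1 - θ) ^ n := pow_nonneg (sub_nonneg.2 hθ1) n
    gcongr
  constructor
  · rw [hθ2] at h1
    exact le_of_mul_le_mul_left (h1.trans hmul) (by positivity)
  · refine le_of_mul_le_mul_left ((le_trans ?_ h2).trans hmul) (by positivity)
    rw [← hθ2]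
    gcongr
    exact mul_le_of_le_one_right hL.le (pow_le_one₀ hθ.le hθ1)

lemma norm_agd_gram_le {B T θ : ℝ} (hlam : 0 < lam) (hi : (i : ℝ) + 1 ≤ 2 * T)
    (ha : ∀ j, ‖a j‖ ≤ B) (hc : ‖c‖ ≤ B) (hθ : 0 < θ) (hθ1 : θ ≤ 1)
    (hθ2 : (lam + B ^ 2) * θ ^ 2 = lam / (2 * T)) (n : ℕ) :
    ‖(agd (gram lam a i) c (lam + B ^ 2) θ n).1‖ ≤ 3 * (2 * T * B / lam) ∧
      ‖(agd (gram lam a i) c (lam + B ^ 2) θ n).2‖ ≤ 3 * (2 * T * B / lam) := by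
  obtain ⟨x, hx⟩ := exists_gram_eq (a := a) hlam i c
  obtain ⟨h1, h2⟩ := norm_agd_gram_sub_sq_le hlam hi ha hc hθ hθ1 hθ2 hx n
  have hB : 0 ≤ B := (norm_nonneg c).trans hc
  have hT : 0 < 2 * T := lt_of_lt_of_le (by positivity) hi
  have hxn : ‖x‖ ≤ 2 * T * B / lam := (norm_solution_le hlam hx).trans (by gcongr)
  have hX : 0 ≤ 2 * T * B / lam := by positivity
  have hp : (1 - θ) ^ n ≤ 1 := pow_le_one₀ (sub_nonneg.2 hθ1) (by linarith)
  generalize 2 * T * B / lam = X at *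
  have key : ∀ v w : EuclideanSpace ℝ (Fin d), ‖w‖ ≤ X →
      ‖v - w‖ ^ 2 ≤ (1 - θ) ^ n * (2 * X ^ 2) → ‖v‖ ≤ 3 * X := by
    intro v w hw hvw
    have h3 : ‖v - w‖ ≤ 2 * X := by
      refine le_of_sq_le_sq (hvw.trans ?_) (by positivity)
      nlinarith [sq_nonneg X, mul_le_mul_of_nonneg_right hp (by positivity : 0 ≤ 2 * X ^ 2)]
    have := norm_add_le (v - w) w
    rw [sub_add_cancel] at this
    linarith
  refine ⟨key _ x hxn h1, key _ (θ • x) ?_ h2⟩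
  rw [norm_smul, Real.norm_of_nonneg hθ.le]
  exact (mul_le_of_le_one_left (norm_nonneg x) hθ1).trans hxn

lemma norm_agd_gram_sub_le {B T θ δ : ℝ} (hlam : 0 < lam) (hi : (i : ℝ) + 1 ≤ 2 * T)
    (ha : ∀ j, ‖a j‖ ≤ B) (hc : ‖c‖ ≤ B) (hθ : 0 < θ) (hθ1 : θ ≤ 1)
    (hθ2 : (lam + B ^ 2) * θ ^ 2 = lam / (2 * T)) (hx : gram lam a i x = c) (hδ : 0 ≤ δ) {n : ℕ}
    (hn : Real.exp (-(θ * n)) * (2 * (2 * T * B / lam) ^ 2) ≤ δ ^ 2) :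
    ‖(agd (gram lam a i) c (lam + B ^ 2) θ n).1 - x‖ ≤ δ := by
  refine le_of_sq_le_sq ?_ hδ
  refine ((norm_agd_gram_sub_sq_le hlam hi ha hc hθ hθ1 hθ2 hx n).1.trans ?_).trans hn
  refine mul_le_mul_of_nonneg_right ?_ (by positivity)
  rw [← neg_mul, mul_comm, Real.exp_nat_mul]
  exact pow_le_pow_left₀ (sub_nonneg.2 hθ1) (by linarith [Real.add_one_le_exp (-θ)]) n

lemma inner_solution_div_le {B : ℝ} (hlam : 0 < lam) (hc : ‖c‖ ≤ B) (hx : gram lam a i x = c) :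
    1 / ((i : ℝ) + 1) * inner ℝ c x ≤ B ^ 2 / lam := by
  have hi0 : 0 < (i : ℝ) + 1 := by positivity
  rw [one_div, inv_mul_le_iff₀ hi0]
  calc inner ℝ c x ≤ ‖c‖ * ‖x‖ := real_inner_le_norm c x
    _ ≤ B * (((i : ℝ) + 1) * B / lam) := by
        refine mul_le_mul hc ((norm_solution_le hlam hx).trans ?_) (norm_nonneg x)
          ((norm_nonneg c).trans hc)
        gcongr
    _ = _ := by ring

/-- The read-out of the quadratic form is as accurate as the solution of the linear system. -/
lemma abs_relu_inner_sub_le {B δ : ℝ} (hlam : 0 < lam) (hc : ‖c‖ ≤ B) (hx : gram lam a i x = c)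
    {y : EuclideanSpace ℝ (Fin d)} (hy : ‖y - x‖ ≤ δ) :
    |1 / ((i : ℝ) + 1) * relu (inner ℝ c y) - 1 / ((i : ℝ) + 1) * inner ℝ c x| ≤ B * δ := by
  have h0 := inner_solution_nonneg hlam hx
  have h1 : |inner ℝ c y - inner ℝ c x| ≤ B * δ := by
    rw [← inner_sub_right]
    exact (abs_real_inner_le_norm _ _).trans
      (mul_le_mul hc hy (norm_nonneg _) ((norm_nonneg c).trans hc))
  have h2 : |relu (inner ℝ c y) - inner ℝ c x| ≤ B * δ := by
    rw [← relu_of_nonneg h0]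
    exact (abs_max_sub_max_le_abs _ _ _).trans h1
  rw [← mul_sub, abs_mul, abs_of_pos (by positivity)]
  refine (mul_le_of_le_one_left (abs_nonneg _) ?_).trans h2
  rw [div_le_one (by positivity)]
  linarith [(Nat.cast_nonneg i : (0 : ℝ) ≤ i)]

/-- The square root iteration for a perturbed argument. -/
lemma abs_sqrtIter_sub_sqrt_le {q q' e κ ρ : ℝ} (hq' : 0 ≤ q') (hκ : √q' ≤ κ) (hρ : 0 < ρ)
    (hρq : ρ ≤ √q) (hqq : |q' - q| ≤ e) (he : e ≤ 3 / 4 * ρ ^ 2) (n : ℕ) :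
    |sqrtIter (1 / (2 * κ)) q' n - √q| ≤ κ * Real.exp (-(ρ / (4 * κ) * n)) + e / ρ := by
  have hq : 0 < √q := hρ.trans_le hρq
  have hqs : √q * √q = q := Real.mul_self_sqrt (Real.sqrt_pos.1 hq).le
  have hqs' : √q' * √q' = q' := Real.mul_self_sqrt hq'
  have hhalf : ρ / 2 ≤ √q' := by
    refine Real.le_sqrt_of_sq_le ?_
    nlinarith [(abs_le.1 hqq).1]
  have hκ0 : 0 < κ := by linarith
  have hη : 1 / (2 * κ) * √q' ≤ 1 / 2 := by
    rw [div_mul_eq_mul_div, div_le_iff₀ (by positivity)]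
    linarith
  obtain ⟨-, h2, h3⟩ := sqrtIter_bounds (η := 1 / (2 * κ)) (q := q') (by positivity) hq'
    (by linarith) n
  have h4 : √q' * (1 - 1 / (2 * κ) * √q') ^ n ≤ κ * Real.exp (-(ρ / (4 * κ) * n)) := by
    refine mul_le_mul hκ ?_ (pow_nonneg (by linarith) n) hκ0.le
    rw [← neg_mul, mul_comm (-_), Real.exp_nat_mul]
    refine pow_le_pow_left₀ (by linarith) ?_ n
    have h5 : ρ / (4 * κ) ≤ 1 / (2 * κ) * √q' := by
      have : ρ / (4 * κ) = 1 / (2 * κ) * (ρ / 2) := by field_simp; norm_num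
      rw [this]
      gcongr
    linarith [Real.add_one_le_exp (-(ρ / (4 * κ)))]
  have h6 : |√q' - √q| ≤ e / ρ := by
    rw [le_div_iff₀ hρ]
    refine le_trans ?_ hqq
    have : q' - q = (√q' - √q) * (√q' + √q) := by linear_combination hqs - hqs'
    rw [this, abs_mul]
    refine mul_le_mul_of_nonneg_left ?_ (abs_nonneg _)
    rw [abs_of_nonneg (by positivity)]
    linarith [Real.sqrt_nonneg q']
  have h7 : |sqrtIter (1 / (2 * κ)) q' n - √q'| ≤ κ * Real.exp (-(ρ / (4 * κ) * n)) := by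
    rw [abs_of_nonpos (by linarith)]
    linarith
  exact (abs_sub_le _ _ _).trans (add_le_add h7 h6)

/-- The read-out of the predicted reward is as accurate as the solution of the linear system. -/
lemma abs_sum_inner_sub_le {B δ r : ℝ} (ha : ∀ j, ‖a j‖ ≤ B) {rew : Fin N → ℝ}
    (hr : ∀ j, |rew j| ≤ r) {y : EuclideanSpace ℝ (Fin d)} (hy : ‖y - x‖ ≤ δ) :
    |1 / ((i : ℝ) + 1) * ∑ j ∈ Finset.Iic i, inner ℝ (a j) y * rew j
      - 1 / ((i : ℝ) + 1) * ∑ j ∈ Finset.Iic i, inner ℝ (a j) x * rew j| ≤ B * δ * r := by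
  rw [← mul_sub, ← Finset.sum_sub_distrib, abs_mul, abs_of_pos (by positivity)]
  refine (mul_le_mul_of_nonneg_left (Finset.abs_sum_le_sum_abs _ _) (by positivity)).trans ?_
  refine sum_Iic_le fun j => ?_
  rw [← sub_mul, ← inner_sub_right, abs_mul]
  have hB : 0 ≤ B := (norm_nonneg _).trans (ha j)
  have hδ : 0 ≤ δ := (norm_nonneg _).trans hy
  refine mul_le_mul ((abs_real_inner_le_norm _ _).trans ?_) (hr j) (abs_nonneg _) (by positivity)
  exact mul_le_mul (ha j) hy (norm_nonneg _) hB

end Accuracy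

section Network

/-! ### The network and the tokens between its layers -/

/-- The parameters of the network: the regularization `lam`, the smoothness constant `L` and the
momentum parameter `θ` of accelerated gradient descent, the mask size `B`, the step size `η` of the
square root iteration, the confidence width `α`, the temperature `τ`, the numbers `n₁` and `n₂` of
gradient and square root steps, and the action `k₀` whose head forms the final scores. -/
structure NetParams (A : ℕ) where
  lam : ℝ
  L : ℝ
  θ : ℝ
  B : ℝ
  η : ℝ
  α : ℝ
  τ : ℝ
  n₁ : ℕ
  n₂ : ℕ
  k₀ : Fin A

/-- The layers of the network. -/
def NetParams.layer {A : ℕ} (p : NetParams A) (d l : ℕ) : LayerParams (Coord d A) (4 * A) 0 :=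
  if l < p.n₁ then agdLayer d A p.lam p.L p.θ
  else if l = p.n₁ then readLayer d A p.B
  else if l < p.n₁ + 1 + p.n₂ then sqrtLayer d A p.B p.η
  else outLayer d A p.α p.τ p.k₀

variable {d A N : ℕ}

/-- An input token, whose state blocks are zero. -/
def Tok.input (act : EuclideanSpace ℝ (Fin d)) (rew : ℝ)
    (set : Fin A → EuclideanSpace ℝ (Fin d)) (n : ℕ) : Tok d A :=
  ⟨act, rew, set, 0, 0, 0, 0, 0, n⟩

variable (p : NetParams A) (act : Fin N → EuclideanSpace ℝ (Fin d)) (rew : Fin N → ℝ)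
  (set : Fin N → Fin A → EuclideanSpace ℝ (Fin d))

/-- The token `i` after `n` steps of accelerated gradient descent. -/
def solveTok (n : ℕ) (i : Fin N) : Tok d A :=
  { Tok.input (act i) (rew i) (set i) (i + 1) with
    y := fun k => (agd (gram p.lam act i) (set i k) p.L p.θ n).1
    u := fun k => (agd (gram p.lam act i) (set i k) p.L p.θ n).2 }

/-- The quadratic form read out from the approximate solution of the linear system. -/
def quadRead (i : Fin N) (k : Fin A) : ℝ :=
  1 / ((i : ℝ) + 1) * relu (inner ℝ (set i k) (agd (gram p.lam act i) (set i k) p.L p.θ p.n₁).1)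

/-- The predicted reward read out from the approximate solution of the linear system. -/
def rewardRead (i : Fin N) (k : Fin A) : ℝ :=
  1 / ((i : ℝ) + 1) * ∑ j ∈ Finset.Iic i,
    inner ℝ (act j) (agd (gram p.lam act i) (set i k) p.L p.θ p.n₁).1 * rew j

/-- The token `i` after `n` steps of the square root iteration. -/
def rootTok (n : ℕ) (i : Fin N) : Tok d A :=
  { solveTok p act rew set p.n₁ i with
    pol := rewardRead p act rew set i
    q := quadRead p act set i
    s := fun k => sqrtIter p.η (quadRead p act set i k) n }

/-- The final scores. -/
def score (i : Fin N) (k : Fin A) : ℝ :=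
  (rewardRead p act rew set i k + p.α * sqrtIter p.η (quadRead p act set i k) p.n₂) / p.τ

/-- The token `i` after all layers. -/
def outTok (i : Fin N) : Tok d A :=
  { rootTok p act rew set p.n₂ i with pol := score p act rew set i }

/-- The token `i` after `l` layers. -/
def tokAfter (l : ℕ) (i : Fin N) : Tok d A :=
  if l ≤ p.n₁ then solveTok p act rew set l i
  else if l ≤ p.n₁ + 1 + p.n₂ then rootTok p act rew set (l - (p.n₁ + 1)) i
  else outTok p act rew set i

variable {p act rew set}

lemma layer_tokAfter (hL : 0 < p.L) (hθ : 0 < p.θ) (hB : 0 ≤ p.B)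
    (hy : ∀ i j k,
      inner ℝ (set j k) (agd (gram p.lam act i) (set i k) p.L p.θ p.n₁).1 ≤ p.B)
    (hs : ∀ i j k n,
      sqrtIter p.η (quadRead p act set i k) n * sqrtIter p.η (quadRead p act set j k) n ≤ p.B)
    {l : ℕ} (hl : l < p.n₁ + 1 + p.n₂ + 1) (i : Fin N) :
    mlp (p.layer d l) (attn (p.layer d l) fun i => (tokAfter p act rew set l i).vec) i
      = (tokAfter p act rew set (l + 1) i).vec := by
  have key : attn (p.layer d l) (fun i => (tokAfter p act rew set l i).vec) i
      = (tokAfter p act rew set (l + 1) i).vec := by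
    rcases lt_trichotomy l p.n₁ with h | h | h
    · have e1 : ∀ i, tokAfter p act rew set l i = solveTok p act rew set l i := fun i =>
        if_pos h.le
      have e2 : tokAfter p act rew set (l + 1) i = solveTok p act rew set (l + 1) i := if_pos h
      simp only [e1, e2, NetParams.layer, if_pos h]
      rw [attn_agdLayer (fun _ => rfl) p.lam hL hθ]
      simp only [solveTok, Tok.input, agd_succ, Prod.mk.eta]
    · subst h
      have e1 : ∀ i, tokAfter p act rew set p.n₁ i = solveTok p act rew set p.n₁ i := fun i =>
        if_pos le_rfl
      have e2 : tokAfter p act rew set (p.n₁ + 1) i = rootTok p act rew set 0 i := by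
        simp [tokAfter]
      simp only [e1, e2, NetParams.layer, lt_irrefl, if_true, if_false]
      rw [attn_readLayer (fun _ => rfl) hB fun k j => hy i j k]
      congr 1
      simp [rootTok, solveTok, Tok.input, quadRead, rewardRead, sqrtIter, funext_iff]
    · rcases Nat.lt_or_ge l (p.n₁ + 1 + p.n₂) with h' | h'
      · obtain ⟨n, rfl⟩ := Nat.exists_eq_add_of_le (Nat.succ_le_of_lt h)
        simp only [Nat.succ_eq_add_one] at *
        have e1 : ∀ i, tokAfter p act rew set (p.n₁ + 1 + n) i = rootTok p act rew set n i :=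
          fun i => by
            rw [tokAfter, if_neg (by omega), if_pos (by omega)]; congr 1; omega
        have e2 : tokAfter p act rew set (p.n₁ + 1 + n + 1) i = rootTok p act rew set (n + 1) i := by
            rw [tokAfter, if_neg (by omega), if_pos (by omega)]; congr 1; omega
        simp only [e1, e2, NetParams.layer]
        rw [if_neg (by omega), if_neg (by omega), if_pos h',
          attn_sqrtLayer (fun _ => rfl) p.η hB fun k j => hs i j k n]
        congr 1
      · obtain rfl : l = p.n₁ + 1 + p.n₂ := by omega
        have e1 : ∀ i, tokAfter p act rew set (p.n₁ + 1 + p.n₂) i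
            = rootTok p act rew set p.n₂ i :=
          fun i => by
            rw [tokAfter, if_neg (by omega), if_pos (by omega)]; congr 1; omega
        have e2 : tokAfter p act rew set (p.n₁ + 1 + p.n₂ + 1) i = outTok p act rew set i := by
            rw [tokAfter, if_neg (by omega), if_neg (by omega)]
        simp only [e1, e2, NetParams.layer]
        rw [if_neg (by omega), if_neg (by omega), if_neg (by omega),
          attn_outLayer (fun _ => rfl)]
        congr 1
  rw [← key]
  unfold NetParams.layer
  split_ifs <;> exact mlp_headLayer _ _ _

lemma tokAfter_zero (i : Fin N) :
    tokAfter p act rew set 0 i = Tok.input (act i) (rew i) (set i) (i + 1) := by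
  simp only [tokAfter, zero_le, if_true, solveTok, agd, Function.iterate_zero, id]
  rfl

/-- The output of the network, if the projections to the ball do nothing. -/
lemma transformer_network (hL : 0 < p.L) (hθ : 0 < p.θ) (hB : 0 ≤ p.B)
    (hy : ∀ i j k,
      inner ℝ (set j k) (agd (gram p.lam act i) (set i k) p.L p.θ p.n₁).1 ≤ p.B)
    (hs : ∀ i j k n,
      sqrtIter p.η (quadRead p act set i k) n * sqrtIter p.η (quadRead p act set j k) n ≤ p.B)
    {R : ℝ} (hR : ∀ l i, l2norm (tokAfter p act rew set l i).vec ≤ R) (i : Fin N) (k : Fin A) :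
    transformer R (p.n₁ + 1 + p.n₂ + 1) (fun l => p.layer d l)
        (fun i => (Tok.input (act i) (rew i) (set i) (i + 1)).vec) i (.pol k)
      = score p act rew set i k := by
  have h := transformer_eq_of_l2norm_le (p.layer d) (fun l i => (tokAfter p act rew set l i).vec)
    (p.n₁ + 1 + p.n₂ + 1) (fun l hl i => layer_tokAfter hL hθ hB hy hs hl i) fun l _ i => hR l i
  simp only [tokAfter_zero] at h
  rw [h]
  have e : tokAfter p act rew set (p.n₁ + 1 + p.n₂ + 1) i = outTok p act rew set i := by
    rw [tokAfter, if_neg (by omega), if_neg (by omega)]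
  change (tokAfter p act rew set (p.n₁ + 1 + p.n₂ + 1) i).vec (.pol k) = _
  rw [e]
  rfl

/-- A bound for the coordinates of a token from bounds for its blocks. -/
lemma abs_vec_le {t : Tok d A} {β : ℝ} (h1 : ‖t.act‖ ≤ β) (h2 : |t.rew| ≤ β)
    (h3 : ∀ k, ‖t.set k‖ ≤ β) (h4 : ∀ k, |t.pol k| ≤ β) (h5 : ∀ k, ‖t.y k‖ ≤ β)
    (h6 : ∀ k, ‖t.u k‖ ≤ β) (h7 : ∀ k, |t.q k| ≤ β) (h8 : ∀ k, |t.s k| ≤ β) (hn : 1 ≤ t.n)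
    (h9 : (t.n : ℝ) ^ 2 ≤ β) (o : Coord d A) : |t.vec o| ≤ β := by
  have hn' : (1 : ℝ) ≤ t.n := by exact_mod_cast hn
  have hco : ∀ (v : EuclideanSpace ℝ (Fin d)) c, |v c| ≤ ‖v‖ := fun v c => PiLp.norm_apply_le v c
  cases o with
  | act c => exact (hco _ c).trans h1
  | rew => exact h2
  | set k c => exact (hco _ c).trans (h3 k)
  | pol k => exact h4 k
  | y k c => exact (hco _ c).trans (h5 k)
  | u k c => exact (hco _ c).trans (h6 k)
  | q k => exact h7 k
  | s k => exact h8 k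
  | pos c =>
    fin_cases c
    · simp [Tok.vec, posEmb]; nlinarith
    · simpa [Tok.vec, posEmb] using h9
    · simp [Tok.vec, posEmb]; nlinarith

end Network

/-! ### Invariants and accuracy of the network -/

/-- The relations between the parameters of the network, for actions of norm at most `Ba`, horizon
`T` and an error `δ` of the approximate solutions of the linear systems. -/
structure NetParams.Tuned {A : ℕ} (p : NetParams A) (Ba T δ : ℝ) : Prop where
  lam_pos : 0 < p.lam
  L_eq : p.L = p.lam + Ba ^ 2
  θ_pos : 0 < p.θ
  θ_le : p.θ ≤ 1
  θ_eq : (p.lam + Ba ^ 2) * p.θ ^ 2 = p.lam / (2 * T)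
  B_eq : p.B = 3 * (2 * T * Ba / p.lam) * Ba + (Ba ^ 2 / p.lam + 1)
  η_eq : p.η = 1 / (2 * (Ba ^ 2 / p.lam + 2))
  α_nonneg : 0 ≤ p.α
  τ_pos : 0 < p.τ
  Ba_nonneg : 0 ≤ Ba
  T_pos : 0 < T
  δ_nonneg : 0 ≤ δ
  δ_le : Ba * δ ≤ 1
  solve : Real.exp (-(p.θ * p.n₁)) * (2 * (2 * T * Ba / p.lam) ^ 2) ≤ δ ^ 2

section Invariants

variable {d A N : ℕ} {p : NetParams A} {Ba T δ r : ℝ} {act : Fin N → EuclideanSpace ℝ (Fin d)}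
  {rew : Fin N → ℝ} {set : Fin N → Fin A → EuclideanSpace ℝ (Fin d)}

lemma quadRead_nonneg (i : Fin N) (k : Fin A) : 0 ≤ quadRead p act set i k :=
  mul_nonneg (by positivity) (le_max_right _ _)

lemma norm_solver_sub_le (h : p.Tuned Ba T δ) (ha : ∀ j, ‖act j‖ ≤ Ba)
    (hset : ∀ i k, ‖set i k‖ ≤ Ba) {i : Fin N} (hi : (i : ℝ) + 1 ≤ 2 * T) {k : Fin A}
    {x : EuclideanSpace ℝ (Fin d)} (hx : gram p.lam act i x = set i k) :
    ‖(agd (gram p.lam act i) (set i k) p.L p.θ p.n₁).1 - x‖ ≤ δ := by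
  rw [h.L_eq]
  exact norm_agd_gram_sub_le h.lam_pos hi ha (hset i k) h.θ_pos h.θ_le h.θ_eq hx h.δ_nonneg h.solve

lemma quadRead_le (h : p.Tuned Ba T δ) (ha : ∀ j, ‖act j‖ ≤ Ba)
    (hset : ∀ i k, ‖set i k‖ ≤ Ba) {i : Fin N} (hi : (i : ℝ) + 1 ≤ 2 * T) (k : Fin A) :
    quadRead p act set i k ≤ Ba ^ 2 / p.lam + 1 := by
  obtain ⟨x, hx⟩ := exists_gram_eq (a := act) h.lam_pos i (set i k)
  have h1 := (abs_le.1 (abs_relu_inner_sub_le h.lam_pos (hset i k) hx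
    (norm_solver_sub_le h ha hset hi hx))).2
  have h2 := inner_solution_div_le h.lam_pos (hset i k) hx
  rw [quadRead]
  linarith [h.δ_le]

lemma sqrt_le_self_add_one {x : ℝ} (hx : 0 ≤ x) : √x ≤ x + 1 := by
  rw [Real.sqrt_le_left (by linarith)]
  nlinarith

lemma sqrt_quadRead_le (h : p.Tuned Ba T δ) (ha : ∀ j, ‖act j‖ ≤ Ba)
    (hset : ∀ i k, ‖set i k‖ ≤ Ba) {i : Fin N} (hi : (i : ℝ) + 1 ≤ 2 * T) (k : Fin A) :
    √(quadRead p act set i k) ≤ Ba ^ 2 / p.lam + 2 := by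
  have h1 := sqrt_le_self_add_one (quadRead_nonneg (p := p) (act := act) (set := set) i k)
  linarith [quadRead_le h ha hset hi k]

lemma sqrtIter_quadRead_bounds (h : p.Tuned Ba T δ) (ha : ∀ j, ‖act j‖ ≤ Ba)
    (hset : ∀ i k, ‖set i k‖ ≤ Ba) {i : Fin N} (hi : (i : ℝ) + 1 ≤ 2 * T) (k : Fin A) (n : ℕ) :
    0 ≤ sqrtIter p.η (quadRead p act set i k) n ∧
      sqrtIter p.η (quadRead p act set i k) n ≤ √(quadRead p act set i k) := by
  have hlam := h.lam_pos
  have hκ : 0 < Ba ^ 2 / p.lam + 2 := by positivity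
  have hη : 2 * p.η * √(quadRead p act set i k) ≤ 1 := by
    have h1 := sqrt_quadRead_le h ha hset hi k
    have e : 2 * p.η = 1 / (Ba ^ 2 / p.lam + 2) := by rw [h.η_eq]; field_simp
    rw [e, div_mul_eq_mul_div, div_le_one hκ]
    linarith
  obtain ⟨h1, h2, -⟩ := sqrtIter_bounds (by rw [h.η_eq]; positivity) (quadRead_nonneg i k) hη n
  exact ⟨h1, h2⟩

lemma inner_solver_le (h : p.Tuned Ba T δ) (ha : ∀ j, ‖act j‖ ≤ Ba)
    (hset : ∀ i k, ‖set i k‖ ≤ Ba) {i : Fin N} (hi : (i : ℝ) + 1 ≤ 2 * T) (j : Fin N) (k : Fin A) :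
    inner ℝ (set j k) (agd (gram p.lam act i) (set i k) p.L p.θ p.n₁).1 ≤ p.B := by
  have h1 := (norm_agd_gram_le h.lam_pos hi ha (hset i k) h.θ_pos h.θ_le h.θ_eq p.n₁).1
  rw [← h.L_eq] at h1
  have hlam := h.lam_pos
  have h2 : 0 ≤ Ba ^ 2 / p.lam + 1 := by positivity
  rw [h.B_eq]
  refine (real_inner_le_norm _ _).trans ?_
  have := mul_le_mul (hset j k) h1 (norm_nonneg _) h.Ba_nonneg
  linarith

lemma sqrtIter_mul_le (h : p.Tuned Ba T δ) (ha : ∀ j, ‖act j‖ ≤ Ba)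
    (hset : ∀ i k, ‖set i k‖ ≤ Ba) (hN : ∀ i : Fin N, (i : ℝ) + 1 ≤ 2 * T) (i j : Fin N)
    (k : Fin A) (n : ℕ) :
    sqrtIter p.η (quadRead p act set i k) n * sqrtIter p.η (quadRead p act set j k) n ≤ p.B := by
  have hQ : ∀ i, sqrtIter p.η (quadRead p act set i k) n ≤ √(Ba ^ 2 / p.lam + 1) := fun i =>
    (sqrtIter_quadRead_bounds h ha hset (hN i) k n).2.trans
      (Real.sqrt_le_sqrt (quadRead_le h ha hset (hN i) k))
  have hlam := h.lam_pos
  have hBa := h.Ba_nonneg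
  have hT := h.T_pos
  have h1 := mul_le_mul (hQ i) (hQ j) (sqrtIter_quadRead_bounds h ha hset (hN j) k n).1
    (Real.sqrt_nonneg _)
  rw [Real.mul_self_sqrt (by positivity)] at h1
  rw [h.B_eq]
  have : 0 ≤ 3 * (2 * T * Ba / p.lam) * Ba := by positivity
  linarith

lemma abs_rewardRead_le (h : p.Tuned Ba T δ) (ha : ∀ j, ‖act j‖ ≤ Ba)
    (hset : ∀ i k, ‖set i k‖ ≤ Ba) (hr : ∀ j, |rew j| ≤ r) {i : Fin N} (hi : (i : ℝ) + 1 ≤ 2 * T)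
    (k : Fin A) : |rewardRead p act rew set i k| ≤ Ba * (3 * (2 * T * Ba / p.lam)) * r := by
  have h1 := (norm_agd_gram_le h.lam_pos hi ha (hset i k) h.θ_pos h.θ_le h.θ_eq p.n₁).1
  rw [← h.L_eq, ← sub_zero (agd (gram p.lam act i) (set i k) p.L p.θ p.n₁).1] at h1
  have h2 := abs_sum_inner_sub_le (i := i) ha hr h1
  simpa [rewardRead] using h2

/-- The size of the coordinates of the tokens. -/
def NetParams.size {A : ℕ} (p : NetParams A) (Ba T r : ℝ) : ℝ :=
  Ba + r + 3 * (2 * T * Ba / p.lam) + (2 * T) ^ 2 + (Ba ^ 2 / p.lam + 2)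
    + Ba * (3 * (2 * T * Ba / p.lam)) * r
    + (Ba * (3 * (2 * T * Ba / p.lam)) * r + p.α * (Ba ^ 2 / p.lam + 2)) / p.τ

lemma NetParams.Tuned.size_nonneg (h : p.Tuned Ba T δ) (hr : 0 ≤ r) : 0 ≤ p.size Ba T r := by
  have := h.lam_pos
  have := h.Ba_nonneg
  have := h.T_pos
  have := h.α_nonneg
  have := h.τ_pos
  unfold NetParams.size
  positivity

lemma l2norm_tokAfter_le (h : p.Tuned Ba T δ) (ha : ∀ j, ‖act j‖ ≤ Ba)
    (hset : ∀ i k, ‖set i k‖ ≤ Ba) (hr : ∀ j, |rew j| ≤ r) (hN : ∀ i : Fin N, (i : ℝ) + 1 ≤ 2 * T)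
    (l : ℕ) (i : Fin N) :
    l2norm (tokAfter p act rew set l i).vec ≤ Fintype.card (Coord d A) * p.size Ba T r := by
  have hr0 : 0 ≤ r := (abs_nonneg _).trans (hr i)
  refine l2norm_le_card_mul (fun o => ?_) (h.size_nonneg hr0)
  have hlam := h.lam_pos
  have hBa := h.Ba_nonneg
  have hT := h.T_pos
  have hα := h.α_nonneg
  have hτ := h.τ_pos
  have p1 : 0 ≤ 3 * (2 * T * Ba / p.lam) := by positivity
  have p2 : 0 ≤ (2 * T) ^ 2 := by positivity
  have p3 : 0 ≤ Ba ^ 2 / p.lam + 2 := by positivity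
  have p4 : 0 ≤ Ba * (3 * (2 * T * Ba / p.lam)) * r := by positivity
  have p5 : 0 ≤ (Ba * (3 * (2 * T * Ba / p.lam)) * r + p.α * (Ba ^ 2 / p.lam + 2)) / p.τ := by
    positivity
  have h0 := h.size_nonneg hr0
  obtain ⟨s1, s2, s3, s4, s5, s6, s7⟩ : Ba ≤ p.size Ba T r ∧ r ≤ p.size Ba T r ∧
      3 * (2 * T * Ba / p.lam) ≤ p.size Ba T r ∧ (2 * T) ^ 2 ≤ p.size Ba T r ∧
      Ba ^ 2 / p.lam + 2 ≤ p.size Ba T r ∧ Ba * (3 * (2 * T * Ba / p.lam)) * r ≤ p.size Ba T r ∧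
      (Ba * (3 * (2 * T * Ba / p.lam)) * r + p.α * (Ba ^ 2 / p.lam + 2)) / p.τ ≤ p.size Ba T r := by
    unfold NetParams.size
    generalize 3 * (2 * T * Ba / p.lam) = v1 at *
    generalize Ba ^ 2 / p.lam + 2 = v2 at *
    generalize (2 * T) ^ 2 = v3 at *
    generalize (Ba * v1 * r + p.α * v2) / p.τ = v4 at *
    generalize Ba * v1 * r = v5 at *
    refine ⟨?_, ?_, ?_, ?_, ?_, ?_, ?_⟩ <;> linarith
  generalize p.size Ba T r = β at *
  have b1 : ‖act i‖ ≤ β := (ha i).trans s1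
  have b2 : |rew i| ≤ β := (hr i).trans s2
  have b3 : ∀ k, ‖set i k‖ ≤ β := fun k => (hset i k).trans s1
  have b5 : ∀ n k, ‖(agd (gram p.lam act i) (set i k) p.L p.θ n).1‖ ≤ β ∧
      ‖(agd (gram p.lam act i) (set i k) p.L p.θ n).2‖ ≤ β := fun n k => by
    obtain ⟨h1, h2⟩ := norm_agd_gram_le h.lam_pos (hN i) ha (hset i k) h.θ_pos h.θ_le h.θ_eq n
    rw [← h.L_eq] at h1 h2
    exact ⟨h1.trans s3, h2.trans s3⟩
  have c4 : ∀ k, |rewardRead p act rew set i k| ≤ Ba * (3 * (2 * T * Ba / p.lam)) * r :=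
    abs_rewardRead_le h ha hset hr (hN i)
  have b4 : ∀ k, |rewardRead p act rew set i k| ≤ β := fun k =>
    (c4 k).trans s6
  have b7 : ∀ k, |quadRead p act set i k| ≤ β := fun k => by
    rw [abs_of_nonneg (quadRead_nonneg i k)]
    exact (quadRead_le h ha hset (hN i) k).trans (le_trans (by linarith) s5)
  have c8 : ∀ n k, |sqrtIter p.η (quadRead p act set i k) n| ≤ Ba ^ 2 / p.lam + 2 := fun n k => by
    obtain ⟨h1, h2⟩ := sqrtIter_quadRead_bounds h ha hset (hN i) k n
    rw [abs_of_nonneg h1]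
    exact h2.trans (sqrt_quadRead_le h ha hset (hN i) k)
  have b8 : ∀ n k, |sqrtIter p.η (quadRead p act set i k) n| ≤ β := fun n k =>
    (c8 n k).trans s5
  have b4' : ∀ k, |score p act rew set i k| ≤ β := fun k => by
    rw [score, abs_div, abs_of_pos hτ]
    refine le_trans (div_le_div_of_nonneg_right ?_ hτ.le) (b := (Ba * (3 * (2 * T * Ba / p.lam)) * r
      + p.α * (Ba ^ 2 / p.lam + 2)) / p.τ) s7
    refine (abs_add_le _ _).trans (add_le_add (c4 k) ?_)
    rw [abs_mul, abs_of_nonneg hα]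
    exact mul_le_mul_of_nonneg_left (c8 _ k) hα
  have b9 : (((i : ℕ) + 1 : ℕ) : ℝ) ^ 2 ≤ β := by
    push_cast
    have : ((i : ℝ) + 1) ^ 2 ≤ (2 * T) ^ 2 := pow_le_pow_left₀ (by positivity) (hN i) 2
    exact this.trans s4
  have z : ∀ k : Fin A, |(0 : Fin A → ℝ) k| ≤ β := fun k => by simpa using h0
  unfold tokAfter
  split_ifs
  · exact abs_vec_le (t := solveTok p act rew set l i) b1 b2 b3 z (fun k => (b5 l k).1)
      (fun k => (b5 l k).2) z z (Nat.le_add_left 1 i) b9 o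
  · exact abs_vec_le (t := rootTok p act rew set (l - (p.n₁ + 1)) i) b1 b2 b3 b4
      (fun k => (b5 p.n₁ k).1) (fun k => (b5 p.n₁ k).2) b7 (b8 _) (Nat.le_add_left 1 i) b9 o
  · exact abs_vec_le (t := outTok p act rew set i) b1 b2 b3 b4'
      (fun k => (b5 p.n₁ k).1) (fun k => (b5 p.n₁ k).2) b7 (b8 _) (Nat.le_add_left 1 i) b9 o

/-- The scores computed by the network approximate the upper confidence bounds, divided by the
temperature. -/
lemma abs_score_sub_le {ρ : ℝ} (h : p.Tuned Ba T δ) (ha : ∀ j, ‖act j‖ ≤ Ba)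
    (hset : ∀ i k, ‖set i k‖ ≤ Ba) (hr : ∀ j, |rew j| ≤ r) {i : Fin N} (hi : (i : ℝ) + 1 ≤ 2 * T)
    {k : Fin A} {x : EuclideanSpace ℝ (Fin d)} (hx : gram p.lam act i x = set i k) (hρ : 0 < ρ)
    (hρ2 : 2 * T * (p.lam + Ba ^ 2) * ρ ^ 2 ≤ ‖set i k‖ ^ 2) (hδ : Ba * δ ≤ 3 / 4 * ρ ^ 2) :
    |score p act rew set i k
        - (1 / ((i : ℝ) + 1) * ∑ j ∈ Finset.Iic i, inner ℝ (act j) x * rew j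
          + p.α * √(1 / ((i : ℝ) + 1) * inner ℝ (set i k) x)) / p.τ|
      ≤ (Ba * δ * r + p.α * ((Ba ^ 2 / p.lam + 2)
          * Real.exp (-(ρ / (4 * (Ba ^ 2 / p.lam + 2)) * p.n₂)) + Ba * δ / ρ)) / p.τ := by
  have hlam := h.lam_pos
  have hy := norm_solver_sub_le h ha hset hi hx
  have h1 := abs_sum_inner_sub_le (i := i) ha hr hy
  have h2 := abs_relu_inner_sub_le h.lam_pos (hset i k) hx hy
  have hL : 0 < p.lam + Ba ^ 2 := by positivity
  have hi0 : 0 < (i : ℝ) + 1 := by positivity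
  have hρq : ρ ≤ √(1 / ((i : ℝ) + 1) * inner ℝ (set i k) x) := by
    refine Real.le_sqrt_of_sq_le ?_
    have h3 := norm_sq_div_le_inner_solution h.lam_pos ha hx
    rw [div_le_iff₀ hL] at h3
    rw [one_div, le_inv_mul_iff₀ hi0]
    refine le_of_mul_le_mul_right (le_trans ?_ (hρ2.trans h3)) hL
    have : 0 ≤ (p.lam + Ba ^ 2) * ρ ^ 2 := by positivity
    nlinarith
  have h4 := abs_sqrtIter_sub_sqrt_le (quadRead_nonneg i k) (sqrt_quadRead_le h ha hset hi k) hρ hρq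
    h2 hδ p.n₂
  rw [← h.η_eq] at h4
  rw [score, ← sub_div, abs_div, abs_of_pos h.τ_pos]
  refine div_le_div_of_nonneg_right ?_ h.τ_pos.le
  rw [add_sub_add_comm, ← mul_sub]
  refine (abs_add_le _ _).trans (add_le_add h1 ?_)
  rw [abs_mul, abs_of_nonneg h.α_nonneg]
  exact mul_le_mul_of_nonneg_left h4 h.α_nonneg

end Invariants

/-! ### The input tokens of a history -/

section HistoryTokens

variable {d A n : ℕ}

/-- The action in the token `i` (zero for a token which carries an action set). -/
def tokenAct (h : History d A n) (i : Fin (2 * n + 1)) : EuclideanSpace ℝ (Fin d) :=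
  if hi : (i : ℕ) % 2 = 0 then 0 else h.action ⟨(i : ℕ) / 2, by omega⟩

/-- The reward in the token `i` (zero for a token which carries an action set). -/
def tokenRew (h : History d A n) (i : Fin (2 * n + 1)) : ℝ :=
  if hi : (i : ℕ) % 2 = 0 then 0 else h.reward ⟨(i : ℕ) / 2, by omega⟩

/-- The action set in the token `i` (zero for a token which carries an action). -/
def tokenSet (h : History d A n) (i : Fin (2 * n + 1)) : Fin A → EuclideanSpace ℝ (Fin d) :=
  if (i : ℕ) % 2 = 0 then h.actionSet ⟨(i : ℕ) / 2, by omega⟩ else 0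

lemma tokens_eq (h : History d A n) (i : Fin (2 * n + 1)) :
    tokens (Fintype.card (Work d A)) h i
      = (Tok.input (tokenAct h i) (tokenRew h i) (tokenSet h i) (i + 1)).vec
        ∘ Coord.ofTokenIdx d A := by
  have hzero : ∀ (t : Tok d A) (w : Work d A), t.y = 0 → t.u = 0 → t.q = 0 → t.s = 0 →
      t.vec (Coord.blocks d A (.inr (.inr (.inr (.inl w))))) = 0 := by
    rintro t (⟨k, c⟩ | ⟨k, c⟩ | k | k) hy hu hq hs <;>
      simp [Coord.blocks, Tok.vec, hy, hu, hq, hs]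
  ext o
  by_cases hi : (i : ℕ) % 2 = 0
  · rcases o with (c | c) | ⟨k, c⟩ | k | w | c <;>
      simp only [tokens, tokenAct, tokenRew, tokenSet, dif_pos hi, if_pos hi]
    case inr.inr.inr.inl => exact (hzero _ _ rfl rfl rfl rfl).symm
    all_goals rfl
  · rcases o with (c | c) | ⟨k, c⟩ | k | w | c <;>
      simp only [tokens, tokenAct, tokenRew, tokenSet, dif_neg hi, if_neg hi]
    case inr.inr.inr.inl => exact (hzero _ _ rfl rfl rfl rfl).symm
    all_goals rfl

lemma sum_tokens (h : History d A n) {V : Type*} [AddCommMonoid V]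
    (F : EuclideanSpace ℝ (Fin d) → ℝ → V) (hF : F 0 0 = 0) :
    ∑ i ∈ Finset.Iic (Fin.last (2 * n)), F (tokenAct h i) (tokenRew h i)
      = ∑ j, F (h.action j) (h.reward j) := by
  have huniv : Finset.Iic (Fin.last (2 * n)) = Finset.univ := by
    ext i; simp [Fin.le_last]
  rw [huniv]
  symm
  refine Fintype.sum_of_injective (fun j : Fin n => (⟨2 * j + 1, by omega⟩ : Fin (2 * n + 1)))
    (fun j j' hj => ?_) _ _ (fun i hi => ?_) fun j => ?_
  · have := congrArg Fin.val hj
    ext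
    simp only at this
    omega
  · have he : (i : ℕ) % 2 = 0 := by
      by_contra hodd
      exact hi ⟨⟨(i : ℕ) / 2, by omega⟩, Fin.ext (by simp only; omega)⟩
    simp only [tokenAct, tokenRew, dif_pos he, hF]
  · have ho : ¬ (2 * (j : ℕ) + 1) % 2 = 0 := by omega
    have hj : (⟨(2 * (j : ℕ) + 1) / 2, by omega⟩ : Fin n) = j := Fin.ext (by simp only; omega)
    simp only [tokenAct, tokenRew, dif_neg ho, hj]

lemma tokenSet_last (h : History d A n) : tokenSet h (Fin.last (2 * n)) = h.current := by
  simp [tokenSet, History.current]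
  rfl

/-! ### Soft LinUCB in terms of the linear systems -/

variable {lam : ℝ}

lemma gram_last (h : History d A n) (v : EuclideanSpace ℝ (Fin d)) :
    gram lam (tokenAct h) (Fin.last (2 * n)) v = (1 / (((2 * n : ℕ) : ℝ) + 1)) •
      (lam • v + ∑ j, inner ℝ (h.action j) v • h.action j) := by
  rw [gram_apply, sum_tokens h (fun a _ => inner ℝ a v • a) (by simp), Fin.val_last]

lemma covMatrix_mulVec (h : History d A n) (v : EuclideanSpace ℝ (Fin d)) :
    covMatrix lam h *ᵥ v.ofLp
      = (lam • v + ∑ j, inner ℝ (h.action j) v • h.action j).ofLp := by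
  rw [covMatrix, Matrix.add_mulVec, Matrix.smul_mulVec, Matrix.one_mulVec, Matrix.sum_mulVec]
  simp only [Matrix.vecMulVec_mulVec, WithLp.ofLp_add, WithLp.ofLp_smul, WithLp.ofLp_sum]
  congr 1
  refine Finset.sum_congr rfl fun j _ => ?_
  ext c
  simp [PiLp.inner_apply, dotProduct, mul_comm]

/-- The solution of the linear system of the last token is the inverse covariance matrix applied to
the action, times the position of the token. -/
lemma gram_last_eq (hlam : 0 < lam) (h : History d A n) (c : EuclideanSpace ℝ (Fin d)) :
    gram lam (tokenAct h) (Fin.last (2 * n))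
      ((((2 * n : ℕ) : ℝ) + 1) • WithLp.toLp 2 ((covMatrix lam h)⁻¹ *ᵥ c.ofLp)) = c := by
  have hn : ((2 * n : ℕ) : ℝ) + 1 ≠ 0 := by positivity
  have hsurj : Function.Surjective (covMatrix lam h).mulVec := by
    intro b
    obtain ⟨x, hx⟩ := exists_gram_eq (a := tokenAct h) hlam (Fin.last (2 * n))
      ((1 / (((2 * n : ℕ) : ℝ) + 1)) • WithLp.toLp 2 b)
    refine ⟨x.ofLp, ?_⟩
    rw [gram_last] at hx
    have := smul_right_injective _ (one_div_ne_zero hn) hx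
    rw [covMatrix_mulVec, this]
  have hunit : IsUnit (covMatrix lam h).det :=
    (Matrix.isUnit_iff_isUnit_det _).1 (Matrix.mulVec_surjective_iff_isUnit.1 hsurj)
  rw [map_smul, gram_last, smul_smul, mul_one_div_cancel hn, one_smul]
  refine WithLp.ofLp_injective 2 ?_
  rw [← covMatrix_mulVec, Matrix.mulVec_mulVec, Matrix.mul_nonsing_inv _ hunit, Matrix.one_mulVec]

lemma ridgeLoss_eq (h : History d A n) {w₀ : EuclideanSpace ℝ (Fin d)}
    (hw : lam • w₀ + ∑ j, inner ℝ (h.action j) w₀ • h.action j = ∑ j, h.reward j • h.action j)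
    (w : EuclideanSpace ℝ (Fin d)) :
    ridgeLoss lam h w = ridgeLoss lam h w₀ + (∑ j, inner ℝ (h.action j) (w - w₀) ^ 2
      + lam * ‖w - w₀‖ ^ 2) := by
  obtain ⟨v, rfl⟩ : ∃ v, w = w₀ + v := ⟨w - w₀, by abel⟩
  have h1 := congrArg (fun x => inner ℝ x v) hw
  simp only [inner_add_left, sum_inner, real_inner_smul_left] at h1
  have h2 : ∑ j, (h.reward j - inner ℝ (h.action j) (w₀ + v)) ^ 2
      = ∑ j, (h.reward j - inner ℝ (h.action j) w₀) ^ 2 + ∑ j, inner ℝ (h.action j) v ^ 2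
        + 2 * ∑ j, inner ℝ (h.action j) w₀ * inner ℝ (h.action j) v
        - 2 * ∑ j, h.reward j * inner ℝ (h.action j) v := by
    simp only [Finset.mul_sum, ← Finset.sum_add_distrib, ← Finset.sum_sub_distrib, inner_add_right]
    exact Finset.sum_congr rfl fun j _ => by ring
  rw [ridgeLoss, ridgeLoss, h2, add_sub_cancel_left, norm_add_sq_real]
  linear_combination 2 * h1

/-- The ridge estimator solves the normal equations. -/
lemma ridge_normal (hlam : 0 < lam) (h : History d A n) :
    lam • ridge lam h + ∑ j, inner ℝ (h.action j) (ridge lam h) • h.action j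
      = ∑ j, h.reward j • h.action j := by
  have hn : ((2 * n : ℕ) : ℝ) + 1 ≠ 0 := by positivity
  obtain ⟨w₀, hw₀⟩ := exists_gram_eq (a := tokenAct h) hlam (Fin.last (2 * n))
    ((1 / (((2 * n : ℕ) : ℝ) + 1)) • ∑ j, h.reward j • h.action j)
  rw [gram_last] at hw₀
  replace hw₀ := smul_right_injective _ (one_div_ne_zero hn) hw₀
  have hmin : ∀ w', ridgeLoss lam h w₀ ≤ ridgeLoss lam h w' := fun w' => by
    rw [ridgeLoss_eq h hw₀ w', le_add_iff_nonneg_right]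
    positivity
  have hspec := Classical.epsilon_spec
    (p := fun w => ∀ w', ridgeLoss lam h w ≤ ridgeLoss lam h w') ⟨w₀, hmin⟩ w₀
  have heq : ridge lam h = w₀ := by
    change ridgeLoss lam h (ridge lam h) ≤ _ at hspec
    rw [ridgeLoss_eq h hw₀ (ridge lam h), add_le_iff_nonpos_right] at hspec
    have h1 : 0 ≤ ∑ j, inner ℝ (h.action j) (ridge lam h - w₀) ^ 2 :=
      Finset.sum_nonneg fun j _ => sq_nonneg _
    have h2 : lam * ‖ridge lam h - w₀‖ ^ 2 = 0 :=
      le_antisymm (by linarith) (by positivity)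
    have h3 := (mul_eq_zero.1 h2).resolve_left hlam.ne'
    rwa [sq_eq_zero_iff, norm_eq_zero, sub_eq_zero] at h3
  rw [heq, hw₀]

/-- The upper confidence bounds in terms of the solutions of the linear systems. -/
lemma exists_ucb_eq (hlam : 0 < lam) (h : History d A n) (k : Fin A) :
    ∃ x, gram lam (tokenAct h) (Fin.last (2 * n)) x = tokenSet h (Fin.last (2 * n)) k ∧
      ∀ α, ucb lam α h k =
        1 / (((Fin.last (2 * n) : Fin (2 * n + 1)) : ℝ) + 1)
            * ∑ j ∈ Finset.Iic (Fin.last (2 * n)), inner ℝ (tokenAct h j) x * tokenRew h j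
          + α * √(1 / (((Fin.last (2 * n) : Fin (2 * n + 1)) : ℝ) + 1)
            * inner ℝ (tokenSet h (Fin.last (2 * n)) k) x) := by
  have hn : ((2 * n : ℕ) : ℝ) + 1 ≠ 0 := by positivity
  have hx := gram_last_eq hlam h (h.current k)
  refine ⟨_, by rw [tokenSet_last]; exact hx, fun α => ?_⟩
  rw [tokenSet_last, sum_tokens h (fun a r => inner ℝ a _ * r) (by simp), Fin.val_last, ucb]
  congr 1
  · nth_rewrite 1 [← hx]
    rw [inner_gram_comm, gram_last, ridge_normal hlam, inner_smul_right, inner_sum]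
    congr 1
    refine Finset.sum_congr rfl fun j _ => ?_
    rw [inner_smul_right, real_inner_comm, mul_comm]
  · rw [inner_smul_right, ← mul_assoc, one_div_mul_cancel hn, one_mul]
    congr 2
    simp [PiLp.inner_apply, dotProduct, mul_comm]

end HistoryTokens

/-! ### The induced policy -/

lemma inducedAlg_reindex {d A L M D' n : ℕ} (R : ℝ) (θ : TFParams (Coord d A) L M D')
    (h : History d A n) (k : Fin A) :
    inducedAlg R (fun l => (θ l).reindex (Coord.ofTokenIdx d A)) h k
      = softmax (fun j => transformer R L θ
          (fun i => (Tok.input (tokenAct h i) (tokenRew h i) (tokenSet h i) (i + 1)).vec)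
          (Fin.last (2 * n)) (.pol j)) k := by
  rw [inducedAlg, funext (tokens_eq h), transformer_reindex]
  rfl

/-! ### The choice of the parameters -/

section Parameters

lemma exp_neg_le_inv_pow {x G : ℝ} (hG : 0 < G) (m : ℕ) (h : m * Real.log G ≤ x) :
    Real.exp (-x) ≤ (G ^ m)⁻¹ := by
  rw [Real.exp_neg]
  refine inv_anti₀ (by positivity) ?_
  rw [← Real.exp_log hG, ← Real.exp_nat_mul]
  exact Real.exp_le_exp.2 h

/-- All parameters of the problem that enter the soft-O polynomially or logarithmically are
bounded by `P` and by `Y`, respectively. -/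
structure ScaleBounds (P Y lam b B r T τ ε α : ℝ) : Prop where
  three_le : 3 ≤ P
  lam_pos : 0 < lam
  b_pos : 0 < b
  B_pos : 0 < B
  r_nonneg : 0 ≤ r
  one_le_T : 1 ≤ T
  τ_pos : 0 < τ
  ε_pos : 0 < ε
  α_nonneg : 0 ≤ α
  one_le_Y : 1 ≤ Y
  lam_inv_le : lam⁻¹ ≤ P
  b_inv_le : b⁻¹ ≤ P
  B_le : B ≤ P
  L_le : lam + B ^ 2 ≤ P ^ 2
  r_le : r ≤ P ^ 2
  T_le : T ≤ Y
  τ_inv_le : τ⁻¹ ≤ Y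
  ε_inv_le : ε⁻¹ ≤ Y
  α_le : α ≤ 4 * P ^ 3 * Y ^ 2

variable {P Y lam b B r T τ ε α : ℝ}

/-- The momentum parameter of accelerated gradient descent, the square root of the inverse of the
condition number. -/
def momentum (lam B T : ℝ) : ℝ := √(lam / (2 * T * (lam + B ^ 2)))

/-- A lower bound for the width `√(aᵀ A⁻¹ a)` of the confidence intervals. -/
def minWidth (lam b B T : ℝ) : ℝ := b / √(2 * T * (lam + B ^ 2))

/-- The network for given parameters of the problem. The numbers of steps are chosen for accuracy
`G ^ (-13)` of the solutions of the linear systems and of the square roots, where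
`G = P * Y`. -/
def network {A : ℕ} (k₀ : Fin A) (G lam b B T τ α : ℝ) : NetParams A where
  lam := lam
  L := lam + B ^ 2
  θ := momentum lam B T
  B := 3 * (2 * T * B / lam) * B + (B ^ 2 / lam + 1)
  η := 1 / (2 * (B ^ 2 / lam + 2))
  α := α
  τ := τ
  n₁ := ⌈33 * Real.log G / momentum lam B T⌉₊
  n₂ := ⌈13 * Real.log G * (4 * (B ^ 2 / lam + 2)) / minWidth lam b B T⌉₊
  k₀ := k₀

namespace ScaleBounds

lemma one_le_P (h : ScaleBounds P Y lam b B r T τ ε α) : 1 ≤ P := by linarith [h.three_le]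

lemma le_G (h : ScaleBounds P Y lam b B r T τ ε α) : P ≤ P * Y ∧ Y ≤ P * Y ∧ 3 ≤ P * Y := by
  have h1 := h.three_le
  have h2 := h.one_le_Y
  refine ⟨?_, ?_, ?_⟩ <;> nlinarith

lemma radius_le (h : ScaleBounds P Y lam b B r T τ ε α) :
    2 * T * B / lam ≤ 2 * T * P ^ 2 ∧ 2 * T * B / lam ≤ 2 * (P * Y) ^ 2 := by
  have h1 := h.one_le_P
  have h2 := h.one_le_Y
  have hT := h.one_le_T
  have hB := h.B_pos
  have hl := h.lam_pos
  have e : 2 * T * B / lam ≤ 2 * T * P ^ 2 := by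
    calc 2 * T * B / lam = 2 * T * (B * lam⁻¹) := by rw [div_eq_mul_inv]; ring
      _ ≤ 2 * T * (P * P) := by
          have := h.B_le
          have := h.lam_inv_le
          gcongr
      _ = 2 * T * P ^ 2 := by ring
  refine ⟨e, e.trans ?_⟩
  have : T ≤ Y ^ 2 := h.T_le.trans (le_self_pow₀ h2 two_ne_zero)
  calc 2 * T * P ^ 2 ≤ 2 * Y ^ 2 * P ^ 2 := by gcongr
    _ = 2 * (P * Y) ^ 2 := by ring

lemma sq_div_le (h : ScaleBounds P Y lam b B r T τ ε α) : B ^ 2 / lam + 2 ≤ P ^ 4 := by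
  have h1 := h.three_le
  have hB := h.B_pos
  have h2 : B ^ 2 / lam ≤ P ^ 3 := by
    calc B ^ 2 / lam = B ^ 2 * lam⁻¹ := div_eq_mul_inv _ _
      _ ≤ P ^ 2 * P := by
          have := h.B_le
          have := h.lam_inv_le
          have := inv_pos.2 h.lam_pos
          gcongr
      _ = P ^ 3 := by ring
  have h3 : (3 : ℝ) ^ 3 ≤ P ^ 3 := by gcongr
  have h4 : P ^ 3 * 3 ≤ P ^ 3 * P := by gcongr
  nlinarith

lemma momentum_pos (h : ScaleBounds P Y lam b B r T τ ε α) : 0 < momentum lam B T := by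
  have := h.lam_pos
  have := h.one_le_T
  unfold momentum
  positivity

lemma momentum_sq (h : ScaleBounds P Y lam b B r T τ ε α) :
    momentum lam B T ^ 2 = lam / (2 * T * (lam + B ^ 2)) := by
  have := h.lam_pos
  have := h.one_le_T
  exact Real.sq_sqrt (by positivity)

lemma momentum_le_one (h : ScaleBounds P Y lam b B r T τ ε α) : momentum lam B T ≤ 1 := by
  have h1 := h.lam_pos
  have h2 := h.one_le_T
  refine Real.sqrt_le_one.2 ?_
  rw [div_le_one (by positivity)]
  nlinarith [sq_nonneg B]

lemma inv_momentum_le (h : ScaleBounds P Y lam b B r T τ ε α) :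
    (momentum lam B T)⁻¹ ≤ P ^ 2 * √T := by
  have h1 := h.lam_pos
  have hT := h.one_le_T
  have h3 := h.three_le
  rw [momentum, ← Real.sqrt_inv, inv_div, Real.sqrt_le_left (by positivity), mul_pow,
    Real.sq_sqrt (by linarith), mul_div_assoc]
  have e : (lam + B ^ 2) / lam ≤ P ^ 2 * P := by
    rw [div_eq_mul_inv]
    exact mul_le_mul h.L_le h.lam_inv_le (inv_pos.2 h1).le (by positivity)
  calc 2 * T * ((lam + B ^ 2) / lam) ≤ P * T * (P ^ 2 * P) := by
        gcongr
        linarith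
    _ = (P ^ 2) ^ 2 * T := by ring

lemma minWidth_pos (h : ScaleBounds P Y lam b B r T τ ε α) : 0 < minWidth lam b B T := by
  have := h.lam_pos
  have := h.one_le_T
  have := h.b_pos
  unfold minWidth
  positivity

lemma minWidth_sq (h : ScaleBounds P Y lam b B r T τ ε α) :
    2 * T * (lam + B ^ 2) * minWidth lam b B T ^ 2 = b ^ 2 := by
  have := h.lam_pos
  have := h.one_le_T
  rw [minWidth, div_pow, Real.sq_sqrt (by positivity)]
  field_simp

lemma inv_minWidth_le (h : ScaleBounds P Y lam b B r T τ ε α) :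
    (minWidth lam b B T)⁻¹ ≤ P ^ 3 * √T := by
  have h1 := h.lam_pos
  have hT := h.one_le_T
  have h3 := h.three_le
  have e : √(2 * T * (lam + B ^ 2)) ≤ P ^ 2 * √T := by
    rw [Real.sqrt_le_left (by positivity), mul_pow, Real.sq_sqrt (by linarith)]
    calc 2 * T * (lam + B ^ 2) ≤ P * T * P ^ 2 := by
          have := h.L_le
          gcongr
          linarith
      _ = P ^ 3 * T := by ring
      _ ≤ (P ^ 2) ^ 2 * T := by
          rw [← pow_mul]
          gcongr
          · linarith
          · norm_num
  rw [minWidth, inv_div, div_eq_mul_inv]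
  calc √(2 * T * (lam + B ^ 2)) * b⁻¹ ≤ P ^ 2 * √T * P :=
        mul_le_mul e h.b_inv_le (inv_pos.2 h.b_pos).le (by positivity)
    _ = P ^ 3 * √T := by ring

lemma inv_minWidth_le_pow (h : ScaleBounds P Y lam b B r T τ ε α) :
    (minWidth lam b B T)⁻¹ ≤ (P * Y) ^ 3 := by
  have h1 := h.one_le_P
  have hT := h.one_le_T
  have hY := h.one_le_Y
  refine h.inv_minWidth_le.trans ?_
  have : √T ≤ Y ^ 3 := by
    refine le_trans ?_ (le_self_pow₀ hY (by norm_num : 3 ≠ 0))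
    rw [Real.sqrt_le_left (by linarith)]
    exact h.T_le.trans (le_self_pow₀ hY two_ne_zero)
  rw [mul_pow]
  gcongr

lemma α_le_pow (h : ScaleBounds P Y lam b B r T τ ε α) : α ≤ (P * Y) ^ 5 := by
  have h1 := h.three_le
  have hY := h.one_le_Y
  refine h.α_le.trans ?_
  have h2 : (4 : ℝ) ≤ P ^ 2 := by nlinarith
  have h3 : Y ^ 2 ≤ Y ^ 5 := pow_le_pow_right₀ hY (by norm_num)
  calc 4 * P ^ 3 * Y ^ 2 ≤ P ^ 2 * P ^ 3 * Y ^ 5 := by gcongr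
    _ = (P * Y) ^ 5 := by ring

lemma solve_le (h : ScaleBounds P Y lam b B r T τ ε α) {n : ℕ}
    (hn : 33 * Real.log (P * Y) / momentum lam B T ≤ n) :
    Real.exp (-(momentum lam B T * n)) * (2 * (2 * T * B / lam) ^ 2) ≤ (((P * Y) ^ 13)⁻¹) ^ 2 := by
  obtain ⟨-, -, hG⟩ := h.le_G
  have hX := h.radius_le.2
  have hB := h.B_pos
  have hl := h.lam_pos
  have hT := h.one_le_T
  have hX0 : 0 ≤ 2 * T * B / lam := by positivity
  rw [div_le_iff₀ h.momentum_pos] at hn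
  have h1 := exp_neg_le_inv_pow (by linarith : 0 < P * Y) 33
    (hn.trans (le_of_eq (mul_comm _ _)))
  generalize P * Y = G at *
  have hG0 : 0 < G := by linarith
  have h2 : 2 * (2 * T * B / lam) ^ 2 ≤ G ^ 7 := by
    calc 2 * (2 * T * B / lam) ^ 2 ≤ 2 * (2 * G ^ 2) ^ 2 := by gcongr
      _ = 8 * G ^ 4 := by ring
      _ ≤ 3 ^ 3 * G ^ 4 := by gcongr; norm_num
      _ ≤ G ^ 3 * G ^ 4 := by gcongr
      _ = G ^ 7 := by ring
  calc _ ≤ (G ^ 33)⁻¹ * G ^ 7 := by gcongr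
    _ = ((G ^ 13)⁻¹) ^ 2 := by field_simp

lemma tuned {A : ℕ} (h : ScaleBounds P Y lam b B r T τ ε α) (k₀ : Fin A) :
    (network k₀ (P * Y) lam b B T τ α).Tuned B T ((P * Y) ^ 13)⁻¹ where
  lam_pos := h.lam_pos
  L_eq := rfl
  θ_pos := h.momentum_pos
  θ_le := h.momentum_le_one
  θ_eq := by
    change (lam + B ^ 2) * momentum lam B T ^ 2 = lam / (2 * T)
    have := h.lam_pos
    have := h.one_le_T
    rw [h.momentum_sq]
    field_simp
  B_eq := rfl
  η_eq := rfl
  α_nonneg := h.α_nonneg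
  τ_pos := h.τ_pos
  Ba_nonneg := h.B_pos.le
  T_pos := by linarith [h.one_le_T]
  δ_nonneg := by
    have := h.le_G.2.2
    positivity
  δ_le := by
    have h1 := h.le_G.2.2
    rw [mul_inv_le_iff₀ (by positivity), one_mul]
    exact (h.B_le.trans h.le_G.1).trans (le_self_pow₀ (by linarith) (by norm_num))
  solve := h.solve_le (Nat.le_ceil _)

lemma δ_le_minWidth (h : ScaleBounds P Y lam b B r T τ ε α) :
    B * ((P * Y) ^ 13)⁻¹ ≤ 3 / 4 * minWidth lam b B T ^ 2 := by
  obtain ⟨hPG, -, hG⟩ := h.le_G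
  have hw := h.inv_minWidth_le_pow
  have hw0 := h.minWidth_pos
  have hB := h.B_le.trans hPG
  generalize P * Y = G at *
  have hG0 : 0 < G := by linarith
  have h1 : (G ^ 3)⁻¹ ≤ minWidth lam b B T := inv_le_of_inv_le₀ hw0 hw
  calc B * (G ^ 13)⁻¹ ≤ G * (G ^ 13)⁻¹ := by gcongr
    _ = (G ^ 6)⁻¹ * ((G ^ 6)⁻¹ ) := by field_simp
    _ ≤ 3 / 4 * (G ^ 6)⁻¹ := by
        gcongr
        rw [inv_le_comm₀ (by positivity) (by norm_num)]
        calc ((3 : ℝ) / 4)⁻¹ ≤ 3 ^ 6 := by norm_num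
          _ ≤ G ^ 6 := by gcongr
    _ = 3 / 4 * ((G ^ 3)⁻¹) ^ 2 := by field_simp
    _ ≤ 3 / 4 * minWidth lam b B T ^ 2 := by gcongr

lemma error_le (h : ScaleBounds P Y lam b B r T τ ε α) {n : ℕ}
    (hn : 13 * Real.log (P * Y) * (4 * (B ^ 2 / lam + 2)) / minWidth lam b B T ≤ n) :
    (B * ((P * Y) ^ 13)⁻¹ * r + α * ((B ^ 2 / lam + 2)
        * Real.exp (-(minWidth lam b B T / (4 * (B ^ 2 / lam + 2)) * n))
          + B * ((P * Y) ^ 13)⁻¹ / minWidth lam b B T)) / τ ≤ ε / 2 := by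
  obtain ⟨hPG, hYG, hG⟩ := h.le_G
  have hP := h.one_le_P
  have hl := h.lam_pos
  have hw := h.inv_minWidth_le_pow
  have hw0 := h.minWidth_pos
  have hκ0 : 0 < B ^ 2 / lam + 2 := by positivity
  have hκ : B ^ 2 / lam + 2 ≤ (P * Y) ^ 4 := h.sq_div_le.trans (by gcongr)
  have hB := h.B_le.trans hPG
  have hB0 := h.B_pos
  have hr : r ≤ (P * Y) ^ 2 := h.r_le.trans (by gcongr)
  have hr0 := h.r_nonneg
  have hα := h.α_le_pow
  have hα0 := h.α_nonneg
  have hτ := h.τ_inv_le.trans hYG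
  have hτ0 := inv_pos.2 h.τ_pos
  have hε := h.ε_inv_le.trans hYG
  have hexp : Real.exp (-(minWidth lam b B T / (4 * (B ^ 2 / lam + 2)) * n)) ≤ ((P * Y) ^ 13)⁻¹ := by
    refine exp_neg_le_inv_pow (by linarith) 13 ?_
    rw [div_le_iff₀ hw0] at hn
    rw [div_mul_eq_mul_div, le_div_iff₀ (by positivity)]
    push_cast
    linarith
  have hexp0 := (Real.exp_pos (-(minWidth lam b B T / (4 * (B ^ 2 / lam + 2)) * n))).le
  have hε' : (P * Y)⁻¹ ≤ ε := inv_le_of_inv_le₀ h.ε_pos hε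
  rw [div_eq_mul_inv _ τ, div_eq_mul_inv _ (minWidth lam b B T)]
  have hw0' := (inv_pos.2 hw0).le
  generalize (minWidth lam b B T)⁻¹ = w at *
  generalize Real.exp (-(minWidth lam b B T / (4 * (B ^ 2 / lam + 2)) * n)) = e at *
  generalize B ^ 2 / lam + 2 = κ at *
  generalize P * Y = G at *
  have hG0 : 0 < G := by linarith
  have hG1 : 1 ≤ G := by linarith
  calc _ ≤ (G * (G ^ 13)⁻¹ * G ^ 2 + G ^ 5 * (G ^ 4 * (G ^ 13)⁻¹ + G * (G ^ 13)⁻¹ * G ^ 3)) * G := by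
        gcongr
    _ = (G ^ 4 + 2 * G ^ 10) * (G ^ 13)⁻¹ := by ring
    _ ≤ (G ^ 10 + 2 * G ^ 10) * (G ^ 13)⁻¹ := by
        gcongr
        norm_num
    _ = 3 * (G * G)⁻¹ * G⁻¹ := by field_simp; ring
    _ ≤ 3 * (3 * 3)⁻¹ * ε := by gcongr
    _ ≤ ε / 2 := by linarith [h.ε_pos]

lemma size_le {A : ℕ} (h : ScaleBounds P Y lam b B r T τ ε α) (k₀ : Fin A) :
    (network k₀ (P * Y) lam b B T τ α).size B T r ≤ (P * Y) ^ 13 := by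
  obtain ⟨hPG, hYG, hG⟩ := h.le_G
  have hP := h.one_le_P
  have hl := h.lam_pos
  have hκ0 : 0 < B ^ 2 / lam + 2 := by positivity
  have hκ : B ^ 2 / lam + 2 ≤ (P * Y) ^ 4 := h.sq_div_le.trans (by gcongr)
  have hB := h.B_le.trans hPG
  have hB0 := h.B_pos
  have hr : r ≤ (P * Y) ^ 2 := h.r_le.trans (by gcongr)
  have hr0 := h.r_nonneg
  have hα := h.α_le_pow
  have hα0 := h.α_nonneg
  have hτ := h.τ_inv_le.trans hYG
  have hτ0 := inv_pos.2 h.τ_pos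
  have hT := h.T_le.trans hYG
  have hT0 : 0 < T := by linarith [h.one_le_T]
  have hX := h.radius_le.2
  have hX0 : 0 ≤ 2 * T * B / lam := by positivity
  change B + r + 3 * (2 * T * B / lam) + (2 * T) ^ 2 + (B ^ 2 / lam + 2)
    + B * (3 * (2 * T * B / lam)) * r
    + (B * (3 * (2 * T * B / lam)) * r + α * (B ^ 2 / lam + 2)) / τ ≤ _
  rw [div_eq_mul_inv _ τ]
  generalize 2 * T * B / lam = X at *
  generalize B ^ 2 / lam + 2 = κ at *
  generalize P * Y = G at *
  have hG0 : 0 < G := by linarith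
  have hG1 : 1 ≤ G := by linarith
  have hpow : ∀ m ≤ 10, G ^ m ≤ G ^ 10 := fun m hm => pow_le_pow_right₀ hG1 hm
  calc _ ≤ G + G ^ 2 + 3 * (2 * G ^ 2) + (2 * G) ^ 2 + G ^ 4 + G * (3 * (2 * G ^ 2)) * G ^ 2
        + (G * (3 * (2 * G ^ 2)) * G ^ 2 + G ^ 5 * G ^ 4) * G := by gcongr
    _ = G ^ 1 + 11 * G ^ 2 + G ^ 4 + 6 * G ^ 5 + 6 * G ^ 6 + G ^ 10 := by ring
    _ ≤ 3 ^ 3 * G ^ 10 := by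
        linarith [hpow 1 (by norm_num), hpow 2 (by norm_num), hpow 4 (by norm_num),
          hpow 5 (by norm_num), hpow 6 (by norm_num)]
    _ ≤ G ^ 3 * G ^ 10 := by gcongr
    _ = G ^ 13 := by ring

/-- The number of layers. -/
lemma depth_le {A : ℕ} (h : ScaleBounds P Y lam b B r T τ ε α) (k₀ : Fin A) {Λ : ℝ} (hΛ : 1 ≤ Λ)
    (hlog : Real.log (P * Y) ≤ P * Λ) :
    (((network k₀ (P * Y) lam b B T τ α).n₁ + 1 + (network k₀ (P * Y) lam b B T τ α).n₂ + 1 : ℕ) : ℝ)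
      ≤ 100 * P ^ 8 * Λ * √T := by
  have hP := h.one_le_P
  have hT1 : 1 ≤ √T := Real.one_le_sqrt.2 h.one_le_T
  have hlog0 : 0 ≤ Real.log (P * Y) := Real.log_nonneg (by linarith [h.le_G.2.2])
  have hm := h.inv_momentum_le
  have hm0 := inv_pos.2 h.momentum_pos
  have hw := h.inv_minWidth_le
  have hw0 := inv_pos.2 h.minWidth_pos
  have hκ := h.sq_div_le
  have hl := h.lam_pos
  have hκ0 : 0 < B ^ 2 / lam + 2 := by positivity
  have e1 : 33 * Real.log (P * Y) / momentum lam B T ≤ 33 * (P ^ 8 * Λ * √T) := by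
    rw [div_eq_mul_inv]
    calc _ ≤ 33 * (P * Λ) * (P ^ 2 * √T) := by gcongr
      _ = 33 * (P ^ 3 * Λ * √T) := by ring
      _ ≤ 33 * (P ^ 8 * Λ * √T) := by gcongr; norm_num
  have e2 : 13 * Real.log (P * Y) * (4 * (B ^ 2 / lam + 2)) / minWidth lam b B T
      ≤ 52 * (P ^ 8 * Λ * √T) := by
    rw [div_eq_mul_inv]
    calc _ ≤ 13 * (P * Λ) * (4 * P ^ 4) * (P ^ 3 * √T) := by gcongr
      _ = 52 * (P ^ 8 * Λ * √T) := by ring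
  have c1 := Nat.ceil_lt_add_one (le_trans (by have := h.momentum_pos; positivity) le_rfl :
    0 ≤ 33 * Real.log (P * Y) / momentum lam B T)
  have c2 := Nat.ceil_lt_add_one (le_trans (by have := h.minWidth_pos; positivity) le_rfl :
    0 ≤ 13 * Real.log (P * Y) * (4 * (B ^ 2 / lam + 2)) / minWidth lam b B T)
  have c3 : 1 ≤ P ^ 8 * Λ * √T :=
    one_le_mul_of_one_le_of_one_le (one_le_mul_of_one_le_of_one_le (one_le_pow₀ hP) hΛ) hT1
  simp only [network]
  push_cast
  linarith

/-- The size of the weights. -/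
lemma weights_le {A d : ℕ} (h : ScaleBounds P Y lam b B r T τ ε α) (k₀ : Fin A) (hτ1 : τ ≤ 1)
    (l : ℕ) :
    ((network k₀ (P * Y) lam b B T τ α).layer d l).BoundedBy (9 * P ^ 4 * T)
      (16 * P * A + (1 + α) / τ) := by
  have h3 := h.three_le
  have hP := h.one_le_P
  have hT := h.one_le_T
  have hl := h.lam_pos
  have hα := h.α_nonneg
  have hτ := h.τ_pos
  have hκ0 : 0 < B ^ 2 / lam + 2 := by positivity
  have hB0 := h.B_pos
  have hX0 : 0 ≤ 2 * T * B / lam := by positivity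
  have hA : (0 : ℝ) ≤ A := Nat.cast_nonneg A
  have hα' : 0 ≤ (1 + α) / τ := by positivity
  have hPT : 1 ≤ P ^ 4 * T := one_le_mul_of_one_le_of_one_le (one_le_pow₀ hP) hT
  have hmask0 : 0 ≤ 3 * (2 * T * B / lam) * B + (B ^ 2 / lam + 1) := by positivity
  have hmask : 3 * (2 * T * B / lam) * B + (B ^ 2 / lam + 1) + 2 ≤ 9 * P ^ 4 * T := by
    have e1 : 3 * (2 * T * B / lam) * B ≤ 6 * (P ^ 4 * T) := by
      calc 3 * (2 * T * B / lam) * B ≤ 3 * (2 * T * P ^ 2) * P := by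
            have := h.radius_le.1
            have := h.B_le
            gcongr
        _ = 6 * (P ^ 3 * T) := by ring
        _ ≤ 6 * (P ^ 4 * T) := by gcongr; norm_num
    have e2 : P ^ 4 ≤ P ^ 4 * T := le_mul_of_one_le_right (by positivity) hT
    linarith [h.sq_div_le]
  have hAP : (A : ℝ) ≤ P * A := le_mul_of_one_le_left hA hP
  unfold NetParams.layer
  split_ifs
  · refine (boundedBy_agdLayer h.lam_pos (le_add_of_nonneg_right (sq_nonneg B)) h.momentum_pos
      h.momentum_le_one).mono (by linarith) ?_
    have : (A : ℝ) * (9 / lam) ≤ 9 * (P * A) := by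
      rw [div_eq_mul_inv]
      have := mul_le_mul_of_nonneg_left h.lam_inv_le (by positivity : 0 ≤ 9 * (A : ℝ))
      linarith
    change (A : ℝ) * (7 + 9 / lam) ≤ _
    linarith
  · exact (boundedBy_readLayer hmask0).mono hmask (by linarith)
  · refine (boundedBy_sqrtLayer hmask0 ?_).mono hmask (by linarith)
    simp only [network]
    rw [abs_of_nonneg (by positivity), div_le_one (by positivity)]
    have : 0 ≤ B ^ 2 / lam := by positivity
    linarith
  · refine (boundedBy_outLayer h.α_nonneg h.τ_pos hτ1 _).mono (by linarith) ?_
    have : 0 ≤ P * A := by positivity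
    linarith

end ScaleBounds

/-- The confidence width is at most of the order `√d`. -/
lemma confWidth_le {d T : ℕ} (hd : 1 ≤ d) (hT : 1 ≤ T) {σ B W lam P Λ : ℝ} (hσ : 0 < σ) (hB : 0 < B)
    (hW : 0 < W) (hlam : 0 < lam) (hP : 1 + σ + B + W + lam + lam⁻¹ ≤ P) (hΛ : 1 + Real.log T ≤ Λ) :
    confWidth d T σ B W lam ≤ 4 * √d * P ^ 3 * Λ := by
  have hinv := inv_pos.2 hlam
  have hd' : (1 : ℝ) ≤ d := by exact_mod_cast hd
  have hT' : (1 : ℝ) ≤ T := by exact_mod_cast hT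
  have hlogT : 0 ≤ Real.log T := Real.log_nonneg hT'
  have hP1 : 1 ≤ P := by linarith
  have hΛ1 : 1 ≤ Λ := by linarith
  have hP3 : 1 ≤ P ^ 3 := one_le_pow₀ hP1
  have hP23 : P ^ 2 ≤ P ^ 3 := pow_le_pow_right₀ hP1 (by norm_num)
  have hBW : 2 * B * W ≤ P ^ 2 := by nlinarith
  have hΛ3 : Λ ≤ P ^ 3 * Λ := le_mul_of_one_le_left (by linarith) hP3
  have hPΛ : P ^ 3 ≤ P ^ 3 * Λ := le_mul_of_one_le_right (by positivity) hΛ1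
  have l1 : Real.log (2 * B * W * T) ≤ 2 * (P ^ 3 * Λ) := by
    rw [Real.log_mul (by positivity) (by positivity)]
    have := Real.log_le_self (by positivity : 0 ≤ 2 * B * W)
    linarith
  have l2 : Real.log ((d * lam + T * B ^ 2) / (d * lam)) ≤ 2 * (P ^ 3 * Λ) := by
    have hq : (d * lam + T * B ^ 2) / (d * lam) ≤ T * (1 + B ^ 2 * lam⁻¹) := by
      rw [div_le_iff₀ (by positivity)]
      have : T * (1 + B ^ 2 * lam⁻¹) * (d * lam) = T * (d * lam) + d * (T * B ^ 2) := by
        field_simp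
      rw [this]
      have h1 : (d : ℝ) * lam ≤ T * (d * lam) := le_mul_of_one_le_left (by positivity) hT'
      have h2 : (T : ℝ) * B ^ 2 ≤ d * (T * B ^ 2) := le_mul_of_one_le_left (by positivity) hd'
      linarith
    refine (Real.log_le_log (by positivity) hq).trans ?_
    rw [Real.log_mul (by positivity) (by positivity)]
    have h1 := Real.log_le_sub_one_of_pos (by positivity : 0 < 1 + B ^ 2 * lam⁻¹)
    have h2 : B ^ 2 * lam⁻¹ ≤ P ^ 2 * P := by
      have : B ≤ P := by linarith
      have : lam⁻¹ ≤ P := by linarith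
      gcongr
    have h3 : P ^ 2 * P = P ^ 3 := by ring
    linarith
  have hrad : 2 * Real.log (2 * B * W * T) + d * Real.log ((d * lam + T * B ^ 2) / (d * lam))
      ≤ (3 * √d * P ^ 2 * Λ) ^ 2 := by
    have h1 : (d : ℝ) * Real.log ((d * lam + T * B ^ 2) / (d * lam)) ≤ d * (2 * (P ^ 3 * Λ)) := by
      gcongr
    have h2 : (3 * √d * P ^ 2 * Λ) ^ 2 = 9 * (d * (P ^ 4 * Λ ^ 2)) := by
      rw [mul_pow, mul_pow, mul_pow, Real.sq_sqrt (by positivity)]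
      ring
    have h3 : P ^ 3 * Λ ≤ P ^ 4 * Λ ^ 2 :=
      mul_le_mul (pow_le_pow_right₀ hP1 (by norm_num)) (le_self_pow₀ hΛ1 two_ne_zero)
        (by linarith) (by positivity)
    have h4 : P ^ 3 * Λ ≤ d * (P ^ 3 * Λ) := le_mul_of_one_le_left (by positivity) hd'
    have h5 : (d : ℝ) * (P ^ 3 * Λ) ≤ d * (P ^ 4 * Λ ^ 2) := by gcongr
    rw [h2]
    linarith
  have hsd : 1 ≤ √d := Real.one_le_sqrt.2 hd'
  have hs : √lam ≤ P := by
    rw [Real.sqrt_le_left (by linarith)]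
    nlinarith
  have t1 : √lam * W ≤ √d * P ^ 3 * Λ := by
    calc √lam * W ≤ P * P := by
          gcongr
          linarith
      _ = 1 * P ^ 2 * 1 := by ring
      _ ≤ √d * P ^ 3 * Λ := by gcongr
  have t2 : σ * √(2 * Real.log (2 * B * W * T)
      + d * Real.log ((d * lam + T * B ^ 2) / (d * lam))) ≤ 3 * (√d * P ^ 3 * Λ) := by
    calc _ ≤ P * (3 * √d * P ^ 2 * Λ) := by
          gcongr
          · linarith
          · rw [Real.sqrt_le_left (by positivity)]
            exact hrad
      _ = 3 * (√d * P ^ 3 * Λ) := by ring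
  rw [confWidth]
  linarith

end Parameters

/-! ### Assembly -/

lemma LinearBandit.IsBounded.abs_reward_le {d A T : ℕ} {E : LinearBandit d A T} {b B W σ : ℝ}
    (hE : E.IsBounded b B W) (choice : Fin T → Fin A) {noise : Fin T → ℝ}
    (hnoise : ∀ t, |noise t| ≤ σ) (t : Fin T) (j : Fin t) :
    |(E.history choice noise t).reward j| ≤ B * W + σ := by
  refine (abs_add_le _ _).trans (add_le_add ?_ (hnoise _))
  have h := (hE.2 ⟨j, by omega⟩ (choice ⟨j, by omega⟩)).2
  exact (abs_real_inner_le_norm _ _).trans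
    (mul_le_mul h hE.1 (norm_nonneg _) ((norm_nonneg _).trans h))

/-- The policy induced by the network approximates soft LinUCB. -/
lemma abs_log_softLinUCB_sub_le {d A T : ℕ} {P Y lam b B W σ τ ε α : ℝ}
    (h : ScaleBounds P Y lam b B (B * W + σ) T τ ε α) (k₀ : Fin A)
    (hcard : (Fintype.card (Coord d A) : ℝ) ≤ (P * Y) ^ 4) {E : LinearBandit d A T}
    (hE : E.IsBounded b B W) (choice : Fin T → Fin A) {noise : Fin T → ℝ}
    (hnoise : ∀ t, |noise t| ≤ σ) (t : Fin T) (k : Fin A) :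
    |Real.log (softLinUCB lam α τ (E.history choice noise t) k)
      - Real.log (inducedAlg ((P * Y) ^ 17)
        (fun l : Fin ((network k₀ (P * Y) lam b B T τ α).n₁ + 1
          + (network k₀ (P * Y) lam b B T τ α).n₂ + 1) =>
          ((network k₀ (P * Y) lam b B T τ α).layer d l).reindex (Coord.ofTokenIdx d A))
        (E.history choice noise t) k)| ≤ ε := by
  set p := network k₀ (P * Y) lam b B T τ α with hp
  set H := E.history choice noise t with hH
  have htuned : p.Tuned B T ((P * Y) ^ 13)⁻¹ := h.tuned k₀
  have hB := h.B_pos.le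
  have hr0 := h.r_nonneg
  have hG0 : 0 < P * Y := by linarith [h.le_G.2.2]
  have ha : ∀ i, ‖tokenAct H i‖ ≤ B := fun i => by
    unfold tokenAct
    split_ifs
    · simpa using hB
    · exact (hE.2 _ _).2
  have hset : ∀ i k, ‖tokenSet H i k‖ ≤ B := fun i k => by
    unfold tokenSet
    split_ifs
    · exact (hE.2 _ _).2
    · simpa using hB
  have hr : ∀ i, |tokenRew H i| ≤ B * W + σ := fun i => by
    unfold tokenRew
    split_ifs
    · simpa using hr0
    · exact hE.abs_reward_le choice hnoise t _
  have hN : ∀ i : Fin (2 * (t : ℕ) + 1), (i : ℝ) + 1 ≤ 2 * T := fun i => by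
    have : (i : ℕ) + 1 ≤ 2 * T := by omega
    exact_mod_cast this
  have hR : ∀ l i, l2norm (tokAfter p (tokenAct H) (tokenRew H) (tokenSet H) l i).vec
      ≤ (P * Y) ^ 17 := fun l i => by
    refine (l2norm_tokAfter_le htuned ha hset hr hN l i).trans ?_
    have h1 := h.size_le k₀
    have h2 := htuned.size_nonneg hr0
    calc _ ≤ (P * Y) ^ 4 * (P * Y) ^ 13 := mul_le_mul hcard h1 h2 (by positivity)
      _ = (P * Y) ^ 17 := by ring
  have hout : ∀ j, transformer ((P * Y) ^ 17) (p.n₁ + 1 + p.n₂ + 1) (fun l => p.layer d l)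
      (fun i => (Tok.input (tokenAct H i) (tokenRew H i) (tokenSet H i) (i + 1)).vec)
      (Fin.last (2 * t)) (.pol j)
        = score p (tokenAct H) (tokenRew H) (tokenSet H) (Fin.last (2 * t)) j := fun j => by
    refine transformer_network ?_ htuned.θ_pos ?_
      (fun i j k => inner_solver_le htuned ha hset (hN i) j k)
      (fun i j k n => sqrtIter_mul_le htuned ha hset hN i j k n) hR _ j
    · rw [htuned.L_eq]
      have := htuned.lam_pos
      positivity
    · rw [htuned.B_eq]
      have := htuned.lam_pos
      positivity
  rw [inducedAlg_reindex ((P * Y) ^ 17) (fun l : Fin (p.n₁ + 1 + p.n₂ + 1) => p.layer d l) H k,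
    softLinUCB, abs_sub_comm]
  simp only [hout]
  refine (abs_log_softmax_sub_le (δ := ε / 2) (fun j => ?_) k).trans (by linarith)
  obtain ⟨x, hx, hucb⟩ := exists_ucb_eq h.lam_pos H j
  rw [hucb]
  have hlow : 2 * T * (p.lam + B ^ 2) * minWidth lam b B T ^ 2
      ≤ ‖tokenSet H (Fin.last (2 * t)) j‖ ^ 2 := by
    change 2 * T * (lam + B ^ 2) * minWidth lam b B T ^ 2 ≤ _
    rw [h.minWidth_sq, tokenSet_last]
    exact pow_le_pow_left₀ h.b_pos.le (hE.2 _ _).1 2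
  exact (abs_score_sub_le htuned ha hset hr (hN _) hx h.minWidth_pos hlow h.δ_le_minWidth).trans
    (h.error_le (Nat.le_ceil _))

lemma tfNorm_network_le {d A L : ℕ} {P Y lam b B r T τ ε α : ℝ}
    (h : ScaleBounds P Y lam b B r T τ ε α) (k₀ : Fin A) (hτ1 : τ ≤ 1) :
    tfNorm (fun l : Fin L => ((network k₀ (P * Y) lam b B T τ α).layer d l).reindex
      (Coord.ofTokenIdx d A)) ≤ 9 * P ^ 4 * T + (16 * P * A + (1 + α) / τ) := by
  have hw := fun l : Fin L => h.weights_le (d := d) k₀ hτ1 l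
  have hP := h.one_le_P
  have hT := h.one_le_T
  have hα := h.α_nonneg
  have hτ := h.τ_pos
  exact tfNorm_reindex_le (Coord.ofTokenIdx d A)
    (fun l : Fin L => (network k₀ (P * Y) lam b B T τ α).layer d l) (by positivity) (by positivity)
    (fun l => (hw l).1) (fun l => (hw l).2.1) fun l => (hw l).2.2

lemma two_le_add_inv {x : ℝ} (hx : 0 < x) : 2 ≤ x + x⁻¹ := by
  have h1 : x * x⁻¹ = 1 := mul_inv_cancel₀ hx.ne'
  have h2 := inv_pos.2 hx
  nlinarith [sq_nonneg (x - x⁻¹)]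

/-- The factor polynomial in the bounds of the environment and the factor which enters
logarithmically satisfy the scale bounds. -/
lemma scaleBounds_of_eq {d A T : ℕ} (hd : 1 ≤ d) (hA : 1 ≤ A) (hT : 1 ≤ T)
    {σ b B W lam ε τ P Y Λ : ℝ} (hσ : 0 < σ) (hb : 0 < b) (hB : 0 < B) (hW : 0 < W) (hlam : 0 < lam)
    (hε : 0 < ε) (hε1 : ε ≤ 1) (hτ : 0 < τ) (hτ1 : τ ≤ 1)
    (hP : P = 1 + σ + b⁻¹ + B + W + lam + lam⁻¹)
    (hΛ : Λ = 1 + Real.log T + Real.log A + Real.log d + Real.log (1 / ε) + Real.log (1 / τ))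
    (hY : Y = T * A * d * ε⁻¹ * τ⁻¹) :
    ScaleBounds P Y lam b B (B * W + σ) T τ ε (confWidth d T σ B W lam) ∧ 1 ≤ Λ ∧
      Real.log (P * Y) ≤ P * Λ ∧ (A : ℝ) * d ≤ Y ∧
      confWidth d T σ B W lam ≤ 4 * √d * P ^ 3 * Λ := by
  have hd' : (1 : ℝ) ≤ d := by exact_mod_cast hd
  have hA' : (1 : ℝ) ≤ A := by exact_mod_cast hA
  have hT' : (1 : ℝ) ≤ T := by exact_mod_cast hT
  have hε' : 1 ≤ ε⁻¹ := (one_le_inv₀ hε).2 hε1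
  have hτ' : 1 ≤ τ⁻¹ := (one_le_inv₀ hτ).2 hτ1
  have hinv := inv_pos.2 hlam
  have hbinv := inv_pos.2 hb
  have hlogY : Λ = 1 + Real.log Y := by
    rw [hY, Real.log_mul (by positivity) (by positivity), Real.log_mul (by positivity)
      (by positivity), Real.log_mul (by positivity) (by positivity), Real.log_mul (by positivity)
      (by positivity), hΛ, one_div, one_div]
    ring
  have hlogT := Real.log_nonneg hT'
  have hΛT : 1 + Real.log T ≤ Λ := by
    have h1 := Real.log_nonneg hA'
    have h2 := Real.log_nonneg hd'
    have h3 := Real.log_nonneg hε'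
    have h4 := Real.log_nonneg hτ'
    rw [hΛ, one_div, one_div]
    linarith
  have hΛ1 : 1 ≤ Λ := by linarith
  have hP3 : 3 ≤ P := by
    have := two_le_add_inv hlam
    linarith
  have hP1 : 1 ≤ P := by linarith
  have hTA : (1 : ℝ) ≤ T * A := one_le_mul_of_one_le_of_one_le hT' hA'
  have hTAd : (1 : ℝ) ≤ T * A * d := one_le_mul_of_one_le_of_one_le hTA hd'
  have hTAde : 1 ≤ T * A * d * ε⁻¹ := one_le_mul_of_one_le_of_one_le hTAd hε'
  have hY1 : 1 ≤ Y := hY ▸ one_le_mul_of_one_le_of_one_le hTAde hτ'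
  have hAdY : (A : ℝ) * d ≤ Y := by
    calc (A : ℝ) * d = 1 * A * d * 1 * 1 := by ring
      _ ≤ T * A * d * ε⁻¹ * τ⁻¹ := by gcongr
      _ = Y := hY.symm
  have hTY : (T : ℝ) ≤ Y := by
    calc (T : ℝ) = T * 1 * 1 * 1 * 1 := by ring
      _ ≤ T * A * d * ε⁻¹ * τ⁻¹ := by gcongr
      _ = Y := hY.symm
  have hα := confWidth_le hd hT hσ hB hW hlam (P := P) (by linarith) hΛT
  have hα0 : 0 ≤ confWidth d T σ B W lam := by unfold confWidth; positivity
  have hscale : ScaleBounds P Y lam b B (B * W + σ) T τ ε (confWidth d T σ B W lam) :=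
    { three_le := hP3
      lam_pos := hlam
      b_pos := hb
      B_pos := hB
      r_nonneg := by positivity
      one_le_T := hT'
      τ_pos := hτ
      ε_pos := hε
      α_nonneg := hα0
      one_le_Y := hY1
      lam_inv_le := by linarith
      b_inv_le := by linarith
      B_le := by linarith
      L_le := by
        calc lam + B ^ 2 ≤ lam * (lam + 2 * B + 1) + B ^ 2 := by
              linarith [le_mul_of_one_le_right hlam.le (by linarith : 1 ≤ lam + 2 * B + 1)]
          _ ≤ (lam + B + 1) ^ 2 := by linarith
          _ ≤ P ^ 2 := pow_le_pow_left₀ (by positivity) (by linarith) 2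
      r_le := by
        calc B * W + σ ≤ B * W + σ + (B ^ 2 + W ^ 2 + σ ^ 2 + 1 + B * W + 2 * B * σ + 2 * W * σ
              + 2 * B + 2 * W + σ) := le_add_of_nonneg_right (by positivity)
          _ = (B + W + σ + 1) ^ 2 := by ring
          _ ≤ P ^ 2 := pow_le_pow_left₀ (by positivity) (by linarith) 2
      T_le := hTY
      τ_inv_le := hY ▸ le_mul_of_one_le_left (by positivity) hTAde
      ε_inv_le := by
        rw [hY]
        exact (le_mul_of_one_le_left (by positivity) hTAd).trans
          (le_mul_of_one_le_right (by positivity) hτ')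
      α_le := by
        refine hα.trans ?_
        have h1 : √(d : ℝ) ≤ Y := by
          refine le_trans ?_ ((le_mul_of_one_le_left (by positivity) hA').trans hAdY)
          rw [Real.sqrt_le_left (by positivity)]
          exact le_self_pow₀ hd' two_ne_zero
        have h2 : Λ ≤ Y := by
          have := Real.log_le_sub_one_of_pos (by linarith : 0 < Y)
          linarith
        calc 4 * √(d : ℝ) * P ^ 3 * Λ ≤ 4 * Y * P ^ 3 * Y := by gcongr
          _ = 4 * P ^ 3 * Y ^ 2 := by ring }
  have hlogG : Real.log (P * Y) ≤ P * Λ := by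
    rw [Real.log_mul (by positivity) (by positivity)]
    have h1 := Real.log_le_sub_one_of_pos (by linarith : 0 < P)
    have h2 : 0 ≤ (P - 1) * (Λ - 1) := mul_nonneg (by linarith) (by linarith)
    linarith
  exact ⟨hscale, hΛ1, hlogG, hAdY, hα⟩

/-- The bound for the norm of the network in the form of the theorem. -/
lemma norm_bound_le {d T A : ℕ} (hd : 1 ≤ d) (hT : 1 ≤ T) {P Λ ε τ α : ℝ} (hP1 : 1 ≤ P)
    (hΛ1 : 1 ≤ Λ) (hε : 0 < ε) (hε1 : ε ≤ 1) (hτ : 0 < τ) (hτ1 : τ ≤ 1)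
    (hα : α ≤ 4 * √d * P ^ 3 * Λ) :
    9 * P ^ 4 * T + (16 * P * A + (1 + α) / τ)
      ≤ 100 * P ^ 8 * Λ * (A + T * √d / (τ * ε ^ (1 / 4 : ℝ))) := by
  have hd' : (1 : ℝ) ≤ d := by exact_mod_cast hd
  have hT' : (1 : ℝ) ≤ T := by exact_mod_cast hT
  have hsd : 1 ≤ √(d : ℝ) := Real.one_le_sqrt.2 hd'
  have hP8 : P ≤ P ^ 8 := le_self_pow₀ hP1 (by norm_num)
  have hε4 : ε ^ (1 / 4 : ℝ) ≤ 1 := Real.rpow_le_one hε.le hε1 (by norm_num)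
  have hε40 : 0 < ε ^ (1 / 4 : ℝ) := Real.rpow_pos_of_pos hε _
  have hS : T * √(d : ℝ) / τ ≤ T * √(d : ℝ) / (τ * ε ^ (1 / 4 : ℝ)) :=
    div_le_div_of_nonneg_left (by positivity) (by positivity)
      (mul_le_of_le_one_right hτ.le hε4)
  have hS0 : 0 ≤ T * √(d : ℝ) / τ := by positivity
  have hTS : (T : ℝ) ≤ T * √(d : ℝ) / τ := by
    rw [mul_div_assoc]
    refine le_mul_of_one_le_right (by positivity) ?_
    rw [one_le_div hτ]
    linarith
  have hdS : √(d : ℝ) / τ ≤ T * √(d : ℝ) / τ := by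
    gcongr
    exact le_mul_of_one_le_left (by positivity) hT'
  have hP38 : P ^ 3 ≤ P ^ 8 := pow_le_pow_right₀ hP1 (by norm_num)
  have hP48 : P ^ 4 ≤ P ^ 8 := pow_le_pow_right₀ hP1 (by norm_num)
  have hPΛ : P ^ 8 ≤ P ^ 8 * Λ := le_mul_of_one_le_right (by positivity) hΛ1
  have b1 : 9 * P ^ 4 * T ≤ 9 * (P ^ 8 * Λ * (T * √(d : ℝ) / τ)) := by
    calc 9 * P ^ 4 * T = 9 * (P ^ 4 * T) := by ring
      _ ≤ 9 * (P ^ 8 * Λ * (T * √(d : ℝ) / τ)) := by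
        gcongr
        exact hP48.trans hPΛ
  have b2 : 16 * P * A ≤ 16 * (P ^ 8 * Λ * A) := by
    calc 16 * P * A = 16 * (P * A) := by ring
      _ ≤ 16 * (P ^ 8 * Λ * A) := by
        gcongr
        exact hP8.trans hPΛ
  have b3 : (1 + α) / τ ≤ 5 * (P ^ 8 * Λ * (T * √(d : ℝ) / τ)) := by
    have h1 : 1 ≤ √(d : ℝ) * P ^ 3 * Λ :=
      one_le_mul_of_one_le_of_one_le (one_le_mul_of_one_le_of_one_le hsd (one_le_pow₀ hP1)) hΛ1
    calc (1 + α) / τ ≤ 5 * (√(d : ℝ) * P ^ 3 * Λ) / τ := by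
          gcongr
          linarith
      _ = 5 * (P ^ 3 * Λ * (√(d : ℝ) / τ)) := by ring
      _ ≤ 5 * (P ^ 8 * Λ * (T * √(d : ℝ) / τ)) := by gcongr
  have b4 : P ^ 8 * Λ * (T * √(d : ℝ) / τ)
      ≤ P ^ 8 * Λ * (T * √(d : ℝ) / (τ * ε ^ (1 / 4 : ℝ))) := by gcongr
  have b5 : 0 ≤ P ^ 8 * Λ * (T * √(d : ℝ) / (τ * ε ^ (1 / 4 : ℝ))) := by positivity
  have b6 : 0 ≤ P ^ 8 * Λ * (A : ℝ) := by positivity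
  linarith

end ICRL

end

theorem theorem2 :
    ∃ (C : ℝ) (p q : ℕ), 0 < C ∧
      ∀ (d A T : ℕ), 1 ≤ d → 1 ≤ A → 1 ≤ T →
      ∀ (σ b_a B_a B_w lam : ℝ), 0 < σ → 0 < b_a → 0 < B_a → 0 < B_w → 0 < lam →
      ∀ (ε τ : ℝ), 0 < ε → ε ≤ 1 → 0 < τ → τ ≤ 1 →
      ∃ (z L M D' : ℕ) (θ : TFParams (TokenIdx d A z) L M D') (R : ℝ),
        0 < R ∧
        Real.log R ≤ softFactor C p q d A T σ b_a B_a B_w lam ε τ ∧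
        (Fintype.card (TokenIdx d A z) : ℝ) ≤ C * (d * A) ∧
        (L : ℝ) ≤ softFactor C p q d A T σ b_a B_a B_w lam ε τ * √T ∧
        M ≤ 4 * A ∧
        (D' : ℝ) ≤ softFactor C p q d A T σ b_a B_a B_w lam ε τ
          * (d + A * √(T * d / (τ * ε))) ∧
        tfNorm θ ≤ softFactor C p q d A T σ b_a B_a B_w lam ε τ
          * (A + T * √d / (τ * ε ^ (1 / 4 : ℝ))) ∧
        ∀ (E : LinearBandit d A T), E.IsBounded b_a B_a B_w →
          ∀ (choice : Fin T → Fin A) (noise : Fin T → ℝ), (∀ t, |noise t| ≤ σ) →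
          ∀ (t : Fin T) (k : Fin A),
            |Real.log (softLinUCB lam (confWidth d T σ B_a B_w lam) τ
                (E.history choice noise t) k)
              - Real.log (inducedAlg R θ (E.history choice noise t) k)| ≤ ε := by
  refine ⟨100, 8, 1, by norm_num, ?_⟩
  intro d A T hd hA hT σ b B W lam hσ hb hB hW hlam ε τ hε hε1 hτ hτ1
  obtain ⟨P, hP⟩ : ∃ P, P = 1 + σ + b⁻¹ + B + W + lam + lam⁻¹ := ⟨_, rfl⟩
  obtain ⟨Λ, hΛ⟩ : ∃ Λ, Λ = 1 + Real.log T + Real.log A + Real.log d + Real.log (1 / ε)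
      + Real.log (1 / τ) := ⟨_, rfl⟩
  obtain ⟨Y, hY⟩ : ∃ Y : ℝ, Y = T * A * d * ε⁻¹ * τ⁻¹ := ⟨_, rfl⟩
  obtain ⟨hscale, hΛ1, hlogG, hAdY, hα⟩ :=
    scaleBounds_of_eq hd hA hT hσ hb hB hW hlam hε hε1 hτ hτ1 hP hΛ hY
  have hP1 := hscale.one_le_P
  have hG0 : 0 < P * Y := by linarith [hscale.le_G.2.2]
  have hsoft : softFactor 100 8 1 d A T σ b B W lam ε τ = 100 * P ^ 8 * Λ := by
    rw [softFactor, ← hP, ← hΛ, pow_one]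
  have hcard := Coord.card_le hd hA
  have hcardG : (Fintype.card (Coord d A) : ℝ) ≤ (P * Y) ^ 4 := by
    have h1 : (Fintype.card (Coord d A) : ℝ) ≤ 11 * (d * A) := by exact_mod_cast hcard
    have hG := hscale.le_G
    have h2 : 11 * (d * A) ≤ 3 ^ 3 * (P * Y) := by
      have : (d : ℝ) * A ≤ P * Y := by linarith [mul_comm (A : ℝ) d]
      have : (0 : ℝ) ≤ d * A := by positivity
      linarith
    calc _ ≤ 3 ^ 3 * (P * Y) := h1.trans h2
      _ ≤ (P * Y) ^ 3 * (P * Y) := by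
        have := hG.2.2
        gcongr
      _ = (P * Y) ^ 4 := by ring
  set k₀ : Fin A := ⟨0, hA⟩
  set p := network k₀ (P * Y) lam b B T τ (confWidth d T σ B W lam) with hp
  refine ⟨Fintype.card (Work d A), p.n₁ + 1 + p.n₂ + 1, 4 * A, 0,
    fun l => (p.layer d l).reindex (Coord.ofTokenIdx d A), (P * Y) ^ 17, by positivity, ?_, ?_, ?_,
    le_rfl, ?_, ?_, ?_⟩
  · rw [hsoft, Real.log_pow]
    have h1 : P * Λ ≤ P ^ 8 * Λ :=
      mul_le_mul_of_nonneg_right (le_self_pow₀ hP1 (by norm_num)) (by linarith)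
    have h2 : 0 ≤ P * Λ := by positivity
    push_cast
    linarith
  · rw [Fintype.card_congr (Coord.ofTokenIdx d A)]
    have h1 : (Fintype.card (Coord d A) : ℝ) ≤ 11 * (d * A) := by exact_mod_cast hcard
    have : (0 : ℝ) ≤ d * A := by positivity
    linarith
  · rw [hsoft]
    exact hscale.depth_le k₀ hΛ1 hlogG
  · rw [hsoft]
    push_cast
    positivity
  · rw [hsoft]
    refine (tfNorm_network_le hscale k₀ hτ1).trans ?_
    exact norm_bound_le hd hT hP1 hΛ1 hε hε1 hτ hτ1 hα
  · intro E hE choice noise hnoise t k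
    exact abs_log_softLinUCB_sub_le hscale k₀ hcardG hE choice hnoise t k
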